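/- Let $n\ge 1$, $\sigma>0$, $0<\alpha<2$, $\rho=1-\alpha/2$ and $0<\theta\le\rho$. Write $\langle x\rangle=(1+|x|^2)^{1/2}$ and $p=-i\nabla$ on $\mathbf R^n$. Let $V\in C^\infty(\mathbf R^n;\mathbf R)$ be such that for every multi-index $\beta$ there is a constant $C_\beta$ with $|\partial^\beta V(x)|\le C_\beta\langle x\rangle^{-\theta-|\beta|}$ for all sufficiently large $|x|$. On $L^2(\mathbf R^n)$ let $H_0$ be the closure of $p^2-\sigma|x|^\alpha$ on the Schwartz functions, let $H=H_0+V$, and let $\mathscr A$ be the closure of $$\langle x\rangle^{-\alpha}\,x\cdot p+p\cdot x\,\langle x\rangle^{-\alpha}$$ on the Schwartz functions. Then $H$ is self-adjoint, and for every real-valued $\varphi\in C_0^\infty(\mathbf R)$ the following holds. The operator $\varphi(H)$ maps $D(\langle x\rangle^{\rho})$ into $D(H)\cap D(\mathscr A)$. The commutator $i[H,\mathscr A]$, understood as the form $\langle u,i[H,\mathscr A]v\rangle=i\big(\langle Hu,\mathscr Av\rangle-\langle\mathscr Au,Hv\rangle\big)$ on $D(H)\cap D(\mathscr A)$ (inner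 products conjugate linear in the first entry), is such that the densely defined form $\varphi(H)\,i[H,\mathscr A]\,\varphi(H)$, that is $(u,v)\mapsto\langle\varphi(H)u,i[H,\mathscr A]\varphi(H)v\rangle$ for all $u,v\in L^2(\mathbf R^n)$ with $\varphi(H)u,\varphi(H)v\in D(H)\cap D(\mathscr A)$, is the form of a (unique) bounded operator on $L^2(\mathbf R^n)$. For this operator there is a compact operator $K$ on $L^2(\mathbf R^n)$ such that $$\varphi(H)\,i[H,\mathscr A]\,\varphi(H)\ \ge\ \alpha_0\,\varphi(H)^2+K,\qquad \alpha_0=\min\{\alpha\sigma,(2-\alpha)\sigma\}.$$ -/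

import Mathlib

open MeasureTheory
open scoped SchwartzMap ContDiff

namespace MourreRepulsive

noncomputable section

/-- Euclidean space `ℝⁿ`. -/
abbrev Rn (n : ℕ) := EuclideanSpace ℝ (Fin n)

/-- The complex Hilbert space `L²(ℝⁿ)`. -/
abbrev L2 (n : ℕ) := Lp ℂ 2 (volume : Measure (Rn n))

/-- `⟨x⟩ ^ s`, where `⟨x⟩ = (1 + |x|²) ^ (1/2)`. -/
def japPow {n : ℕ} (s : ℝ) (x : Rn n) : ℝ := (1 + ‖x‖ ^ 2) ^ (s / 2)

/-! ### Unbounded operators on `L²(ℝⁿ)` -/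

/-- The graph of the operator `f ↦ D f` with initial domain the Schwartz space
(those Schwartz functions `f` for which `D f` is square integrable). -/
def schwartzGraph {n : ℕ} (D : 𝓢(Rn n, ℂ) →ₗ[ℂ] (Rn n → ℂ)) : Submodule ℂ (L2 n × L2 n) where
  carrier := {q | ∃ f : 𝓢(Rn n, ℂ), q.1 =ᵐ[volume] f ∧ q.2 =ᵐ[volume] D f}
  zero_mem' := ⟨0, by
    simpa using Lp.coeFn_zero ℂ 2 (volume : Measure (Rn n)), by
    simpa using Lp.coeFn_zero ℂ 2 (volume : Measure (Rn n))⟩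
  add_mem' := by
    rintro a b ⟨f, hf₁, hf₂⟩ ⟨g, hg₁, hg₂⟩
    refine ⟨f + g, ?_, ?_⟩
    · filter_upwards [hf₁, hg₁, Lp.coeFn_add a.1 b.1] with x h1 h2 h3
      exact h3.trans (by rw [Pi.add_apply, h1, h2]; rfl)
    · filter_upwards [hf₂, hg₂, Lp.coeFn_add a.2 b.2] with x h1 h2 h3
      exact h3.trans (by rw [Pi.add_apply, h1, h2, map_add]; rfl)
  smul_mem' := by
    rintro c a ⟨f, hf₁, hf₂⟩
    refine ⟨c • f, ?_, ?_⟩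
    · filter_upwards [hf₁, Lp.coeFn_smul c a.1] with x h1 h3
      exact h3.trans (by rw [Pi.smul_apply, h1]; rfl)
    · filter_upwards [hf₂, Lp.coeFn_smul c a.2] with x h1 h3
      exact h3.trans (by rw [Pi.smul_apply, h1, map_smul]; rfl)

/-- The operator `f ↦ D f` in `L²(ℝⁿ)` on Schwartz functions. -/
def schwartzOp {n : ℕ} (D : 𝓢(Rn n, ℂ) →ₗ[ℂ] (Rn n → ℂ)) : L2 n →ₗ.[ℂ] L2 n :=
  (schwartzGraph D).toLinearPMap

/-- The set defining `schwartzOp D` is a graph, so `schwartzOp D` is really the operator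
`f ↦ D f`. -/
theorem schwartzOp_graph {n : ℕ} (D : 𝓢(Rn n, ℂ) →ₗ[ℂ] (Rn n → ℂ)) :
    (schwartzOp D).graph = schwartzGraph D := by
  refine Submodule.toLinearPMap_graph_eq _ ?_
  rintro ⟨u, v⟩ ⟨f, hf, hv⟩ (rfl : u = 0)
  have h0 : (f : Rn n → ℂ) =ᵐ[volume] (0 : Rn n → ℂ) :=
    hf.symm.trans (Lp.coeFn_zero ℂ 2 (volume : Measure (Rn n)))
  have h1 : (f : Rn n → ℂ) = 0 :=
    (Continuous.ae_eq_iff_eq volume f.continuous continuous_const).mp h0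
  have h2 : f = 0 := by
    ext x
    exact congrFun h1 x
  subst h2
  refine Lp.ext (hv.trans ?_)
  simpa using (Lp.coeFn_zero ℂ 2 (volume : Measure (Rn n))).symm

/-- The graph of multiplication by `g`. -/
def mulGraph {n : ℕ} (g : Rn n → ℝ) : Submodule ℂ (L2 n × L2 n) where
  carrier := {q | q.2 =ᵐ[volume] fun x => (g x : ℂ) * q.1 x}
  zero_mem' := by
    filter_upwards [Lp.coeFn_zero ℂ 2 (volume : Measure (Rn n))] with x h
    exact h.trans (by simp)
  add_mem' := by
    intro a b (ha : _ =ᵐ[volume] _) (hb : _ =ᵐ[volume] _)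
    filter_upwards [ha, hb, Lp.coeFn_add a.1 b.1, Lp.coeFn_add a.2 b.2] with x h1 h2 h3 h4
    refine h4.trans ?_
    rw [Pi.add_apply, h1, h2, ← mul_add]
    exact congrArg _ h3.symm
  smul_mem' := by
    intro c a (ha : _ =ᵐ[volume] _)
    filter_upwards [ha, Lp.coeFn_smul c a.1, Lp.coeFn_smul c a.2] with x h1 h3 h4
    refine h4.trans ?_
    rw [Pi.smul_apply, h1, smul_eq_mul, mul_left_comm]
    exact congrArg _ h3.symm

/-- Multiplication by the real function `g` in `L²(ℝⁿ)`,
with its maximal domain `{u | g u ∈ L²}`. -/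
def mulOp {n : ℕ} (g : Rn n → ℝ) : L2 n →ₗ.[ℂ] L2 n := (mulGraph g).toLinearPMap

theorem mulOp_graph {n : ℕ} (g : Rn n → ℝ) : (mulOp g).graph = mulGraph g := by
  refine Submodule.toLinearPMap_graph_eq _ ?_
  rintro ⟨u, v⟩ (hv : _ =ᵐ[volume] _) (rfl : u = 0)
  refine Lp.ext (hv.trans ?_)
  filter_upwards [Lp.coeFn_zero ℂ 2 (volume : Measure (Rn n))] with x h
  simp

/-! ### The Hamiltonian and the conjugate operator -/

/-- The momentum `p_j = -i ∂_j` on Schwartz functions. -/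
def momentum {n : ℕ} (j : Fin n) : 𝓢(Rn n, ℂ) →L[ℂ] 𝓢(Rn n, ℂ) :=
  (-Complex.I) • LineDeriv.lineDerivOpCLM ℂ 𝓢(Rn n, ℂ) (EuclideanSpace.single j (1 : ℝ))

/-- `p² = p · p = -Δ` on Schwartz functions. -/
def momentumSq (n : ℕ) : 𝓢(Rn n, ℂ) →L[ℂ] 𝓢(Rn n, ℂ) :=
  ∑ j : Fin n, (momentum j).comp (momentum j)

/-- The differential expression `p² - σ |x| ^ α`. -/
def freeExpr (n : ℕ) (σ α : ℝ) : 𝓢(Rn n, ℂ) →ₗ[ℂ] (Rn n → ℂ) where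
  toFun f := fun x => momentumSq n f x - ((σ * ‖x‖ ^ α : ℝ) : ℂ) * f x
  map_add' f g := by
    ext x
    simp
    ring
  map_smul' c f := by
    ext x
    simp
    ring

/-- The free Hamiltonian `H₀ = p² - σ |x| ^ α` on `L²(ℝⁿ)`
(closure from the Schwartz functions). -/
def freeHamiltonian (n : ℕ) (σ α : ℝ) : L2 n →ₗ.[ℂ] L2 n := (schwartzOp (freeExpr n σ α)).closure

/-- The Hamiltonian `H = H₀ + V`. -/
def hamiltonian {n : ℕ} (σ α : ℝ) (V : Rn n → ℝ) : L2 n →ₗ.[ℂ] L2 n :=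
  freeHamiltonian n σ α + mulOp V

/-- The `j`-th component of the vector field `⟨x⟩ ^ (-α) x`. -/
def weightedCoord {n : ℕ} (α : ℝ) (j : Fin n) (x : Rn n) : ℂ := ((japPow (-α) x * x j : ℝ) : ℂ)

theorem weightedCoord_hasTemperateGrowth {n : ℕ} (α : ℝ) (j : Fin n) :
    (weightedCoord (n := n) α j).HasTemperateGrowth := by
  have h1 : (fun x : Rn n => japPow (-α) x).HasTemperateGrowth :=
    Function.hasTemperateGrowth_one_add_norm_sq_rpow (Rn n) (-α / 2)
  have h2 : (fun x : Rn n => x j).HasTemperateGrowth :=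
    (EuclideanSpace.proj (𝕜 := ℝ) j : Rn n →L[ℝ] ℝ).hasTemperateGrowth
  exact Function.Complex.hasTemperateGrowth_ofReal.comp (h1.mul h2)

/-- Multiplication of Schwartz functions by `⟨x⟩ ^ (-α) x_j`. -/
def weightedMul {n : ℕ} (α : ℝ) (j : Fin n) : 𝓢(Rn n, ℂ) →L[ℂ] 𝓢(Rn n, ℂ) :=
  SchwartzMap.smulLeftCLM ℂ (weightedCoord α j)

theorem weightedMul_apply {n : ℕ} (α : ℝ) (j : Fin n) (f : 𝓢(Rn n, ℂ)) (x : Rn n) :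
    weightedMul α j f x = ((japPow (-α) x * x j : ℝ) : ℂ) * f x := by
  simp only [weightedMul,
    SchwartzMap.smulLeftCLM_apply_apply (weightedCoord_hasTemperateGrowth α j), smul_eq_mul]
  rfl

/-- The differential expression `⟨x⟩ ^ (-α) x · p + p · x ⟨x⟩ ^ (-α)`. -/
def conjugateExpr (n : ℕ) (α : ℝ) : 𝓢(Rn n, ℂ) →ₗ[ℂ] (Rn n → ℂ) where
  toFun f := fun x =>
    ∑ j : Fin n, (weightedMul α j (momentum j f) x + momentum j (weightedMul α j f) x)
  map_add' f g := by
    ext x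
    simp only [map_add, add_apply, Pi.add_apply, ← Finset.sum_add_distrib]
    exact Finset.sum_congr rfl fun j _ => by ring
  map_smul' c f := by
    ext x
    simp only [map_smul, smul_apply, Pi.smul_apply, smul_eq_mul, RingHom.id_apply,
      Finset.mul_sum]
    exact Finset.sum_congr rfl fun j _ => by ring

/-- The conjugate operator `𝒜 = ⟨x⟩ ^ (-α) x · p + p · x ⟨x⟩ ^ (-α)` on `L²(ℝⁿ)`
(closure from the Schwartz functions). -/
def conjugateOp (n : ℕ) (α : ℝ) : L2 n →ₗ.[ℂ] L2 n := (schwartzOp (conjugateExpr n α)).closure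

/-! ### Functional calculus and commutator form -/

section Abstract

variable {E : Type*} [NormedAddCommGroup E] [InnerProductSpace ℂ E]

/-- `R` is the bounded inverse of `T - z`. -/
def IsResolvent (T : E →ₗ.[ℂ] E) (z : ℂ) (R : E →L[ℂ] E) : Prop :=
  (∀ u : E, ∃ h : R u ∈ T.domain, T ⟨R u, h⟩ - z • R u = u) ∧
    ∀ u : T.domain, R (T u - z • (u : E)) = u

theorem IsResolvent.unique {T : E →ₗ.[ℂ] E} {z : ℂ} {R S : E →L[ℂ] E}
    (hR : IsResolvent T z R) (hS : IsResolvent T z S) : R = S := by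
  ext u
  obtain ⟨h, hu⟩ := hS.1 u
  have h2 := hR.2 ⟨S u, h⟩
  simp only [hu] at h2
  exact h2

open scoped Classical in
/-- The resolvent `(T - z)⁻¹` (and `0` if `z` is not in the resolvent set). -/
def resolventOp (T : E →ₗ.[ℂ] E) (z : ℂ) : E →L[ℂ] E :=
  if h : ∃ R, IsResolvent T z R then h.choose else 0

/-- The operator `φ(T)` for a self-adjoint operator `T` and a continuous function `φ : ℝ → ℝ`
vanishing at infinity. With the bounded normal operator `R = (T + i)⁻¹`, whose spectrum consists
of the points `w = (s + i)⁻¹`, `s ∈ σ(T)`, and possibly `w = 0`, it is `g(R)`, where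
`g((s + i)⁻¹) = φ(s)` and `g(0) = 0`. -/
def funcCalc [CompleteSpace E] (T : E →ₗ.[ℂ] E) (φ : ℝ → ℝ) : E →L[ℂ] E :=
  cfc (fun w : ℂ => if w = 0 then 0 else ((φ (w⁻¹).re : ℝ) : ℂ)) (resolventOp T (-Complex.I))

/-- The commutator `i[T, S]` of symmetric operators as a sesquilinear form on `D(T) ∩ D(S)`:
`⟨u, i[T, S] v⟩ = i (⟨T u, S v⟩ - ⟨S u, T v⟩)`, conjugate linear in `u`. -/
def commForm (T S : E →ₗ.[ℂ] E) (u v : ↥(T.domain ⊓ S.domain)) : ℂ :=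
  Complex.I * (inner ℂ (T ⟨u, u.2.1⟩) (S ⟨v, v.2.2⟩) - inner ℂ (S ⟨u, u.2.2⟩) (T ⟨v, v.2.1⟩))

end Abstract

end

end MourreRepulsive

open MourreRepulsive

namespace MourreRepulsive

noncomputable section

/-! ### Essentially self-adjoint operators given on a space mapping densely into `E` -/

section EssentiallySelfAdjoint

variable {E D : Type*} [NormedAddCommGroup E] [InnerProductSpace ℂ E]
  [AddCommGroup D] [Module ℂ D]

/-! Write `X = ⟨x⟩^(-α) x`, `w = V - σ|x|^α`, `ρ = 1 - α/2` and `R = (H + i)⁻¹`. Formally `𝒜 = 2 X·p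
- i div X`, and `i[H, 𝒜]` is `4 p·(DX)p - 2 X·∇w` plus terms with `∇ div X`. The Jacobian `DX =
⟨x⟩^(-α)(1 - α x⊗x/⟨x⟩²)` exceeds `(1 - α)⟨x⟩^(-α)` by a nonnegative matrix. At bounded energy `p²`
balances `σ|x|^α`, so between resolvents `p·⟨x⟩^(-α)p` equals `σ` up to a compact operator, whatever
the sign of `1 - α`; and `X·∇w` tends to `-σα`. The sum `4(1 - α)σ + 2ασ = 2(2 - α)σ` is a lower
bound modulo compact operators, and it exceeds the required constant. This is carried by
`cpt_sum_momOp_sub`, `isPositive_convexPart` and `cpt_commOp_sub`.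

Two analytic facts make this rigorous. First, `⟨x⟩^(-α/2) p_j R` is bounded
(`norm_weighted_momentum_le`): the weight `⟨x⟩^(-α)` tames the potential. Hence the commutator form
between resolvents is that of a bounded operator `commOp`. Second, `⟨x⟩^(-t) R` is compact for every
`t > 0` (`isCompactOperator_japPow_mul_res`), so every term with a decaying coefficient is
negligible.

Self-adjointness comes from density of the ranges of `p² + w ± i` on Schwartz functions. A vector
orthogonal to such a range is tested against cutoffs `η_ε = (1 + ε|x|²)⁻¹`. Since `α < 2`, the
commutator `[p², η_ε]` is small relative to `p² + w`, uniformly over truncations of `w`, and the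
vector must vanish (`denseRange_shift_schr`). All operators are then handled through resolvents
defined by extension from the core.

For the domain statement, `φ(H)` is expanded in powers of the Cayley transform with rapidly
decreasing coefficients (`exists_cayley_series`), so a commutator with `φ(H)` is bounded by the
commutator with `R`. Applied to regularizations of `⟨x⟩^ρ`, this shows that `φ(H)` preserves the
domain of `⟨x⟩^ρ`. Applied also to `s φ(s)`, it gives `φ(H)ψ = ⟨x⟩^(-ρ) R k`, and `𝒜⟨x⟩^(-ρ)R` is
bounded because `1 - α - ρ = -α/2`.

A vector in `D(H) ∩ D(𝒜)` need not obviously be a limit of Schwartz functions in both graph norms at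
once. The identity of the form with `commOp` is therefore proved with the cutoff inserted, where
everything is bounded, and the cutoff is then removed strongly (`inner_cutRes_commOp`, `cutConj_eq`,
`inner_commOp_eq`). -/

theorem denseRange_of_forall_inner_eq_zero [CompleteSpace E] {A : D →ₗ[ℂ] E}
    (h : ∀ ψ : E, (∀ f, inner ℂ (A f) ψ = 0) → ψ = 0) : DenseRange A := by
  have h1 : (LinearMap.range A).topologicalClosure = ⊤ := by
    rw [Submodule.topologicalClosure_eq_top_iff, Submodule.eq_bot_iff]
    intro ψ hψ
    refine h ψ fun f => ?_
    exact (Submodule.mem_orthogonal _ _).1 hψ _ (LinearMap.mem_range_self A f)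
  have h2 := (Submodule.dense_iff_topologicalClosure_eq_top).2 h1
  rwa [LinearMap.coe_range] at h2

theorem eq_of_denseRange_inner {A : D →ₗ[ℂ] E} (hA : DenseRange A) {u v : E}
    (h : ∀ f, inner ℂ (A f) u = inner ℂ (A f) v) : u = v := by
  have h2 : Dense ((LinearMap.range A : Submodule ℂ E) : Set E) := by
    rwa [LinearMap.coe_range]
  refine h2.eq_of_inner_right ℂ ?_
  rintro _ ⟨f, rfl⟩
  exact h f

/-- A relatively bounded perturbation with relative bound less than one of a map with dense
range has dense range. -/
theorem denseRange_add_of_norm_le [CompleteSpace E] {A C : D →ₗ[ℂ] E} (hA : DenseRange A) {k : ℝ}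
    (hk0 : 0 ≤ k) (hk : k < 1) (hC : ∀ f, ‖C f‖ ≤ k * ‖A f‖) : DenseRange (A + C) := by
  refine denseRange_of_forall_inner_eq_zero fun ψ hψ => ?_
  by_contra hne
  have hpos : 0 < ‖ψ‖ := norm_pos_iff.2 hne
  -- If `A f` is within `δ` of `ψ`, orthogonality to the range of `A + C` gives `‖ψ‖ ≤ δ + k(‖ψ‖ +
  -- δ)`, hence `(1 - k)‖ψ‖ ≤ 2δ`. A quarter of `(1 - k)‖ψ‖` makes this absurd.
  have hδ : 0 < (1 - k) * ‖ψ‖ / 4 := by have := sub_pos.2 hk; positivity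
  obtain ⟨f, hf⟩ := hA.exists_dist_lt ψ hδ
  rw [dist_eq_norm] at hf
  have h1 : inner ℂ ψ ψ = inner ℂ (ψ - A f) ψ - inner ℂ (C f) ψ := by
    have := hψ f
    rw [LinearMap.add_apply, inner_add_left] at this
    rw [inner_sub_left]
    linear_combination this
  have h2 : ‖ψ‖ ^ 2 ≤ ‖ψ - A f‖ * ‖ψ‖ + ‖C f‖ * ‖ψ‖ := by
    calc ‖ψ‖ ^ 2 = ‖inner ℂ ψ ψ‖ := by
          rw [inner_self_eq_norm_sq_to_K]; simp
      _ ≤ ‖inner ℂ (ψ - A f) ψ‖ + ‖inner ℂ (C f) ψ‖ := by rw [h1]; exact norm_sub_le _ _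
      _ ≤ _ := add_le_add (norm_inner_le_norm _ _) (norm_inner_le_norm _ _)
  have h3 : ‖A f‖ ≤ ‖ψ‖ + ‖ψ - A f‖ := by
    calc ‖A f‖ = ‖ψ - (ψ - A f)‖ := by congr 1; abel
      _ ≤ _ := norm_sub_le _ _
  have h4 : ‖ψ‖ ≤ ‖ψ - A f‖ + ‖C f‖ := by nlinarith
  have h5 := hC f
  nlinarith [mul_le_mul_of_nonneg_left h3 hk0]

/-- `T + z` as a map on the initial domain of `T`. -/
def shift (i T : D →ₗ[ℂ] E) (z : ℂ) : D →ₗ[ℂ] E := T + z • i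

theorem shift_apply (i T : D →ₗ[ℂ] E) (z : ℂ) (f : D) : shift i T z f = T f + z • i f := rfl

/-- Symmetry of `T` on its initial domain. -/
def SymmetricOn (i T : D →ₗ[ℂ] E) : Prop := ∀ f g, inner ℂ (T f) (i g) = inner ℂ (i f) (T g)

/-- Symmetry makes `⟨T f, f⟩` real, so the cross term produced by an imaginary shift has no real
part. This Pythagorean identity is the source of all resolvent bounds. -/
theorem SymmetricOn.norm_shift_sq {i T : D →ₗ[ℂ] E} (h : SymmetricOn i T) (t : ℝ) (f : D) :
    ‖shift i T (t * Complex.I) f‖ ^ 2 = ‖T f‖ ^ 2 + t ^ 2 * ‖i f‖ ^ 2 := by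
  have h1 : (inner ℂ (T f) (i f)).im = 0 := by
    have h2 := h f f
    rw [← inner_conj_symm (i f) (T f)] at h2
    exact Complex.conj_eq_iff_im.1 h2.symm
  rw [shift_apply, norm_add_sq (𝕜 := ℂ), norm_smul, inner_smul_right]
  simp [h1, mul_pow]

theorem SymmetricOn.norm_le_shift {i T : D →ₗ[ℂ] E} (h : SymmetricOn i T) (t : ℝ) (f : D) :
    ‖T f‖ ≤ ‖shift i T (t * Complex.I) f‖ := by
  refine le_of_sq_le_sq ?_ (norm_nonneg _)
  rw [h.norm_shift_sq]
  have : 0 ≤ t ^ 2 * ‖i f‖ ^ 2 := by positivity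
  linarith

theorem SymmetricOn.mul_norm_le_shift {i T : D →ₗ[ℂ] E} (h : SymmetricOn i T) (t : ℝ) (f : D) :
    |t| * ‖i f‖ ≤ ‖shift i T (t * Complex.I) f‖ := by
  refine le_of_sq_le_sq ?_ (norm_nonneg _)
  rw [h.norm_shift_sq, mul_pow, sq_abs]
  have : 0 ≤ ‖T f‖ ^ 2 := by positivity
  linarith

/-- The resolvent of the closure of `T`, as the extension of `(T + z) f ↦ f`. -/
def coreResolvent [CompleteSpace E] (i T : D →ₗ[ℂ] E) (z : ℂ) : E →L[ℂ] E := i.extendOfNorm (shift i T z)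

/-- `T` is symmetric on its initial domain, and `T ± i` have dense ranges. -/
structure EssSelfAdjoint (i T : D →ₗ[ℂ] E) : Prop where
  dense : DenseRange i
  symm : SymmetricOn i T
  plus : DenseRange (shift i T Complex.I)
  minus : DenseRange (shift i T (-Complex.I))

namespace EssSelfAdjoint

variable {i T : D →ₗ[ℂ] E} (h : EssSelfAdjoint i T)
include h

theorem norm_le_plus (f : D) : ‖i f‖ ≤ 1 * ‖shift i T Complex.I f‖ := by
  simpa using h.symm.mul_norm_le_shift 1 f

theorem norm_le_minus (f : D) : ‖i f‖ ≤ 1 * ‖shift i T (-Complex.I) f‖ := by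
  simpa using h.symm.mul_norm_le_shift (-1) f

theorem norm_apply_le_plus (f : D) : ‖T f‖ ≤ 1 * ‖shift i T Complex.I f‖ := by
  simpa using h.symm.norm_le_shift 1 f

variable [CompleteSpace E]

theorem resolvent_plus (f : D) :
    coreResolvent i T Complex.I (shift i T Complex.I f) = i f :=
  LinearMap.extendOfNorm_eq h.plus ⟨1, h.norm_le_plus⟩ f

theorem resolvent_minus (f : D) :
    coreResolvent i T (-Complex.I) (shift i T (-Complex.I) f) = i f :=
  LinearMap.extendOfNorm_eq h.minus ⟨1, h.norm_le_minus⟩ f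

theorem norm_resolvent_le : ‖coreResolvent i T Complex.I‖ ≤ 1 :=
  LinearMap.opNorm_extendOfNorm_le h.plus zero_le_one h.norm_le_plus

/-- On the dense ranges of `T + i` and `T - i` the relation reduces to the symmetry of `T`. -/
theorem adjoint_resolvent :
    (coreResolvent i T Complex.I).adjoint = coreResolvent i T (-Complex.I) := by
  ext v
  refine DenseRange.induction_on h.minus v
    (isClosed_eq (by fun_prop) (by fun_prop)) fun g => ?_
  rw [h.resolvent_minus]
  refine eq_of_denseRange_inner h.plus fun f => ?_
  rw [ContinuousLinearMap.adjoint_inner_right, h.resolvent_plus, shift_apply, shift_apply,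
    inner_add_left, inner_add_right, inner_smul_left, inner_smul_right, h.symm f g]
  simp

/-- The first resolvent identity at `±i`, checked on the dense range of `T + i`. Both orders of the
product are kept: together they give self-adjointness of the closure and normality of the resolvent.
-/
theorem resolvent_sub_left (v : E) :
    coreResolvent i T (-Complex.I) v - coreResolvent i T Complex.I v =
      (2 * Complex.I) • coreResolvent i T (-Complex.I) (coreResolvent i T Complex.I v) := by
  refine DenseRange.induction_on h.plus v
    (isClosed_eq (by fun_prop) (by fun_prop)) fun f => ?_
  rw [h.resolvent_plus]
  have h1 : shift i T Complex.I f = shift i T (-Complex.I) f + (2 * Complex.I) • i f := by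
    simp only [shift_apply]; module
  rw [h1, map_add, h.resolvent_minus, map_smul]
  abel

theorem resolvent_sub_right (v : E) :
    coreResolvent i T (-Complex.I) v - coreResolvent i T Complex.I v =
      (2 * Complex.I) • coreResolvent i T Complex.I (coreResolvent i T (-Complex.I) v) := by
  refine DenseRange.induction_on h.minus v
    (isClosed_eq (by fun_prop) (by fun_prop)) fun f => ?_
  rw [h.resolvent_minus]
  have h1 : shift i T (-Complex.I) f = shift i T Complex.I f - (2 * Complex.I) • i f := by
    simp only [shift_apply]; module
  rw [h1, map_sub, h.resolvent_plus, map_smul]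
  abel

/-- The right side is a closed condition that holds on the graph of `T`. Conversely, `(R k, k - iR
k)` depends continuously on `k` and lies in the graph of `T` for `k` in the dense range of `T + i`.
Closures can thus be treated without approximating sequences. -/
theorem mem_closure_iff (u v : E) :
    (u, v) ∈ (LinearMap.range (i.prod T)).topologicalClosure ↔
      coreResolvent i T Complex.I (v + Complex.I • u) = u := by
  constructor
  · intro huv
    have hcl : IsClosed {q : E × E | coreResolvent i T Complex.I (q.2 + Complex.I • q.1) = q.1} :=
      isClosed_eq (by fun_prop) (by fun_prop)
    have hsub : ((LinearMap.range (i.prod T) : Submodule ℂ (E × E)) : Set (E × E)) ⊆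
        {q : E × E | coreResolvent i T Complex.I (q.2 + Complex.I • q.1) = q.1} := by
      rintro _ ⟨f, rfl⟩
      exact h.resolvent_plus f
    exact closure_minimal hsub hcl huv
  · intro huv
    have key : ∀ k : E, (coreResolvent i T Complex.I k,
        k - Complex.I • coreResolvent i T Complex.I k) ∈
        (LinearMap.range (i.prod T)).topologicalClosure := by
      intro k
      refine DenseRange.induction_on (p := fun k : E => (coreResolvent i T Complex.I k,
        k - Complex.I • coreResolvent i T Complex.I k) ∈
        (LinearMap.range (i.prod T)).topologicalClosure) h.plus k ?_ ?_
      · exact (Submodule.isClosed_topologicalClosure _).preimage (by fun_prop)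
      · intro f
        refine Submodule.le_topologicalClosure _ ⟨f, ?_⟩
        rw [h.resolvent_plus, shift_apply, LinearMap.prod_apply, add_sub_cancel_right]
        rfl
    have := key (v + Complex.I • u)
    rw [huv] at this
    simpa using this

/-! #### Operators whose graph is the closure of `T` -/

variable {H : E →ₗ.[ℂ] E} (hH : H.graph = (LinearMap.range (i.prod T)).topologicalClosure)
include hH

theorem mem_graph_iff (u v : E) :
    (u, v) ∈ H.graph ↔ coreResolvent i T Complex.I (v + Complex.I • u) = u := by
  rw [hH, h.mem_closure_iff]

theorem resolvent_mem_graph (k : E) :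
    (coreResolvent i T Complex.I k, k - Complex.I • coreResolvent i T Complex.I k) ∈ H.graph := by
  rw [h.mem_graph_iff hH]; simp

theorem resolvent_mem_domain (k : E) : coreResolvent i T Complex.I k ∈ H.domain :=
  LinearPMap.mem_domain_of_mem_graph (h.resolvent_mem_graph hH k)

theorem apply_resolvent (k : E) (hk : coreResolvent i T Complex.I k ∈ H.domain) :
    H ⟨_, hk⟩ = k - Complex.I • coreResolvent i T Complex.I k :=
  ((LinearPMap.mem_graph_iff' H).1 (h.resolvent_mem_graph hH k)).elim fun y hy => by
    have h1 : y = ⟨_, hk⟩ := Subtype.ext (congrArg Prod.fst hy)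
    rw [← h1]; exact congrArg Prod.snd hy

theorem resolvent_apply (u : H.domain) :
    coreResolvent i T Complex.I (H u + Complex.I • (u : E)) = u :=
  (h.mem_graph_iff hH _ _).1 (LinearPMap.mem_graph H u)

theorem isResolvent : IsResolvent H (-Complex.I) (coreResolvent i T Complex.I) := by
  refine ⟨fun u => ⟨h.resolvent_mem_domain hH u, ?_⟩, fun u => ?_⟩
  · rw [h.apply_resolvent hH]; simp
  · simpa using h.resolvent_apply hH u

theorem resolventOp_eq : resolventOp H (-Complex.I) = coreResolvent i T Complex.I := by
  have hex : ∃ R, IsResolvent H (-Complex.I) R := ⟨_, h.isResolvent hH⟩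
  rw [resolventOp, dif_pos hex]
  exact hex.choose_spec.unique (h.isResolvent hH)

theorem dense_domain : Dense (H.domain : Set E) := by
  refine h.dense.mono ?_
  rintro _ ⟨f, rfl⟩
  rw [← h.resolvent_plus f]
  exact h.resolvent_mem_domain hH _

/-- Membership in the adjoint graph is a fixed-point equation for the resolvent at `i`, and
membership in the graph one for the resolvent at `-i`. The two resolvent identities convert each
equation into the other. -/
theorem isSelfAdjoint : IsSelfAdjoint H := by
  rw [LinearPMap.isSelfAdjoint_def]
  refine LinearPMap.eq_of_eq_graph ?_
  rw [LinearPMap.adjoint_graph_eq_graph_adjoint (h.dense_domain hH)]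
  ext ⟨u, v⟩
  rw [Submodule.mem_adjoint_iff, h.mem_graph_iff hH]
  have h1 : (∀ a b, (a, b) ∈ H.graph → inner ℂ b u - inner ℂ a v = 0) ↔
      coreResolvent i T (-Complex.I) (v - Complex.I • u) = u := by
    rw [← h.adjoint_resolvent]
    constructor
    · intro hab
      refine ext_inner_left ℂ fun k => ?_
      have h2 := hab _ _ (h.resolvent_mem_graph hH k)
      rw [inner_sub_left, inner_smul_left] at h2
      rw [ContinuousLinearMap.adjoint_inner_right, inner_sub_right, inner_smul_right]
      simp only [Complex.conj_I] at h2
      linear_combination -h2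
    · intro hu a b hab
      rw [h.mem_graph_iff hH] at hab
      set k := b + Complex.I • a with hk
      have h2 : b = k - Complex.I • a := by rw [hk]; abel
      have h3 : inner ℂ k u = inner ℂ a (v - Complex.I • u) := by
        rw [← hab, ← ContinuousLinearMap.adjoint_inner_right, hu]
      rw [h2, inner_sub_left, h3, inner_smul_left, inner_sub_right, inner_smul_right]
      simp only [Complex.conj_I]
      ring
  simp only [h1]
  constructor
  · intro hu
    have h2 := h.resolvent_sub_right (v - Complex.I • u)
    rw [hu] at h2
    have h3 : v + Complex.I • u = (v - Complex.I • u) + (2 * Complex.I) • u := by module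
    rw [h3, map_add, map_smul, ← h2]
    abel
  · intro hu
    have h2 := h.resolvent_sub_left (v + Complex.I • u)
    rw [hu] at h2
    have h3 : v - Complex.I • u = (v + Complex.I • u) - (2 * Complex.I) • u := by module
    rw [h3, map_sub, map_smul, ← h2]
    abel

end EssSelfAdjoint

end EssentiallySelfAdjoint

end

end MourreRepulsive


namespace MourreRepulsive

noncomputable section

/-! ### Fourier expansion of a test function in powers of the Cayley transform -/

section CayleySeries

open Real

/-- The test function `φ` in the angular variable of the Cayley transform. -/
def angularProfile (φ : ℝ → ℝ) (x : ℝ) : ℂ :=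
  if |x| < 1 / 2 then ((φ (tan (π * x)) : ℝ) : ℂ) else 0

/-- Compact support of `φ` bounds `|tan (πx)|`, so the profile dies strictly before the endpoints
`±1/2`. This makes the extension by zero smooth. -/
theorem exists_angular_support {φ : ℝ → ℝ} (hc : HasCompactSupport φ) :
    ∃ r < (1 / 2 : ℝ), ∀ x, r < |x| → angularProfile φ x = 0 := by
  obtain ⟨M, hM⟩ := hc.isCompact.isBounded.exists_norm_le
  have hMφ : ∀ s : ℝ, M < |s| → φ s = 0 := by
    intro s hs
    by_contra hne
    exact absurd (hM s (subset_tsupport _ hne)) (not_le.2 hs)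
  refine ⟨arctan M / π, ?_, fun x hx => ?_⟩
  · rw [div_lt_iff₀ pi_pos]; linarith [arctan_lt_pi_div_two M]
  · unfold angularProfile
    split_ifs with h
    · rw [hMφ, Complex.ofReal_zero]
      obtain ⟨h1, h2⟩ := abs_lt.1 h
      rw [div_lt_iff₀ pi_pos] at hx
      have e1 : arctan (tan (π * x)) = π * x :=
        arctan_tan (by nlinarith [pi_pos]) (by nlinarith [pi_pos])
      by_contra hle
      rw [not_lt] at hle
      rcases le_or_gt 0 x with h0 | h0
      · have := arctan_strictMono.monotone ((le_abs_self _).trans hle)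
        rw [e1] at this
        rw [abs_of_nonneg h0] at hx
        linarith
      · have := arctan_strictMono.monotone ((neg_le_abs _).trans hle)
        rw [arctan_neg, e1] at this
        rw [abs_of_neg h0] at hx
        linarith
    · rfl

theorem contDiff_angularProfile {φ : ℝ → ℝ} (hφ : ContDiff ℝ ∞ φ) (hc : HasCompactSupport φ) :
    ContDiff ℝ ∞ (angularProfile φ) := by
  obtain ⟨r, hr, h0⟩ := exists_angular_support hc
  rw [contDiff_iff_contDiffAt]
  intro x
  rcases lt_or_ge |x| (1 / 2) with hx | hx
  · have hev : angularProfile φ =ᶠ[nhds x] fun y => ((φ (tan (π * y)) : ℝ) : ℂ) := by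
      filter_upwards [(continuous_abs.isOpen_preimage _ isOpen_Iio).mem_nhds hx] with y hy
      exact if_pos hy
    refine ContDiffAt.congr_of_eventuallyEq ?_ hev
    have hcos : cos (π * x) ≠ 0 := by
      obtain ⟨h1, h2⟩ := abs_lt.1 hx
      exact (cos_pos_of_mem_Ioo ⟨by nlinarith [pi_pos], by nlinarith [pi_pos]⟩).ne'
    have h1 : ContDiffAt ℝ ∞ (fun y : ℝ => tan (π * y)) x :=
      (contDiffAt_tan.2 hcos).comp x (contDiffAt_const.mul contDiffAt_id)
    have h2 : ContDiffAt ℝ ∞ (fun y : ℝ => φ (tan (π * y))) x := hφ.contDiffAt.comp x h1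
    exact Complex.ofRealCLM.contDiff.contDiffAt.comp x h2
  · have hev : angularProfile φ =ᶠ[nhds x] fun _ => 0 := by
      filter_upwards [(continuous_abs.isOpen_preimage _ isOpen_Ioi).mem_nhds
        (show r < |x| by linarith)] with y hy
      exact h0 y hy
    exact contDiffAt_const.congr_of_eventuallyEq hev

theorem hasCompactSupport_angularProfile {φ : ℝ → ℝ} :
    HasCompactSupport (angularProfile φ) := by
  refine HasCompactSupport.intro (isCompact_Icc (a := (-1 : ℝ)) (b := 1)) fun x hx => ?_
  refine if_neg fun h => hx ?_
  obtain ⟨h1, h2⟩ := abs_lt.1 h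
  exact ⟨by linarith, by linarith⟩

/-- With `s = sin a / cos a`, the numerator and the denominator are `e^(ia)` and `e^(-ia)`, both
divided by `cos a`. -/
theorem cayley_eq_exp (s : ℝ) :
    Complex.exp (2 * arctan s * Complex.I) = (1 + s * Complex.I) / (1 - s * Complex.I) := by
  set a := arctan s
  have hc : (cos a : ℂ) ≠ 0 := by exact_mod_cast (cos_arctan_pos s).ne'
  have hs : (s : ℂ) = sin a / cos a := by
    rw [← Complex.ofReal_div, ← tan_eq_sin_div_cos, tan_arctan]
  have h1 : (sin a : ℂ) ^ 2 + (cos a : ℂ) ^ 2 = 1 := by exact_mod_cast sin_sq_add_cos_sq a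
  have hne : (1 : ℂ) - s * Complex.I ≠ 0 := by
    intro h
    have := congrArg Complex.re h
    simp at this
  rw [eq_div_iff hne, mul_assoc, two_mul, Complex.exp_add, Complex.exp_mul_I,
    ← Complex.ofReal_cos, ← Complex.ofReal_sin, hs]
  field_simp
  linear_combination (cos a + sin a * Complex.I) * h1 -
    (sin a : ℂ) ^ 2 * (cos a + sin a * Complex.I) * Complex.I_sq

/-- Poisson summation: the periodized angular profile has the Fourier transform at the integers as
its coefficients, and these decay rapidly. Summability with the factor `|n|` is what commutators
need; the last identity is the value at `s = ∞`, where the Cayley transform is `-1`. -/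
theorem exists_cayley_series {φ : ℝ → ℝ} (hφ : ContDiff ℝ ∞ φ) (hc : HasCompactSupport φ) :
    ∃ a : ℤ → ℂ, Summable (fun n => ‖a n‖) ∧ Summable (fun n : ℤ => |(n : ℝ)| * ‖a n‖) ∧
      (∀ s : ℝ, (φ s : ℂ) = ∑' n : ℤ, a n * ((1 + s * Complex.I) / (1 - s * Complex.I)) ^ n) ∧
      (0 : ℂ) = ∑' n : ℤ, a n * (-1) ^ n := by
  obtain ⟨r, hr, h0⟩ := exists_angular_support hc
  set f : 𝓢(ℝ, ℂ) := hasCompactSupport_angularProfile.toSchwartzMap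
    (contDiff_angularProfile hφ hc) with hf
  have hfx : ∀ x, f x = angularProfile φ x := fun x => rfl
  have hpois := SchwartzMap.tsum_eq_tsum_fourier f
  have hdec : ∀ k : ℕ, ∃ C, ∀ n : ℤ, |(n : ℝ)| ^ k * ‖FourierTransform.fourier f (n : ℝ)‖ ≤ C := by
    intro k
    obtain ⟨C, hC⟩ := (FourierTransform.fourier f).decay k 0
    exact ⟨C, fun n => by simpa using hC.2 n⟩
  have hsum : ∀ j : ℕ, Summable fun n : ℤ => |(n : ℝ)| ^ j * ‖FourierTransform.fourier f (n : ℝ)‖ := by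
    intro j
    -- Two surplus powers of decay leave the summable majorant `1 / n²`.
    obtain ⟨C, hC⟩ := hdec (j + 2)
    refine Summable.of_norm_bounded_eventually
      (g := fun n : ℤ => C * (1 / (n : ℝ) ^ 2)) ?_ ?_
    · exact (Real.summable_one_div_int_pow.2 one_lt_two).mul_left C
    · have : ∀ᶠ n : ℤ in Filter.cofinite, n ≠ 0 :=
        (Set.finite_singleton (0 : ℤ)).compl_mem_cofinite
      filter_upwards [this] with n hn
      have hn' : (0 : ℝ) < (n : ℝ) ^ 2 := by positivity
      rw [norm_of_nonneg (by positivity), mul_one_div, le_div_iff₀ hn']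
      calc _ = |(n : ℝ)| ^ (j + 2) * ‖FourierTransform.fourier f (n : ℝ)‖ := by
            rw [pow_add, sq_abs]; ring
        _ ≤ C := hC n
  -- For `n ≠ 0` the translate has `|x + n| ≥ 1/2`, where the profile is zero; the strict inequality
  -- in its definition is what includes the endpoint `x = 1/2`.
  have hval : ∀ x : ℝ, |x| ≤ 1 / 2 → ∑' n : ℤ, f (x + n) = f x := by
    intro x hx
    rw [tsum_eq_single 0]
    · simp
    · intro n hn
      rw [hfx]
      refine if_neg (not_lt.2 ?_)
      have h1 : (1 : ℝ) ≤ |(n : ℝ)| := by exact_mod_cast Int.one_le_abs hn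
      have h2 : |(n : ℝ)| ≤ |x + n| + |x| := by
        calc |(n : ℝ)| = |(x + n) - x| := by ring_nf
          _ ≤ _ := abs_sub _ _
      linarith
  refine ⟨fun n => FourierTransform.fourier f (n : ℝ), by simpa using hsum 0, by simpa using hsum 1,
    fun s => ?_, ?_⟩
  · have hs1 : |arctan s / π| < 1 / 2 := by
      rw [abs_div, abs_of_pos pi_pos, div_lt_iff₀ pi_pos, abs_lt]
      constructor <;> linarith [arctan_lt_pi_div_two s, neg_pi_div_two_lt_arctan s]
    have h2 := (hval _ hs1.le).symm.trans (hpois (arctan s / π))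
    rw [hfx, angularProfile, if_pos hs1, mul_div_cancel₀ _ pi_ne_zero, tan_arctan] at h2
    rw [h2]
    refine tsum_congr fun n => ?_
    rw [fourier_coe_apply, ← cayley_eq_exp, ← Complex.exp_int_mul]
    congr 2
    have : (π : ℂ) ≠ 0 := by exact_mod_cast pi_ne_zero
    push_cast
    field_simp
  · have h2 := (hval (1 / 2) (by norm_num)).symm.trans (hpois (1 / 2))
    rw [hfx, angularProfile, if_neg (by norm_num)] at h2
    rw [h2]
    refine tsum_congr fun n => ?_
    rw [fourier_coe_apply, ← Complex.exp_pi_mul_I, ← Complex.exp_int_mul]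
    congr 2
    push_cast
    field_simp

end CayleySeries

end

end MourreRepulsive


namespace MourreRepulsive

noncomputable section

/-! ### Functional calculus of the resolvent through powers of the Cayley transform -/

section FunctionalCalculus

variable {E D : Type*} [NormedAddCommGroup E] [InnerProductSpace ℂ E] [CompleteSpace E]
  [AddCommGroup D] [Module ℂ D]

/-- The function `w ↦ φ(s)`, `w = (s + i)⁻¹`, of `funcCalc`. -/
def resolventSymbol (φ : ℝ → ℝ) (w : ℂ) : ℂ := if w = 0 then 0 else ((φ (w⁻¹).re : ℝ) : ℂ)

/-- The Cayley transform in terms of the resolvent variable `w = (s + i)⁻¹`. -/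
def cayley (w : ℂ) : ℂ := -1 + 2 * Complex.I * w

/-- The unit circle in the Cayley variable is the circle `|w|² = -Im w`, which inversion sends to
the line of imaginary part one. -/
theorem inv_eq_of_norm_cayley {w : ℂ} (hw : ‖cayley w‖ = 1) (h0 : w ≠ 0) :
    w⁻¹ = (w⁻¹).re + Complex.I := by
  have h1 : Complex.normSq (cayley w) = 1 := by rw [Complex.normSq_eq_norm_sq, hw, one_pow]
  have h2 : Complex.normSq w ≠ 0 := by simpa using h0
  have h3 : Complex.normSq w = -w.im := by
    rw [Complex.normSq_apply] at h1 ⊢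
    simp [cayley] at h1
    linarith
  apply Complex.ext
  · simp
  · rw [Complex.inv_im, h3]
    rw [h3] at h2
    simp [neg_ne_zero.1 h2]

theorem resolventSymbol_eq_tsum {φ : ℝ → ℝ} {a : ℤ → ℂ}
    (ha : ∀ s : ℝ, (φ s : ℂ) = ∑' n : ℤ, a n * ((1 + s * Complex.I) / (1 - s * Complex.I)) ^ n)
    (ha0 : (0 : ℂ) = ∑' n : ℤ, a n * (-1) ^ n) {w : ℂ} (hw : ‖cayley w‖ = 1) :
    resolventSymbol φ w = ∑' n : ℤ, a n * cayley w ^ n := by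
  unfold resolventSymbol
  split_ifs with h0
  · simpa [h0, cayley] using ha0
  · rw [ha]
    refine tsum_congr fun n => ?_
    congr 2
    have h1 := inv_eq_of_norm_cayley hw h0
    set s := (w⁻¹).re
    have h2 : w * (s + Complex.I) = 1 := by rw [← h1]; exact mul_inv_cancel₀ h0
    have hne : (1 : ℂ) - s * Complex.I ≠ 0 := by
      intro h
      have := congrArg Complex.re h
      simp at this
    rw [div_eq_iff hne, cayley]
    linear_combination -2 * h2 + (2 * w * s) * Complex.I_sq

namespace EssSelfAdjoint

variable {i T : D →ₗ[ℂ] E} (h : EssSelfAdjoint i T)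
include h

theorem adjoint_mul_resolvent :
    star (coreResolvent i T Complex.I) - coreResolvent i T Complex.I =
      (2 * Complex.I) • (star (coreResolvent i T Complex.I) * coreResolvent i T Complex.I) := by
  ext v
  rw [ContinuousLinearMap.star_eq_adjoint, h.adjoint_resolvent]
  exact h.resolvent_sub_left v

theorem resolvent_mul_adjoint :
    star (coreResolvent i T Complex.I) - coreResolvent i T Complex.I =
      (2 * Complex.I) • (coreResolvent i T Complex.I * star (coreResolvent i T Complex.I)) := by
  ext v
  rw [ContinuousLinearMap.star_eq_adjoint, h.adjoint_resolvent]
  exact h.resolvent_sub_right v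

theorem isStarNormal_resolvent : IsStarNormal (coreResolvent i T Complex.I) := by
  refine ⟨?_⟩
  have h1 := h.adjoint_mul_resolvent
  rw [h.resolvent_mul_adjoint] at h1
  have h2 : (2 * Complex.I : ℂ) ≠ 0 := by simp
  exact (smul_right_injective _ h2 h1).symm

theorem cfc_cayley :
    cfc cayley (coreResolvent i T Complex.I) = -1 + (2 * Complex.I) • coreResolvent i T Complex.I := by
  have := h.isStarNormal_resolvent
  unfold cayley
  rw [cfc_const_add (-1 : ℂ) (fun w => 2 * Complex.I * w) _ (by fun_prop),
    cfc_const_mul_id (2 * Complex.I) (coreResolvent i T Complex.I)]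
  simp

/-- The resolvent identities say that `-1 + 2iR` is unitary, so spectral mapping puts the Cayley
values on the unit circle. This locates the spectrum of `R` without describing the spectrum of the
unbounded operator. -/
theorem norm_cayley_eq_one {w : ℂ} (hw : w ∈ spectrum ℂ (coreResolvent i T Complex.I)) :
    ‖cayley w‖ = 1 := by
  have := h.isStarNormal_resolvent
  have h1 : cayley w ∈ spectrum ℂ (cfc cayley (coreResolvent i T Complex.I)) := by
    rw [cfc_map_spectrum cayley (coreResolvent i T Complex.I) (ha := this)
      (hf := by unfold cayley; fun_prop)]
    exact ⟨w, hw, rfl⟩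
  refine spectrum.norm_eq_one_of_unitary ?_ h1
  rw [h.cfc_cayley, Unitary.mem_iff]
  set R := coreResolvent i T Complex.I
  have e1 := h.adjoint_mul_resolvent
  have e2 := h.resolvent_mul_adjoint
  have hI : (2 * Complex.I) * (2 * Complex.I) = (-4 : ℂ) := by
    linear_combination 4 * Complex.I_sq
  have hs : star (-1 + (2 * Complex.I) • R) = -1 - (2 * Complex.I) • star R := by
    rw [star_add, star_smul, star_neg, star_one, sub_eq_add_neg, ← neg_smul]
    congr 2
    simp
  rw [hs]
  constructor
  · have : (-1 - (2 * Complex.I) • star R) * (-1 + (2 * Complex.I) • R) =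
        1 + (2 * Complex.I) • (star R - R) - ((2 * Complex.I) * (2 * Complex.I)) • (star R * R) := by
      rw [sub_mul, mul_add, mul_add, smul_mul_smul_comm, smul_mul_assoc, smul_sub]
      simp only [mul_neg, neg_mul, mul_one, one_mul, neg_neg]
      module
    rw [this, e1, smul_smul, add_sub_cancel_right]
  · have : (-1 + (2 * Complex.I) • R) * (-1 - (2 * Complex.I) • star R) =
        1 + (2 * Complex.I) • (star R - R) - ((2 * Complex.I) * (2 * Complex.I)) • (R * star R) := by
      rw [add_mul, mul_sub, mul_sub, smul_mul_smul_comm, smul_mul_assoc, smul_sub]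
      simp only [mul_neg, neg_mul, mul_one, one_mul, neg_neg]
      module
    rw [this, e2, smul_smul, add_sub_cancel_right]

theorem continuousOn_cayley_zpow (n : ℤ) :
    ContinuousOn (fun w => cayley w ^ n) (spectrum ℂ (coreResolvent i T Complex.I)) := by
  refine ContinuousOn.zpow₀ (by unfold cayley; fun_prop) n fun w hw => Or.inl ?_
  rw [← norm_ne_zero_iff, h.norm_cayley_eq_one hw]
  exact one_ne_zero

theorem norm_cayley_zpow_le (n : ℤ) :
    ‖cfc (fun w => cayley w ^ n) (coreResolvent i T Complex.I)‖ ≤ 1 := by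
  refine norm_cfc_le zero_le_one fun w hw => ?_
  rw [norm_zpow, h.norm_cayley_eq_one hw, one_zpow]

theorem tendsto_cayley_series {φ : ℝ → ℝ} {a : ℤ → ℂ} (hs : Summable fun n => ‖a n‖)
    (ha : ∀ s : ℝ, (φ s : ℂ) = ∑' n : ℤ, a n * ((1 + s * Complex.I) / (1 - s * Complex.I)) ^ n)
    (ha0 : (0 : ℂ) = ∑' n : ℤ, a n * (-1) ^ n) :
    ContinuousOn (resolventSymbol φ) (spectrum ℂ (coreResolvent i T Complex.I)) ∧
    Filter.Tendsto (fun F : Finset ℤ => ∑ n ∈ F, a n •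
      cfc (fun w => cayley w ^ n) (coreResolvent i T Complex.I)) Filter.atTop
      (nhds (cfc (resolventSymbol φ) (coreResolvent i T Complex.I))) := by
  have := h.isStarNormal_resolvent
  have hb : ∀ (n : ℤ) (w : ℂ), w ∈ spectrum ℂ (coreResolvent i T Complex.I) →
      ‖a n * cayley w ^ n‖ ≤ ‖a n‖ := by
    intro n w hw
    rw [norm_mul, norm_zpow, h.norm_cayley_eq_one hw, one_zpow, mul_one]
  have heq : Set.EqOn (resolventSymbol φ) (fun w => ∑' n : ℤ, a n * cayley w ^ n)
      (spectrum ℂ (coreResolvent i T Complex.I)) :=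
    fun w hw => resolventSymbol_eq_tsum ha ha0 (h.norm_cayley_eq_one hw)
  have hcn : ∀ n : ℤ, ContinuousOn (fun w => a n * cayley w ^ n)
      (spectrum ℂ (coreResolvent i T Complex.I)) :=
    fun n => continuousOn_const.mul (h.continuousOn_cayley_zpow n)
  refine ⟨(continuousOn_tsum hcn hs hb).congr heq, ?_⟩
  rw [cfc_congr heq]
  have h1 := tendsto_cfc_fun (a := coreResolvent i T Complex.I) (tendstoUniformlyOn_tsum hs hb)
    (Filter.Eventually.of_forall fun F => continuousOn_finsetSum _ fun n _ => hcn n)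
  refine h1.congr fun F => ?_
  have h2 := cfc_sum (fun n w => a n * cayley w ^ n) (coreResolvent i T Complex.I) F
    (fun n _ => hcn n)
  rw [show (fun x => ∑ n ∈ F, a n * cayley x ^ n) = ∑ n ∈ F, fun w => a n * cayley w ^ n by
    ext x; simp, h2]
  refine Finset.sum_congr rfl fun n _ => ?_
  exact cfc_const_mul (a n) _ _ (h.continuousOn_cayley_zpow n)

/-- Since `[M, U^(m+k)] = [M, U^m]U^k + U^m[M, U^k]` and powers of the unitary `U` are contractions,
each step costs at most `‖[M, U]‖`. Negative powers use `U⁻¹ = U*`, which is why `M` is taken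
self-adjoint. -/
theorem norm_commutator_zpow_le {M : E →L[ℂ] E} (hM : IsSelfAdjoint M) {c : ℝ}
    (hc : ‖M * coreResolvent i T Complex.I - coreResolvent i T Complex.I * M‖ ≤ c) (n : ℤ) :
    ‖M * cfc (fun w => cayley w ^ n) (coreResolvent i T Complex.I) -
      cfc (fun w => cayley w ^ n) (coreResolvent i T Complex.I) * M‖ ≤ |(n : ℝ)| * (2 * c) := by
  have hN := h.isStarNormal_resolvent
  set R := coreResolvent i T Complex.I with hR
  set W : ℤ → E →L[ℂ] E := fun n => cfc (fun w => cayley w ^ n) R with hW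
  have hmul : ∀ m n : ℤ, W (m + n) = W m * W n := by
    intro m n
    rw [hW, ← cfc_mul _ _ R (h.continuousOn_cayley_zpow m) (h.continuousOn_cayley_zpow n)]
    refine cfc_congr fun w hw => ?_
    refine zpow_add₀ ?_ m n
    rw [← norm_ne_zero_iff, h.norm_cayley_eq_one hw]
    exact one_ne_zero
  have h1 : ‖M * W 1 - W 1 * M‖ ≤ 2 * c := by
    have e : W 1 = -1 + (2 * Complex.I) • R := by
      rw [hW, ← h.cfc_cayley]; simp only [zpow_one]; rfl
    have e2 : M * W 1 - W 1 * M = (2 * Complex.I) • (M * R - R * M) := by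
      rw [e, mul_add, add_mul, mul_smul_comm, smul_mul_assoc, smul_sub]
      simp only [mul_neg, neg_mul, mul_one, one_mul]
      abel
    rw [e2, norm_smul]
    simpa using hc
  have hm1 : ‖M * W (-1) - W (-1) * M‖ ≤ 2 * c := by
    have e : W (-1) = star (W 1) := by
      rw [hW, ← cfc_star]
      refine cfc_congr fun w hw => ?_
      simp only [zpow_neg, zpow_one]
      rw [Complex.inv_eq_conj (h.norm_cayley_eq_one hw)]
      rfl
    have e2 : M * W (-1) - W (-1) * M = -star (M * W 1 - W 1 * M) := by
      rw [e, star_sub, star_mul, star_mul, hM.star_eq]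
      abel
    rw [e2, norm_neg, norm_star]
    exact h1
  have step : ∀ m k : ℤ, ‖M * W k - W k * M‖ ≤ 2 * c →
      ‖M * W (m + k) - W (m + k) * M‖ ≤ ‖M * W m - W m * M‖ + 2 * c := by
    intro m k hk
    have e : M * W (m + k) - W (m + k) * M = (M * W m - W m * M) * W k + W m * (M * W k - W k * M) := by
      rw [hmul]; noncomm_ring
    rw [e]
    refine (norm_add_le _ _).trans (add_le_add ?_ ?_)
    · exact (norm_mul_le _ _).trans (mul_le_of_le_one_right (norm_nonneg _) (h.norm_cayley_zpow_le k))
    · exact (norm_mul_le _ _).trans ((mul_le_of_le_one_left (norm_nonneg _)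
        (h.norm_cayley_zpow_le m)).trans hk)
  have h0 : M * W 0 - W 0 * M = 0 := by
    have : W 0 = 1 := by
      rw [hW]; simp only [zpow_zero]; exact cfc_const_one ℂ R
    rw [this]; simp
  change ‖M * W n - W n * M‖ ≤ _
  induction n with
  | zero => rw [h0]; simp
  | succ k ih =>
    refine (step k 1 h1).trans ?_
    push_cast at ih ⊢
    rw [abs_of_nonneg (by positivity)] at ih ⊢
    linarith
  | pred k ih =>
    refine (step (-k) (-1) hm1).trans ?_
    push_cast at ih ⊢
    rw [abs_neg, abs_of_nonneg (by positivity)] at ih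
    rw [abs_of_nonpos (by linarith [(Nat.cast_nonneg k : (0 : ℝ) ≤ k)])]
    linarith

omit h in
/-- Commutators with `φ(T)` are controlled by commutators with the resolvent. -/
theorem exists_norm_commutator_cfc_le {φ : ℝ → ℝ} (hφ : ContDiff ℝ ∞ φ)
    (hc : HasCompactSupport φ) : ∃ C : ℝ, 0 ≤ C ∧ ∀ (i T : D →ₗ[ℂ] E), EssSelfAdjoint i T →
      ∀ M : E →L[ℂ] E, IsSelfAdjoint M → ∀ c : ℝ,
      ‖M * coreResolvent i T Complex.I - coreResolvent i T Complex.I * M‖ ≤ c →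
      ‖M * cfc (resolventSymbol φ) (coreResolvent i T Complex.I) -
        cfc (resolventSymbol φ) (coreResolvent i T Complex.I) * M‖ ≤ C * c := by
  obtain ⟨a, hs, hs1, ha, ha0⟩ := exists_cayley_series hφ hc
  -- The constant depends on `φ` alone. Its independence of `T` and `M` gives bounds that survive
  -- the removal of a regularization.
  refine ⟨2 * ∑' n : ℤ, |(n : ℝ)| * ‖a n‖,
    mul_nonneg zero_le_two (tsum_nonneg fun n => by positivity), fun i T h M hM c hMc => ?_⟩
  have h1 := (h.tendsto_cayley_series hs ha ha0).2
  have h2 := ((h1.const_mul M).sub (h1.mul_const M)).norm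
  refine le_of_tendsto' h2 fun F => ?_
  have hc0 : 0 ≤ c := (norm_nonneg _).trans hMc
  calc _ = ‖∑ n ∈ F, a n • (M * cfc (fun w => cayley w ^ n) (coreResolvent i T Complex.I) -
      cfc (fun w => cayley w ^ n) (coreResolvent i T Complex.I) * M)‖ := by
        rw [Finset.mul_sum, Finset.sum_mul, ← Finset.sum_sub_distrib]
        congr 1
        refine Finset.sum_congr rfl fun n _ => ?_
        rw [mul_smul_comm, smul_mul_assoc, smul_sub]
    _ ≤ ∑ n ∈ F, (|(n : ℝ)| * ‖a n‖) * (2 * c) := by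
        refine norm_sum_le_of_le _ fun n _ => ?_
        rw [norm_smul]
        calc _ ≤ ‖a n‖ * (|(n : ℝ)| * (2 * c)) :=
              mul_le_mul_of_nonneg_left (h.norm_commutator_zpow_le hM hMc n) (norm_nonneg _)
          _ = _ := by ring
    _ = (∑ n ∈ F, |(n : ℝ)| * ‖a n‖) * (2 * c) := by rw [Finset.sum_mul]
    _ ≤ (∑' n : ℤ, |(n : ℝ)| * ‖a n‖) * (2 * c) :=
        mul_le_mul_of_nonneg_right (hs1.sum_le_tsum F fun n _ => by positivity) (by positivity)
    _ = _ := by ring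

variable {φ : ℝ → ℝ} (hφ : ContDiff ℝ ∞ φ) (hc : HasCompactSupport φ)
include hφ hc

theorem continuousOn_resolventSymbol :
    ContinuousOn (resolventSymbol φ) (spectrum ℂ (coreResolvent i T Complex.I)) := by
  obtain ⟨a, hs, -, ha, ha0⟩ := exists_cayley_series hφ hc
  exact (h.tendsto_cayley_series hs ha ha0).1

omit h hφ hc in
theorem isSelfAdjoint_cfc :
    IsSelfAdjoint (cfc (resolventSymbol φ) (coreResolvent i T Complex.I)) := by
  rw [isSelfAdjoint_iff, ← cfc_star]
  refine cfc_congr fun w _ => ?_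
  unfold resolventSymbol
  split_ifs <;> simp

/-- `φ(H) = (H + i)⁻¹ (H φ(H) + i φ(H))`. -/
theorem cfc_eq_resolvent_mul :
    cfc (resolventSymbol φ) (coreResolvent i T Complex.I) = coreResolvent i T Complex.I *
      (cfc (resolventSymbol fun s => s * φ s) (coreResolvent i T Complex.I) +
        Complex.I • cfc (resolventSymbol φ) (coreResolvent i T Complex.I)) := by
  have hN := h.isStarNormal_resolvent
  have c1 := h.continuousOn_resolventSymbol hφ hc
  have c2 := h.continuousOn_resolventSymbol (φ := fun s => s * φ s) (contDiff_id.mul hφ)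
    (hc.mul_left)
  set R := coreResolvent i T Complex.I
  have c3 : ContinuousOn (fun w => Complex.I * resolventSymbol φ w) (spectrum ℂ R) :=
    continuousOn_const.mul c1
  rw [← cfc_const_mul _ _ R c1, ← cfc_add R _ _ c2 c3]
  have e := cfc_mul id (fun w => resolventSymbol (fun s => s * φ s) w +
    Complex.I * resolventSymbol φ w) R continuousOn_id (c2.add c3)
  rw [cfc_id ℂ R] at e
  rw [← e]
  refine cfc_congr fun w hw => ?_
  have hw1 := h.norm_cayley_eq_one hw
  simp only [resolventSymbol, id]
  split_ifs with h0
  · simp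
  · have h1 := inv_eq_of_norm_cayley hw1 h0
    set s := (w⁻¹).re
    have h2 : w * (s + Complex.I) = 1 := by rw [← h1]; exact mul_inv_cancel₀ h0
    push_cast
    -- On the spectrum `w (s + i) = 1`, so the factor `w` cancels `s φ(s) + i φ(s) = (s + i) φ(s)`.
    linear_combination -(φ s : ℂ) * h2

end EssSelfAdjoint

end FunctionalCalculus

end

end MourreRepulsive


namespace MourreRepulsive

noncomputable section

/-! ### Bounded multiplication operators on `L²` -/

section Multiplication

variable {n : ℕ}

/-- Bounded measurable functions. -/
def IsBddMeas (g : Rn n → ℂ) : Prop := AEStronglyMeasurable g volume ∧ ∃ C, ∀ x, ‖g x‖ ≤ C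

theorem memLp_bdd_mul {g : Rn n → ℂ} (hg : IsBddMeas g) (u : L2 n) :
    MemLp (fun x => g x * u x) 2 volume := by
  obtain ⟨h1, C, hC⟩ := hg
  refine (Lp.memLp u).of_le_mul (c := C) (h1.mul (Lp.aestronglyMeasurable u))
    (Filter.Eventually.of_forall fun x => ?_)
  rw [norm_mul]
  exact mul_le_mul_of_nonneg_right (hC x) (norm_nonneg _)

theorem norm_le_of_ae {u v : L2 n} {C : ℝ} (h : ∀ᵐ x, ‖u x‖ ≤ C * ‖v x‖) : ‖u‖ ≤ C * ‖v‖ :=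
  Lp.norm_le_mul_norm_of_ae_le_mul h

open scoped Classical in
/-- Multiplication by the bounded function `g`. -/
def bmul (g : Rn n → ℂ) : L2 n →L[ℂ] L2 n :=
  if hg : IsBddMeas g then
    LinearMap.mkContinuousOfExistsBound
      { toFun := fun u => (memLp_bdd_mul hg u).toLp _
        map_add' := fun u v => by
          refine Lp.ext ?_
          filter_upwards [(memLp_bdd_mul hg u).coeFn_toLp, (memLp_bdd_mul hg v).coeFn_toLp,
            (memLp_bdd_mul hg (u + v)).coeFn_toLp, Lp.coeFn_add u v,
            Lp.coeFn_add ((memLp_bdd_mul hg u).toLp _) ((memLp_bdd_mul hg v).toLp _)]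
            with x h1 h2 h3 h4 h5
          rw [h3, h5, Pi.add_apply, h1, h2, h4, Pi.add_apply, mul_add]
        map_smul' := fun c u => by
          refine Lp.ext ?_
          filter_upwards [(memLp_bdd_mul hg u).coeFn_toLp, (memLp_bdd_mul hg (c • u)).coeFn_toLp,
            Lp.coeFn_smul c u, Lp.coeFn_smul c ((memLp_bdd_mul hg u).toLp _)] with x h1 h2 h3 h4
          rw [h2, RingHom.id_apply, h4, Pi.smul_apply, h1, h3, Pi.smul_apply, smul_eq_mul,
            smul_eq_mul, mul_left_comm] }
      (by
        obtain ⟨C, hC⟩ := hg.2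
        refine ⟨C, fun u => norm_le_of_ae ?_⟩
        filter_upwards [(memLp_bdd_mul hg u).coeFn_toLp] with x h1
        change ‖((memLp_bdd_mul hg u).toLp _ : Rn n → ℂ) x‖ ≤ _
        rw [h1, norm_mul]
        exact mul_le_mul_of_nonneg_right (hC x) (norm_nonneg _))
  else 0

theorem bmul_coe {g : Rn n → ℂ} (hg : IsBddMeas g) (u : L2 n) :
    bmul g u =ᵐ[volume] fun x => g x * u x := by
  rw [bmul, dif_pos hg]
  exact (memLp_bdd_mul hg u).coeFn_toLp

theorem norm_bmul_apply_le {g : Rn n → ℂ} (hg : IsBddMeas g) {C : ℝ} (hC : ∀ x, ‖g x‖ ≤ C)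
    (u : L2 n) : ‖bmul g u‖ ≤ C * ‖u‖ := by
  refine norm_le_of_ae ?_
  filter_upwards [bmul_coe hg u] with x h1
  rw [h1, norm_mul]
  exact mul_le_mul_of_nonneg_right (hC x) (norm_nonneg _)

theorem IsBddMeas.mul {g k : Rn n → ℂ} (hg : IsBddMeas g) (hk : IsBddMeas k) :
    IsBddMeas fun x => g x * k x := by
  obtain ⟨h1, C, hC⟩ := hg
  obtain ⟨h2, C', hC'⟩ := hk
  refine ⟨h1.mul h2, C * C', fun x => ?_⟩
  rw [norm_mul]
  exact mul_le_mul (hC x) (hC' x) (norm_nonneg _) ((norm_nonneg _).trans (hC x))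

theorem bmul_bmul {g k : Rn n → ℂ} (hg : IsBddMeas g) (hk : IsBddMeas k) (u : L2 n) :
    bmul g (bmul k u) = bmul (fun x => g x * k x) u := by
  refine Lp.ext ?_
  filter_upwards [bmul_coe hg (bmul k u), bmul_coe hk u, bmul_coe (hg.mul hk) u] with x h1 h2 h3
  rw [h1, h2, h3, mul_assoc]

theorem IsBddMeas.add {g k : Rn n → ℂ} (hg : IsBddMeas g) (hk : IsBddMeas k) :
    IsBddMeas fun x => g x + k x := by
  obtain ⟨h1, C, hC⟩ := hg
  obtain ⟨h2, C', hC'⟩ := hk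
  exact ⟨h1.add h2, C + C', fun x => (norm_add_le _ _).trans (add_le_add (hC x) (hC' x))⟩

theorem bmul_add {g k : Rn n → ℂ} (hg : IsBddMeas g) (hk : IsBddMeas k) :
    bmul (fun x => g x + k x) = bmul g + bmul k := by
  ext1 u
  refine Lp.ext ?_
  filter_upwards [bmul_coe hg u, bmul_coe hk u, bmul_coe (hg.add hk) u,
    Lp.coeFn_add (bmul g u) (bmul k u)] with x h1 h2 h3 h4
  rw [h3, add_apply, h4, Pi.add_apply, h1, h2, add_mul]

theorem isBddMeas_const (c : ℂ) : IsBddMeas fun _ : Rn n => c :=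
  ⟨aestronglyMeasurable_const, ‖c‖, fun _ => le_rfl⟩

theorem bmul_const (c : ℂ) : bmul (fun _ : Rn n => c) = c • ContinuousLinearMap.id ℂ (L2 n) := by
  ext1 u
  refine Lp.ext ?_
  filter_upwards [bmul_coe (isBddMeas_const c) u, Lp.coeFn_smul c u] with x h1 h2
  rw [h1]
  exact h2.symm

/-- Multiplication by the real bounded function `g`. -/
abbrev rmul (g : Rn n → ℝ) : L2 n →L[ℂ] L2 n := bmul fun x => ((g x : ℝ) : ℂ)

theorem isBddMeas_ofReal {g : Rn n → ℝ} (hg : Continuous g) {C : ℝ} (hC : ∀ x, |g x| ≤ C) :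
    IsBddMeas fun x => ((g x : ℝ) : ℂ) :=
  ⟨(Complex.continuous_ofReal.comp hg).aestronglyMeasurable, C, fun x => by
    rw [Complex.norm_real]; exact hC x⟩

theorem inner_rmul {g : Rn n → ℝ} (hg : IsBddMeas fun x => ((g x : ℝ) : ℂ)) (u v : L2 n) :
    inner ℂ (rmul g u) v = inner ℂ u (rmul g v) := by
  rw [L2.inner_def, L2.inner_def]
  refine integral_congr_ae ?_
  filter_upwards [bmul_coe hg u, bmul_coe hg v] with x h1 h2
  rw [h1, h2]
  simp only [RCLike.inner_apply, map_mul, Complex.conj_ofReal]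
  ring

theorem isSelfAdjoint_rmul {g : Rn n → ℝ} (hg : IsBddMeas fun x => ((g x : ℝ) : ℂ)) :
    IsSelfAdjoint (rmul g) := by
  rw [ContinuousLinearMap.isSelfAdjoint_iff_isSymmetric]
  exact fun u v => inner_rmul hg u v

/-- Strong convergence to zero of uniformly bounded multiplication operators. -/
theorem tendsto_bmul_zero {g : ℕ → Rn n → ℂ} (hg : ∀ k, IsBddMeas (g k)) {C : ℝ}
    (hC : ∀ k x, ‖g k x‖ ≤ C) (h0 : ∀ x, Filter.Tendsto (fun k => g k x) Filter.atTop (nhds 0))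
    (u : L2 n) : Filter.Tendsto (fun k => bmul (g k) u) Filter.atTop (nhds 0) := by
  rw [tendsto_zero_iff_norm_tendsto_zero]
  have hsq : Filter.Tendsto (fun k => ‖bmul (g k) u‖ ^ 2) Filter.atTop (nhds 0) := by
    have h1 : ∀ k, ‖bmul (g k) u‖ ^ 2 = ∫ x, ‖g k x * u x‖ ^ 2 := by
      intro k
      have h2 := L2.inner_def (𝕜 := ℂ) (bmul (g k) u) (bmul (g k) u)
      rw [inner_self_eq_norm_sq_to_K] at h2
      have h3 : ∫ x, inner ℂ ((bmul (g k) u : Rn n → ℂ) x) ((bmul (g k) u : Rn n → ℂ) x) =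
          ((∫ x, ‖g k x * u x‖ ^ 2 : ℝ) : ℂ) := by
        rw [← integral_complex_ofReal]
        refine integral_congr_ae ?_
        filter_upwards [bmul_coe (hg k) u] with x hx
        rw [hx, inner_self_eq_norm_sq_to_K]
        simp
      exact Complex.ofReal_injective ((Complex.ofReal_pow _ _).trans (h2.trans h3))
    simp_rw [h1]
    have h4 : Filter.Tendsto (fun k => ∫ x, ‖g k x * u x‖ ^ 2) Filter.atTop
        (nhds (∫ _ : Rn n, (0 : ℝ))) := by
      refine tendsto_integral_of_dominated_convergence (fun x => C ^ 2 * ‖u x‖ ^ 2) ?_ ?_ ?_ ?_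
      · intro k
        exact (memLp_bdd_mul (hg k) u).1.norm.pow 2
      · exact ((Lp.memLp u).integrable_norm_pow two_ne_zero).const_mul _
      · intro k
        filter_upwards with x
        rw [Real.norm_of_nonneg (by positivity), norm_mul, mul_pow]
        gcongr
        exact hC k x
      · filter_upwards with x
        have := (((h0 x).mul_const ((u : Rn n → ℂ) x)).norm).pow 2
        simpa using this
    simpa using h4
  have := (Real.continuous_sqrt.tendsto 0).comp hsq
  simpa [Function.comp_def, Real.sqrt_sq (norm_nonneg _)] using this

end Multiplication

/-! ### Schwartz functions in `L²` -/

section Schwartz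

variable {n : ℕ}

/-- The inclusion of the Schwartz space in `L²`. -/
def emb (n : ℕ) : 𝓢(Rn n, ℂ) →ₗ[ℂ] L2 n :=
  (SchwartzMap.toLpCLM ℂ ℂ 2 (volume : Measure (Rn n))).toLinearMap

theorem emb_coe (f : 𝓢(Rn n, ℂ)) : emb n f =ᵐ[volume] f := f.coeFn_toLp 2 volume

theorem denseRange_emb : DenseRange (emb n) :=
  SchwartzMap.denseRange_toLpCLM (F := ℂ) (p := 2) (μ := (volume : Measure (Rn n)))
    ENNReal.ofNat_ne_top

theorem inner_emb (f g : 𝓢(Rn n, ℂ)) :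
    inner ℂ (emb n f) (emb n g) = ∫ x, starRingEnd ℂ (f x) * g x := by
  have := SchwartzMap.inner_toL2_toL2_eq f g (volume : Measure (Rn n))
  refine this.trans (integral_congr_ae (Filter.Eventually.of_forall fun x => ?_))
  simp [mul_comm]

/-- Multiplication of Schwartz functions by a real function of temperate growth. -/
def sm (g : Rn n → ℝ) : 𝓢(Rn n, ℂ) →L[ℂ] 𝓢(Rn n, ℂ) :=
  SchwartzMap.smulLeftCLM ℂ fun x => ((g x : ℝ) : ℂ)

theorem sm_apply {g : Rn n → ℝ} (hg : g.HasTemperateGrowth) (f : 𝓢(Rn n, ℂ)) (x : Rn n) :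
    sm g f x = g x * f x := by
  have : (fun x => ((g x : ℝ) : ℂ)).HasTemperateGrowth :=
    Function.Complex.hasTemperateGrowth_ofReal.comp hg
  rw [sm, SchwartzMap.smulLeftCLM_apply_apply this, smul_eq_mul]

theorem rmul_emb {g : Rn n → ℝ} (hb : IsBddMeas fun x => ((g x : ℝ) : ℂ))
    (hg : g.HasTemperateGrowth) (f : 𝓢(Rn n, ℂ)) : rmul g (emb n f) = emb n (sm g f) := by
  refine Lp.ext ?_
  filter_upwards [bmul_coe hb (emb n f), emb_coe f, emb_coe (sm g f)] with x h1 h2 h3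
  rw [h1, h2, h3, sm_apply hg]

theorem sm_sm {g k : Rn n → ℝ} (hg : g.HasTemperateGrowth) (hk : k.HasTemperateGrowth)
    (f : 𝓢(Rn n, ℂ)) : sm g (sm k f) = sm (fun x => g x * k x) f := by
  ext x
  have hgk : (fun x => g x * k x).HasTemperateGrowth := hg.mul hk
  rw [sm_apply hg, sm_apply hk, sm_apply hgk]
  push_cast; ring

theorem inner_sm {g : Rn n → ℝ} (hg : g.HasTemperateGrowth) (f k : 𝓢(Rn n, ℂ)) :
    inner ℂ (emb n (sm g f)) (emb n k) = inner ℂ (emb n f) (emb n (sm g k)) := by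
  rw [inner_emb, inner_emb]
  refine integral_congr_ae (Filter.Eventually.of_forall fun x => ?_)
  simp only [sm_apply hg, map_mul, Complex.conj_ofReal]
  ring

/-- The `j`-th coordinate vector. -/
abbrev ej (j : Fin n) : Rn n := EuclideanSpace.single j (1 : ℝ)

theorem momentum_apply (j : Fin n) (f : 𝓢(Rn n, ℂ)) (x : Rn n) :
    momentum j f x = -Complex.I * lineDeriv ℝ f x (ej j) := by
  simp only [momentum, FunLike.coe_smul, Pi.smul_apply, smul_eq_mul,
    LineDeriv.lineDerivOpCLM_apply, SchwartzMap.lineDerivOp_apply]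

theorem hasLineDerivAt_schwartz (f : 𝓢(Rn n, ℂ)) (x v : Rn n) :
    HasLineDerivAt ℝ f (lineDeriv ℝ f x v) x v :=
  (f.differentiableAt.lineDifferentiableAt).hasLineDerivAt

theorem momentum_sm {g g' : Rn n → ℝ} {j : Fin n} (hg : g.HasTemperateGrowth)
    (hg' : g'.HasTemperateGrowth) (hd : ∀ x, HasLineDerivAt ℝ g (g' x) x (ej j))
    (f : 𝓢(Rn n, ℂ)) :
    momentum j (sm g f) = sm g (momentum j f) - Complex.I • sm g' f := by
  ext x
  have h1 : HasLineDerivAt ℝ (sm g f) (g' x * f x + g x * lineDeriv ℝ f x (ej j)) x (ej j) := by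
    have h2 := HasDerivAt.mul (HasDerivAt.ofReal_comp (hd x))
      (hasLineDerivAt_schwartz f x (ej j))
    have h3 : (sm g f : Rn n → ℂ) = fun x => (g x : ℂ) * f x := funext fun x => sm_apply hg f x
    unfold HasLineDerivAt
    rw [h3]
    refine HasDerivAt.congr_deriv h2 ?_
    simp
  rw [momentum_apply, h1.lineDeriv]
  simp only [FunLike.coe_sub, FunLike.coe_smul, Pi.sub_apply, Pi.smul_apply, sm_apply hg,
    sm_apply hg', momentum_apply, smul_eq_mul]
  ring

theorem inner_momentum (j : Fin n) (f g : 𝓢(Rn n, ℂ)) :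
    inner ℂ (emb n (momentum j f)) (emb n g) = inner ℂ (emb n f) (emb n (momentum j g)) := by
  rw [inner_emb, inner_emb]
  have h1 := SchwartzMap.integral_bilinear_lineDerivOp_right_eq_neg_left (μ := volume) f g
    ((ContinuousLinearMap.mul ℝ ℂ).comp (Complex.conjCLE : ℂ →L[ℝ] ℂ)) (ej j)
  simp only [SchwartzMap.lineDerivOp_apply, ContinuousLinearMap.comp_apply,
    ContinuousLinearMap.mul_apply', ContinuousLinearEquiv.coe_coe, Complex.conjCLE_apply] at h1
  simp only [momentum_apply]
  calc _ = Complex.I * ∫ x, starRingEnd ℂ (lineDeriv ℝ f x (ej j)) * g x := by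
        rw [← integral_const_mul]
        refine integral_congr_ae (Filter.Eventually.of_forall fun x => ?_)
        simp only [map_mul, map_neg, Complex.conj_I]
        ring
    _ = -Complex.I * ∫ x, starRingEnd ℂ (f x) * lineDeriv ℝ g x (ej j) := by
        rw [h1]; ring
    _ = _ := by
        rw [← integral_const_mul]
        refine integral_congr_ae (Filter.Eventually.of_forall fun x => ?_)
        ring

end Schwartz

end

end MourreRepulsive


namespace MourreRepulsive

noncomputable section

/-! ### Weights -/

section Weights

variable {n : ℕ}

theorem one_le_one_add_normSq (x : Rn n) : 1 ≤ 1 + ‖x‖ ^ 2 := by nlinarith [sq_nonneg ‖x‖]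

theorem one_add_normSq_pos (x : Rn n) : 0 < 1 + ‖x‖ ^ 2 := by positivity

theorem japPow_pos (s : ℝ) (x : Rn n) : 0 < japPow s x := Real.rpow_pos_of_pos (one_add_normSq_pos x) _

theorem japPow_mul (s t : ℝ) (x : Rn n) : japPow s x * japPow t x = japPow (s + t) x := by
  rw [japPow, japPow, japPow, ← Real.rpow_add (one_add_normSq_pos x)]
  congr 1; ring

theorem japPow_zero (x : Rn n) : japPow 0 x = 1 := by simp [japPow]

theorem japPow_two (x : Rn n) : japPow 2 x = 1 + ‖x‖ ^ 2 := by simp [japPow]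

theorem japPow_le_japPow {s t : ℝ} (h : s ≤ t) (x : Rn n) : japPow s x ≤ japPow t x :=
  Real.rpow_le_rpow_of_exponent_le (one_le_one_add_normSq x) (by linarith)

theorem japPow_le_one {s : ℝ} (h : s ≤ 0) (x : Rn n) : japPow s x ≤ 1 :=
  (japPow_le_japPow h x).trans_eq (japPow_zero x)

theorem one_le_japPow {s : ℝ} (h : 0 ≤ s) (x : Rn n) : 1 ≤ japPow s x :=
  (japPow_zero x).symm.trans_le (japPow_le_japPow h x)

theorem norm_le_japPow_one (x : Rn n) : ‖x‖ ≤ japPow 1 x := by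
  refine le_of_sq_le_sq ?_ (japPow_pos 1 x).le
  rw [sq (japPow 1 x), japPow_mul, show (1 : ℝ) + 1 = 2 by norm_num, japPow_two]
  linarith

theorem abs_coord_le_norm (x : Rn n) (j : Fin n) : |x j| ≤ ‖x‖ := by
  simpa using EuclideanSpace.norm_eq x ▸ PiLp.norm_apply_le x j

theorem abs_coord_le (x : Rn n) (j : Fin n) : |x j| ≤ japPow 1 x :=
  (abs_coord_le_norm x j).trans (norm_le_japPow_one x)

theorem abs_coord_mul_japPow_le (s : ℝ) (x : Rn n) (j : Fin n) :
    |x j| * japPow s x ≤ japPow (s + 1) x := by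
  rw [add_comm, ← japPow_mul]
  exact mul_le_mul_of_nonneg_right (abs_coord_le x j) (japPow_pos s x).le

@[fun_prop]
theorem temperate_japPow (s : ℝ) : (japPow s : Rn n → ℝ).HasTemperateGrowth :=
  Function.hasTemperateGrowth_one_add_norm_sq_rpow (Rn n) (s / 2)

@[fun_prop]
theorem temperate_coord (j : Fin n) : (fun x : Rn n => x j).HasTemperateGrowth :=
  (EuclideanSpace.proj (𝕜 := ℝ) j : Rn n →L[ℝ] ℝ).hasTemperateGrowth

theorem continuous_of_temperate {g : Rn n → ℝ} (hg : g.HasTemperateGrowth) : Continuous g :=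
  hg.1.continuous

theorem continuous_japPow (s : ℝ) : Continuous (japPow s : Rn n → ℝ) :=
  continuous_of_temperate (temperate_japPow s)

/-- The regularizing factor `(1 + ε |x|²)⁻¹`. -/
def eta (ε : ℝ) (x : Rn n) : ℝ := (1 + ε * ‖x‖ ^ 2)⁻¹

@[fun_prop]
theorem temperate_eta {ε : ℝ} (hε : 0 ≤ ε) : (eta ε : Rn n → ℝ).HasTemperateGrowth := by
  have h1 : (eta ε : Rn n → ℝ) = (fun x : Rn n => (1 + ‖x‖ ^ 2) ^ (-1 : ℝ)) ∘
      (Real.sqrt ε • ContinuousLinearMap.id ℝ (Rn n) : Rn n →L[ℝ] Rn n) := by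
    ext x
    simp only [eta, Function.comp_apply]
    rw [Real.rpow_neg_one]
    congr 2
    simp [norm_smul, mul_pow, Real.sq_sqrt hε]
  rw [h1]
  exact (Function.hasTemperateGrowth_one_add_norm_sq_rpow (Rn n) (-1)).comp
    (ContinuousLinearMap.hasTemperateGrowth _)

variable {ε : ℝ}

theorem one_add_eps_pos (hε : 0 ≤ ε) (x : Rn n) : 0 < 1 + ε * ‖x‖ ^ 2 := by positivity

theorem eta_pos (hε : 0 ≤ ε) (x : Rn n) : 0 < eta ε x := inv_pos.2 (one_add_eps_pos hε x)

theorem eta_le_one (hε : 0 ≤ ε) (x : Rn n) : eta ε x ≤ 1 :=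
  inv_le_one_of_one_le₀ (by have : 0 ≤ ε * ‖x‖ ^ 2 := by positivity
                            linarith)

/-- Each differentiation of the cutoff produces a factor `ε`; this bound trades it, together with
one factor `eta ε`, for `⟨x⟩^(-2)`. The condition `ε ≤ 1` handles the constant term of `⟨x⟩²`. -/
theorem eps_japPow_two_mul_eta_le (hε : 0 ≤ ε) (hε1 : ε ≤ 1) (x : Rn n) :
    ε * japPow 2 x * eta ε x ≤ 1 := by
  rw [japPow_two, eta, mul_inv_le_iff₀ (one_add_eps_pos hε x)]
  linarith

theorem eta_zero : (eta 0 : Rn n → ℝ) = fun _ => 1 := by ext x; simp [eta]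

/-! #### Line derivatives -/

theorem HasLineDerivAt.real_mul {f g : Rn n → ℝ} {f' g' : ℝ} {x v : Rn n}
    (hf : HasLineDerivAt ℝ f f' x v) (hg : HasLineDerivAt ℝ g g' x v) :
    HasLineDerivAt ℝ (fun x => f x * g x) (f' * g x + f x * g') x v := by
  have := HasDerivAt.mul hf hg
  refine HasDerivAt.congr_deriv this ?_
  simp

theorem HasLineDerivAt.real_const_mul {f : Rn n → ℝ} {f' : ℝ} {x v : Rn n} (c : ℝ)
    (hf : HasLineDerivAt ℝ f f' x v) : HasLineDerivAt ℝ (fun x => c * f x) (c * f') x v :=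
  HasDerivAt.const_mul c hf

theorem HasLineDerivAt.real_add {f g : Rn n → ℝ} {f' g' : ℝ} {x v : Rn n}
    (hf : HasLineDerivAt ℝ f f' x v) (hg : HasLineDerivAt ℝ g g' x v) :
    HasLineDerivAt ℝ (fun x => f x + g x) (f' + g') x v :=
  HasDerivAt.add hf hg

theorem hasLineDerivAt_normSq (x : Rn n) (j : Fin n) :
    HasLineDerivAt ℝ (fun x : Rn n => ‖x‖ ^ 2) (2 * x j) x (ej j) := by
  have h := (hasStrictFDerivAt_norm_sq x).hasFDerivAt.hasLineDerivAt (ej j)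
  refine HasDerivAt.congr_deriv h ?_
  simp [EuclideanSpace.inner_single_right]

theorem hasLineDerivAt_coord (x : Rn n) (i j : Fin n) :
    HasLineDerivAt ℝ (fun x : Rn n => x i) (if i = j then 1 else 0) x (ej j) := by
  have h := (EuclideanSpace.proj (𝕜 := ℝ) i : Rn n →L[ℝ] ℝ).hasFDerivAt (x := x)
  refine HasDerivAt.congr_deriv (h.hasLineDerivAt (ej j)) ?_
  simp [PiLp.single_apply]

theorem hasLineDerivAt_japPow (s : ℝ) (x : Rn n) (j : Fin n) :
    HasLineDerivAt ℝ (japPow s) (s * (x j * japPow (s - 2) x)) x (ej j) := by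
  have h1 := HasDerivAt.const_add 1 (hasLineDerivAt_normSq x j)
  have h2 := HasDerivAt.rpow_const (p := s / 2) h1
    (Or.inl (one_add_normSq_pos _).ne')
  refine HasDerivAt.congr_deriv h2 ?_
  simp only [zero_smul, add_zero, japPow]
  rw [show (s - 2) / 2 = s / 2 - 1 by ring]
  ring

theorem hasLineDerivAt_eta (hε : 0 ≤ ε) (x : Rn n) (j : Fin n) :
    HasLineDerivAt ℝ (eta ε) (-2 * ε * x j * eta ε x ^ 2) x (ej j) := by
  have h1 := HasDerivAt.const_add 1 (HasDerivAt.const_mul ε (hasLineDerivAt_normSq x j))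
  have h2 := HasDerivAt.inv h1 (one_add_eps_pos hε _).ne'
  refine HasDerivAt.congr_deriv h2 ?_
  simp only [zero_smul, add_zero, eta, inv_pow]
  field_simp

/-! #### The regularized weights `⟨x⟩ ^ s (1 + ε |x|²)⁻¹` -/

/-- `⟨x⟩ ^ s (1 + ε |x|²)⁻¹`. -/
def regWeight (s ε : ℝ) (x : Rn n) : ℝ := japPow s x * eta ε x

/-- The radial derivative of `regWeight`, divided by `|x|`. -/
def regRadial (s ε : ℝ) (x : Rn n) : ℝ :=
  s * (japPow (s - 2) x * eta ε x) + (-2 * ε) * (japPow s x * eta ε x ^ 2)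

/-- The radial derivative of `regRadial`, divided by `|x|`. -/
def regRadial₂ (s ε : ℝ) (x : Rn n) : ℝ :=
  s * (s - 2) * (japPow (s - 4) x * eta ε x) + (-4 * s * ε) * (japPow (s - 2) x * eta ε x ^ 2) +
    8 * ε ^ 2 * (japPow s x * eta ε x ^ 3)

/-- `∂_j` of `regWeight`. -/
def regD (s ε : ℝ) (j : Fin n) (x : Rn n) : ℝ := x j * regRadial s ε x

/-- `∂_j²` of `regWeight`. -/
def regDD (s ε : ℝ) (j : Fin n) (x : Rn n) : ℝ := regRadial s ε x + x j * (x j * regRadial₂ s ε x)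

theorem temperate_regWeight (hε : 0 ≤ ε) (s : ℝ) :
    (regWeight s ε : Rn n → ℝ).HasTemperateGrowth :=
  (temperate_japPow s).mul (temperate_eta hε)

theorem temperate_const_mul {g : Rn n → ℝ} (c : ℝ) (hg : g.HasTemperateGrowth) :
    (fun x => c * g x).HasTemperateGrowth :=
  (Function.HasTemperateGrowth.const c).mul hg

theorem temperate_regRadial (hε : 0 ≤ ε) (s : ℝ) :
    (regRadial s ε : Rn n → ℝ).HasTemperateGrowth :=
  (temperate_const_mul s ((temperate_japPow (s - 2)).mul (temperate_eta hε))).add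
    (temperate_const_mul (-2 * ε) ((temperate_japPow s).mul ((temperate_eta hε).pow 2)))

theorem temperate_regRadial₂ (hε : 0 ≤ ε) (s : ℝ) :
    (regRadial₂ s ε : Rn n → ℝ).HasTemperateGrowth :=
  ((temperate_const_mul (s * (s - 2)) ((temperate_japPow (s - 4)).mul (temperate_eta hε))).add
    (temperate_const_mul (-4 * s * ε) ((temperate_japPow (s - 2)).mul
      ((temperate_eta hε).pow 2)))).add
    (temperate_const_mul (8 * ε ^ 2) ((temperate_japPow s).mul ((temperate_eta hε).pow 3)))

theorem temperate_regD (hε : 0 ≤ ε) (s : ℝ) (j : Fin n) :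
    (regD s ε j : Rn n → ℝ).HasTemperateGrowth :=
  (temperate_coord j).mul (temperate_regRadial hε s)

theorem temperate_regDD (hε : 0 ≤ ε) (s : ℝ) (j : Fin n) :
    (regDD s ε j : Rn n → ℝ).HasTemperateGrowth :=
  (temperate_regRadial hε s).add ((temperate_coord j).mul
    ((temperate_coord j).mul (temperate_regRadial₂ hε s)))

theorem hasLineDerivAt_eta_pow (hε : 0 ≤ ε) (k : ℕ) (x : Rn n) (j : Fin n) :
    HasLineDerivAt ℝ (fun x => eta ε x ^ k) (-2 * k * ε * x j * eta ε x ^ (k + 1)) x (ej j) := by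
  have h2 := HasDerivAt.pow (hasLineDerivAt_eta hε x j) k
  refine HasDerivAt.congr_deriv h2 ?_
  simp only [zero_smul, add_zero]
  cases k with
  | zero => simp
  | succ k => simp only [Nat.add_sub_cancel]; push_cast; ring

theorem hasLineDerivAt_regWeight (hε : 0 ≤ ε) (s : ℝ) (x : Rn n) (j : Fin n) :
    HasLineDerivAt ℝ (regWeight s ε) (regD s ε j x) x (ej j) := by
  refine HasDerivAt.congr_deriv
    (HasLineDerivAt.real_mul (hasLineDerivAt_japPow s x j) (hasLineDerivAt_eta hε x j)) ?_
  simp only [regD, regRadial]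
  ring

theorem hasLineDerivAt_regRadial (hε : 0 ≤ ε) (s : ℝ) (x : Rn n) (j : Fin n) :
    HasLineDerivAt ℝ (regRadial s ε) (x j * regRadial₂ s ε x) x (ej j) := by
  refine HasDerivAt.congr_deriv
    (HasLineDerivAt.real_add (HasLineDerivAt.real_const_mul s
      (HasLineDerivAt.real_mul (hasLineDerivAt_japPow (s - 2) x j) (hasLineDerivAt_eta hε x j)))
      (HasLineDerivAt.real_const_mul (-2 * ε)
      (HasLineDerivAt.real_mul (hasLineDerivAt_japPow s x j) (hasLineDerivAt_eta_pow hε 2 x j)))) ?_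
  simp only [regRadial₂]
  rw [show s - 2 - 2 = s - 4 by ring]
  push_cast
  ring

theorem hasLineDerivAt_regD (hε : 0 ≤ ε) (s : ℝ) (x : Rn n) (j : Fin n) :
    HasLineDerivAt ℝ (regD s ε j) (regDD s ε j x) x (ej j) := by
  refine HasDerivAt.congr_deriv
    (HasLineDerivAt.real_mul (hasLineDerivAt_coord x j j) (hasLineDerivAt_regRadial hε s x j)) ?_
  simp [regDD]

/-- After `⟨x⟩^(s-2)` is pulled out, the rest is `η (s - 2b)` with `b = ε⟨x⟩²η` in `[0, 1]`. The
bound is uniform in `ε` and includes `ε = 0`, so it serves both the regularized weights and `⟨x⟩^s`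
itself. -/
theorem abs_regRadial_le (hε : 0 ≤ ε) (hε1 : ε ≤ 1) {s : ℝ} (hs : 0 ≤ s) (hs1 : s ≤ 1) (x : Rn n) :
    |regRadial s ε x| ≤ 3 * japPow (s - 2) x := by
  have e0 := eta_pos hε x
  have e1 := eta_le_one hε x
  have e2 := eps_japPow_two_mul_eta_le hε hε1 x
  have j2 := japPow_pos 2 x
  have hj := japPow_pos (s - 2) x
  have hjs : japPow s x = japPow (s - 2) x * japPow 2 x := by
    rw [japPow_mul]; congr 1; ring
  rw [regRadial, hjs]
  set a := eta ε x
  set b := ε * japPow 2 x * a with hb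
  have hb0 : 0 ≤ b := by positivity
  have : s * (japPow (s - 2) x * a) + -2 * ε * (japPow (s - 2) x * japPow 2 x * a ^ 2) =
      japPow (s - 2) x * (a * (s - 2 * b)) := by rw [hb]; ring
  rw [this, abs_mul, abs_of_pos hj, mul_comm, abs_mul, abs_of_pos e0]
  have h3 : |s - 2 * b| ≤ 3 := by rw [abs_le]; constructor <;> linarith
  have h4 : a * |s - 2 * b| ≤ 3 := by nlinarith [abs_nonneg (s - 2 * b)]
  exact mul_le_mul_of_nonneg_right h4 hj.le

theorem abs_regD_le (hε : 0 ≤ ε) (hε1 : ε ≤ 1) {s : ℝ} (hs : 0 ≤ s) (hs1 : s ≤ 1) (j : Fin n)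
    (x : Rn n) : |regD s ε j x| ≤ 3 * japPow (s - 1) x := by
  rw [regD, abs_mul]
  calc _ ≤ |x j| * (3 * japPow (s - 2) x) :=
        mul_le_mul_of_nonneg_left (abs_regRadial_le hε hε1 hs hs1 x) (abs_nonneg _)
    _ = 3 * (|x j| * japPow (s - 2) x) := by ring
    _ ≤ 3 * japPow (s - 2 + 1) x := by
        have := abs_coord_mul_japPow_le (s - 2) x j
        linarith
    _ = _ := by ring_nf

theorem abs_regRadial₂_le (hε : 0 ≤ ε) (hε1 : ε ≤ 1) {s : ℝ} (hs : 0 ≤ s) (hs1 : s ≤ 1)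
    (x : Rn n) : |regRadial₂ s ε x| ≤ 14 * japPow (s - 4) x := by
  have e0 := eta_pos hε x
  have e1 := eta_le_one hε x
  have e2 := eps_japPow_two_mul_eta_le hε hε1 x
  have j2 := japPow_pos 2 x
  have hj := japPow_pos (s - 4) x
  have hjs : japPow (s - 2) x = japPow (s - 4) x * japPow 2 x := by
    rw [japPow_mul]; congr 1; ring
  have hjs' : japPow s x = japPow (s - 4) x * japPow 2 x * japPow 2 x := by
    rw [japPow_mul, japPow_mul]; congr 1; ring
  rw [regRadial₂, hjs', hjs]
  set a := eta ε x
  set b := ε * japPow 2 x * a with hb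
  have hb0 : 0 ≤ b := by positivity
  have : s * (s - 2) * (japPow (s - 4) x * a) + -4 * s * ε * (japPow (s - 4) x * japPow 2 x * a ^ 2)
      + 8 * ε ^ 2 * (japPow (s - 4) x * japPow 2 x * japPow 2 x * a ^ 3) =
      japPow (s - 4) x * (a * (s * (s - 2) - 4 * s * b + 8 * b ^ 2)) := by rw [hb]; ring
  rw [this, abs_mul, abs_of_pos hj, mul_comm, abs_mul, abs_of_pos e0]
  have h3 : |s * (s - 2) - 4 * s * b + 8 * b ^ 2| ≤ 14 := by
    rw [abs_le]
    constructor
    · nlinarith [mul_nonneg hs hb0]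
    · nlinarith [mul_nonneg hs hb0]
  have h4 : a * |s * (s - 2) - 4 * s * b + 8 * b ^ 2| ≤ 14 := by
    nlinarith [abs_nonneg (s * (s - 2) - 4 * s * b + 8 * b ^ 2)]
  exact mul_le_mul_of_nonneg_right h4 hj.le

theorem abs_regDD_le (hε : 0 ≤ ε) (hε1 : ε ≤ 1) {s : ℝ} (hs : 0 ≤ s) (hs1 : s ≤ 1) (j : Fin n)
    (x : Rn n) : |regDD s ε j x| ≤ 17 := by
  have h1 : |regRadial s ε x| ≤ 3 := by
    refine (abs_regRadial_le hε hε1 hs hs1 x).trans ?_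
    have := japPow_le_one (show s - 2 ≤ 0 by linarith) x
    linarith
  have h2 : |x j * (x j * regRadial₂ s ε x)| ≤ 14 := by
    rw [abs_mul, abs_mul]
    have a1 := abs_regRadial₂_le hε hε1 hs hs1 x
    have a2 := abs_coord_mul_japPow_le (s - 4) x j
    have a3 := abs_coord_mul_japPow_le (s - 4 + 1) x j
    have a4 := japPow_le_one (show s - 4 + 1 + 1 ≤ 0 by linarith) x
    have b1 : |x j| * |regRadial₂ s ε x| ≤ 14 * japPow (s - 4 + 1) x := by
      calc _ ≤ |x j| * (14 * japPow (s - 4) x) := mul_le_mul_of_nonneg_left a1 (abs_nonneg _)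
        _ = 14 * (|x j| * japPow (s - 4) x) := by ring
        _ ≤ _ := by linarith
    calc _ ≤ |x j| * (14 * japPow (s - 4 + 1) x) := mul_le_mul_of_nonneg_left b1 (abs_nonneg _)
      _ = 14 * (|x j| * japPow (s - 4 + 1) x) := by ring
      _ ≤ _ := by linarith
  calc _ ≤ |regRadial s ε x| + |x j * (x j * regRadial₂ s ε x)| := abs_add_le _ _
    _ ≤ _ := by linarith

/-- For `0 ≤ q ≤ 1` one has `t^q ≤ max(1, t)`, and with `t = ε⟨x⟩²`, `ε ≤ 1`, both entries are at
most `1 + ε|x|²`. -/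
theorem rpow_le_one_add (hε : 0 ≤ ε) (hε1 : ε ≤ 1) {q : ℝ} (hq : 0 ≤ q) (hq1 : q ≤ 1) (x : Rn n) :
    (ε * japPow 2 x) ^ q * eta ε x ≤ 1 := by
  have h0 : 0 ≤ ε * japPow 2 x := mul_nonneg hε (japPow_pos 2 x).le
  rw [eta, mul_inv_le_iff₀ (one_add_eps_pos hε x), one_mul]
  rcases le_or_gt (ε * japPow 2 x) 1 with h | h
  · have := Real.rpow_le_one h0 h hq
    have : 0 ≤ ε * ‖x‖ ^ 2 := by positivity
    linarith
  · calc _ ≤ (ε * japPow 2 x) ^ (1 : ℝ) := Real.rpow_le_rpow_of_exponent_le h.le hq1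
      _ = ε * (1 + ‖x‖ ^ 2) := by rw [Real.rpow_one, japPow_two]
      _ ≤ _ := by linarith

/-- The gradient of `(1 + ε |x|²)⁻¹` is small compared to `⟨x⟩ ^ (-a)` if `a < 1`. -/
theorem abs_regD_zero_le (hε : 0 < ε) (hε1 : ε ≤ 1) {a : ℝ} (ha : 0 ≤ a) (ha1 : a ≤ 1) (j : Fin n)
    (x : Rn n) : |regD 0 ε j x| ≤ 2 * ε ^ ((1 - a) / 2) * japPow (-a) x := by
  have e0 := eta_pos hε.le x
  have e1 := eta_le_one hε.le x
  -- The exponent is chosen so that `ε^((1+a)/2) ⟨x⟩^(1+a)` is absorbed by one factor of the cutoff.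
  -- The complementary power `ε^((1-a)/2)` remains as the gain.
  have key := rpow_le_one_add hε.le hε1 (q := (1 + a) / 2) (by linarith) (by linarith) x
  rw [Real.mul_rpow hε.le (japPow_pos 2 x).le] at key
  have k2 : (japPow 2 x) ^ ((1 + a) / 2) = japPow 1 x * japPow a x := by
    rw [japPow_mul, japPow_two, japPow]
  rw [k2] at key
  have h1 : |regD 0 ε j x| = 2 * ε * |x j| * eta ε x ^ 2 := by
    simp only [regD, regRadial, japPow_zero, zero_mul, zero_add, one_mul]
    rw [abs_mul, abs_mul, abs_mul, abs_of_pos hε, abs_of_pos (pow_pos e0 2)]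
    norm_num
    ring
  have h2 : ε = ε ^ ((1 - a) / 2) * ε ^ ((1 + a) / 2) := by
    rw [← Real.rpow_add hε]
    conv_lhs => rw [← Real.rpow_one ε]
    congr 1; ring
  have h3 : japPow 1 x = (japPow 1 x * japPow a x) * japPow (-a) x := by
    rw [japPow_mul, japPow_mul]; congr 1; ring
  set p := ε ^ ((1 - a) / 2)
  set q := ε ^ ((1 + a) / 2)
  have hp : 0 < p := Real.rpow_pos_of_pos hε _
  have hq : 0 < q := Real.rpow_pos_of_pos hε _
  rw [h1]
  calc 2 * ε * |x j| * eta ε x ^ 2 ≤ 2 * ε * japPow 1 x * (eta ε x * 1) := by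
        have := abs_coord_le x j
        have := japPow_pos 1 x
        rw [sq]
        gcongr
    _ = 2 * p * japPow (-a) x * (q * (japPow 1 x * japPow a x) * eta ε x) := by
        rw [mul_one]
        calc _ = 2 * (p * q) * (japPow 1 x * japPow a x * japPow (-a) x) * eta ε x := by
              rw [← h2, ← h3]
          _ = _ := by ring
    _ ≤ 2 * p * japPow (-a) x * 1 := by
        have := japPow_pos (-a) x
        gcongr
    _ = _ := by ring

theorem abs_regDD_zero_le (hε : 0 ≤ ε) (hε1 : ε ≤ 1) (j : Fin n) (x : Rn n) :
    |regDD 0 ε j x| ≤ 10 * ε := by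
  have e0 := eta_pos hε x
  have e1 := eta_le_one hε x
  have e2 := eps_japPow_two_mul_eta_le hε hε1 x
  have hx : (x j) ^ 2 ≤ japPow 2 x := by
    have := abs_coord_le_norm x j
    rw [japPow_two, ← sq_abs]
    nlinarith [abs_nonneg (x j)]
  have h1 : regDD 0 ε j x = ε * eta ε x ^ 2 * (-2 + 8 * (ε * (x j) ^ 2 * eta ε x)) := by
    simp only [regDD, regRadial, regRadial₂, japPow_zero]
    ring
  have h2 : ε * (x j) ^ 2 * eta ε x ≤ 1 := le_trans (by gcongr) e2
  have h0 : 0 ≤ ε * (x j) ^ 2 * eta ε x := by positivity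
  rw [h1, abs_mul, abs_of_nonneg (by positivity)]
  have h3 : |-2 + 8 * (ε * (x j) ^ 2 * eta ε x)| ≤ 10 := by
    rw [abs_le]; constructor <;> linarith
  have h4 : eta ε x ^ 2 ≤ 1 := pow_le_one₀ e0.le e1
  calc _ ≤ ε * 1 * 10 := by gcongr
    _ = _ := by ring

end Weights

end

end MourreRepulsive


namespace MourreRepulsive

noncomputable section

/-! ### Schrödinger operators on Schwartz functions -/

section Schroedinger

variable {n : ℕ}

theorem isBddMeas_temperate {g : Rn n → ℝ} (hg : g.HasTemperateGrowth) {C : ℝ}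
    (hC : ∀ x, |g x| ≤ C) : IsBddMeas fun x => ((g x : ℝ) : ℂ) :=
  isBddMeas_ofReal (continuous_of_temperate hg) hC

theorem isBddMeas_japPow {s : ℝ} (hs : s ≤ 0) :
    IsBddMeas fun x : Rn n => ((japPow s x : ℝ) : ℂ) :=
  isBddMeas_temperate (temperate_japPow s) (C := 1) fun x => by
    rw [abs_of_pos (japPow_pos s x)]; exact japPow_le_one hs x

theorem norm_emb_sm_le {g k : Rn n → ℝ} (hg : g.HasTemperateGrowth) (hk : k.HasTemperateGrowth)
    {C : ℝ} (h : ∀ x, |g x| ≤ C * |k x|) (f : 𝓢(Rn n, ℂ)) :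
    ‖emb n (sm g f)‖ ≤ C * ‖emb n (sm k f)‖ := by
  refine norm_le_of_ae ?_
  filter_upwards [emb_coe (sm g f), emb_coe (sm k f)] with x h1 h2
  rw [h1, h2, sm_apply hg, sm_apply hk, norm_mul, norm_mul, Complex.norm_real, Complex.norm_real,
    ← mul_assoc]
  exact mul_le_mul_of_nonneg_right (h x) (norm_nonneg _)

theorem norm_emb_sm_le_of_bdd {g : Rn n → ℝ} (hg : g.HasTemperateGrowth)
    {C : ℝ} (h : ∀ x, |g x| ≤ C) (f : 𝓢(Rn n, ℂ)) : ‖emb n (sm g f)‖ ≤ C * ‖emb n f‖ := by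
  refine norm_le_of_ae ?_
  filter_upwards [emb_coe (sm g f), emb_coe f] with x h1 h2
  rw [h1, h2, sm_apply hg, norm_mul, Complex.norm_real]
  exact mul_le_mul_of_nonneg_right (h x) (norm_nonneg _)

/-- Continuous potentials with `|w| ≤ c ⟨x⟩ ^ α`. -/
structure IsPotential (α c : ℝ) (w : Rn n → ℝ) : Prop where
  cont : Continuous w
  bound : ∀ x, |w x| ≤ c * japPow α x

/-- Multiplication of Schwartz functions by a potential of at most quadratic growth. -/
def pot (w : Rn n → ℝ) : 𝓢(Rn n, ℂ) →ₗ[ℂ] L2 n :=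
  (rmul fun x => w x * japPow (-2) x).toLinearMap ∘ₗ emb n ∘ₗ (sm (japPow 2)).toLinearMap

variable {α c : ℝ} {w : Rn n → ℝ}

theorem IsPotential.nonneg (hw : IsPotential α c w) : 0 ≤ c := by
  have h := (abs_nonneg _).trans (hw.bound 0)
  exact nonneg_of_mul_nonneg_left h (japPow_pos α 0)

theorem IsPotential.bound_mul (hw : IsPotential α c w) {s : ℝ} (hs : α + s ≤ 0) (x : Rn n) :
    |w x * japPow s x| ≤ c := by
  rw [abs_mul, abs_of_pos (japPow_pos s x)]
  calc _ ≤ c * japPow α x * japPow s x :=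
        mul_le_mul_of_nonneg_right (hw.bound x) (japPow_pos s x).le
    _ = c * japPow (α + s) x := by rw [mul_assoc, japPow_mul]
    _ ≤ c * 1 := mul_le_mul_of_nonneg_left (japPow_le_one hs x) hw.nonneg
    _ = c := mul_one c

theorem IsPotential.isBddMeas_mul (hw : IsPotential α c w) {s : ℝ} (hs : α + s ≤ 0) :
    IsBddMeas fun x => ((w x * japPow s x : ℝ) : ℂ) :=
  isBddMeas_ofReal (hw.cont.mul (continuous_japPow s)) (hw.bound_mul hs)

theorem pot_coe (hα : α ≤ 2) (hw : IsPotential α c w) (f : 𝓢(Rn n, ℂ)) :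
    pot w f =ᵐ[volume] fun x => w x * f x := by
  filter_upwards [bmul_coe (hw.isBddMeas_mul (s := -2) (by linarith)) (emb n (sm (japPow 2) f)),
    emb_coe (sm (japPow 2) f)] with x h1 h2
  change (rmul _ (emb n (sm (japPow 2) f)) : Rn n → ℂ) x = _
  rw [h1, h2, sm_apply (temperate_japPow 2)]
  have : (japPow (-2) x : ℂ) * japPow 2 x = 1 := by
    rw [← Complex.ofReal_mul, japPow_mul]; simp [japPow_zero]
  push_cast
  linear_combination (w x * f x : ℂ) * this

theorem pot_sm (hα : α ≤ 2) (hw : IsPotential α c w) {g : Rn n → ℝ} (hg : g.HasTemperateGrowth)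
    (hb : IsBddMeas fun x => ((g x : ℝ) : ℂ)) (f : 𝓢(Rn n, ℂ)) :
    pot w (sm g f) = rmul g (pot w f) := by
  refine Lp.ext ?_
  filter_upwards [pot_coe hα hw (sm g f), pot_coe hα hw f, bmul_coe hb (pot w f)] with x h1 h2 h3
  rw [h1, h3, h2, sm_apply hg]
  ring

theorem inner_pot (hα : α ≤ 2) (hw : IsPotential α c w) (f g : 𝓢(Rn n, ℂ)) :
    inner ℂ (pot w f) (emb n g) = inner ℂ (emb n f) (pot w g) := by
  rw [L2.inner_def, L2.inner_def]
  refine integral_congr_ae ?_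
  filter_upwards [pot_coe hα hw f, pot_coe hα hw g, emb_coe f, emb_coe g] with x h1 h2 h3 h4
  rw [h1, h2, h3, h4]
  simp only [RCLike.inner_apply, map_mul, Complex.conj_ofReal]
  ring

theorem inner_pot_sm (hα : α ≤ 2) (hw : IsPotential α c w) {g : Rn n → ℝ}
    (hg : g.HasTemperateGrowth) (f k : 𝓢(Rn n, ℂ)) :
    inner ℂ (emb n (sm g f)) (pot w k) = inner ℂ (emb n f) (pot w (sm g k)) := by
  rw [L2.inner_def, L2.inner_def]
  refine integral_congr_ae ?_
  filter_upwards [pot_coe hα hw k, pot_coe hα hw (sm g k), emb_coe f, emb_coe (sm g f)]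
    with x h1 h2 h3 h4
  rw [h1, h2, h3, h4, sm_apply hg, sm_apply hg]
  simp only [RCLike.inner_apply, map_mul, Complex.conj_ofReal]
  ring

/-- The Laplacian `p²` as a map into `L²`. -/
def kin (n : ℕ) : 𝓢(Rn n, ℂ) →ₗ[ℂ] L2 n := emb n ∘ₗ (momentumSq n).toLinearMap

/-- The Schrödinger operator `p² + w` on Schwartz functions. -/
def schr (w : Rn n → ℝ) : 𝓢(Rn n, ℂ) →ₗ[ℂ] L2 n := kin n + pot w

theorem schr_apply (w : Rn n → ℝ) (f : 𝓢(Rn n, ℂ)) :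
    schr w f = emb n (momentumSq n f) + pot w f := rfl

theorem momentumSq_apply (f : 𝓢(Rn n, ℂ)) :
    momentumSq n f = ∑ j, momentum j (momentum j f) := by
  simp [momentumSq]

theorem inner_kin (f g : 𝓢(Rn n, ℂ)) :
    inner ℂ (emb n (momentumSq n f)) (emb n g) =
      ∑ j, inner ℂ (emb n (momentum j f)) (emb n (momentum j g)) := by
  rw [momentumSq_apply, map_sum, sum_inner]
  exact Finset.sum_congr rfl fun j _ => inner_momentum j _ _

theorem inner_kin' (f g : 𝓢(Rn n, ℂ)) :
    inner ℂ (emb n f) (emb n (momentumSq n g)) =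
      ∑ j, inner ℂ (emb n (momentum j f)) (emb n (momentum j g)) := by
  rw [momentumSq_apply, map_sum, inner_sum]
  exact Finset.sum_congr rfl fun j _ => (inner_momentum j _ _).symm

theorem symmetric_kin : SymmetricOn (emb n) (kin n) := fun f g =>
  (inner_kin f g).trans (inner_kin' f g).symm

theorem symmetric_schr (hα : α ≤ 2) (hw : IsPotential α c w) : SymmetricOn (emb n) (schr w) := by
  intro f g
  have h1 := symmetric_kin f g
  have h2 := inner_pot hα hw f g
  rw [schr, LinearMap.add_apply, LinearMap.add_apply, inner_add_left, inner_add_right, h1, h2]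

/-! #### The weighted kinetic energy -/

/-- `∂_j ⟨x⟩ ^ (-α)` divided by `⟨x⟩ ^ (-α/2)`. -/
def kinErr (α : ℝ) (j : Fin n) (x : Rn n) : ℝ := -α * (x j * japPow (-α / 2 - 2) x)

theorem temperate_kinErr (α : ℝ) (j : Fin n) : (kinErr α j : Rn n → ℝ).HasTemperateGrowth :=
  temperate_const_mul _ ((temperate_coord j).mul (temperate_japPow _))

theorem abs_kinErr_le (hα₀ : 0 ≤ α) (j : Fin n) (x : Rn n) :
    |kinErr α j x| ≤ α * japPow (-α / 2 - 1) x := by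
  rw [kinErr, abs_mul, abs_neg, abs_of_nonneg hα₀, abs_mul, abs_of_pos (japPow_pos _ x)]
  refine mul_le_mul_of_nonneg_left ?_ hα₀
  have := abs_coord_mul_japPow_le (-α / 2 - 2) x j
  rwa [show -α / 2 - 2 + 1 = -α / 2 - 1 by ring] at this

theorem abs_kinErr_le_two (hα₀ : 0 ≤ α) (hα : α ≤ 2) (j : Fin n) (x : Rn n) :
    |kinErr α j x| ≤ 2 := by
  have h1 := abs_kinErr_le hα₀ j x
  have h2 := japPow_le_one (show -α / 2 - 1 ≤ 0 by linarith) x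
  have h3 := japPow_pos (-α / 2 - 1) x
  nlinarith

/-- Integration by parts moves one momentum across the weight `⟨x⟩^(-α)`. The derivative of the
weight is factored so that the error still contains a momentum with weight `⟨x⟩^(-α/2)`, the
quantity being estimated. -/
theorem sum_inner_weighted_momentum (α : ℝ) (f g : 𝓢(Rn n, ℂ)) :
    ∑ j, inner ℂ (emb n (sm (japPow (-α / 2)) (momentum j f)))
      (emb n (sm (japPow (-α / 2)) (momentum j g))) =
    inner ℂ (emb n (sm (japPow (-α)) f)) (emb n (momentumSq n g)) -
      Complex.I * ∑ j, inner ℂ (emb n (sm (kinErr α j) f))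
        (emb n (sm (japPow (-α / 2)) (momentum j g))) := by
  rw [inner_kin', Finset.mul_sum, ← Finset.sum_sub_distrib]
  refine Finset.sum_congr rfl fun j _ => ?_
  have hJ := temperate_japPow (n := n) (-α / 2)
  have hE := temperate_kinErr (n := n) α j
  have hE' : (fun x : Rn n => kinErr α j x * japPow (-α / 2) x).HasTemperateGrowth := hE.mul hJ
  have e1 := momentum_sm (j := j) (temperate_japPow (n := n) (-α)) hE' (fun x => by
    refine HasDerivAt.congr_deriv (hasLineDerivAt_japPow (-α) x j) ?_
    rw [kinErr, mul_assoc, mul_assoc, japPow_mul]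
    congr 3; ring) f
  have e2 : sm (japPow (-α)) (momentum j f) =
      sm (japPow (-α / 2)) (sm (japPow (-α / 2)) (momentum j f)) := by
    rw [sm_sm hJ hJ]
    congr 2
    ext x
    rw [japPow_mul]; congr 1; ring
  have e3 : sm (fun x => kinErr α j x * japPow (-α / 2) x) f =
      sm (japPow (-α / 2)) (sm (kinErr α j) f) := by
    rw [sm_sm hJ hE]
    congr 2
    ext x
    ring
  rw [e1, e2, e3, map_sub, map_smul, inner_sub_left, inner_smul_left,
    inner_sm hJ (sm (japPow (-α / 2)) (momentum j f)) (momentum j g),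
    inner_sm hJ (sm (kinErr α j) f) (momentum j g)]
  simp only [Complex.conj_I]
  ring

/-- Here `p²` is replaced by `(p² + w) - w`; the weight is exactly strong enough to make `w⟨x⟩^(-α)`
bounded. -/
theorem inner_weighted_momentumSq (hα : α ≤ 2) (hw : IsPotential α c w)
    (f : 𝓢(Rn n, ℂ)) : inner ℂ (emb n (sm (japPow (-α)) f)) (emb n (momentumSq n f)) =
      inner ℂ (emb n (sm (japPow (-α)) f)) (schr w f) -
      inner ℂ (emb n f) (rmul (fun x => w x * japPow (-α) x) (emb n f)) := by
  have e1 : rmul (fun x => w x * japPow (-α) x) (emb n f) = pot w (sm (japPow (-α)) f) := by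
    refine Lp.ext ?_
    filter_upwards [bmul_coe (hw.isBddMeas_mul (s := -α) (by linarith)) (emb n f), emb_coe f,
      pot_coe hα hw (sm (japPow (-α)) f)] with x h1 h2 h3
    rw [h3, sm_apply (temperate_japPow _)]
    refine h1.trans ?_
    rw [h2]
    push_cast; ring
  rw [schr_apply, inner_add_right, e1, inner_pot_sm hα hw (temperate_japPow _)]
  ring

/-- Completing the square in every `a j` gives `∑ (a j - N)² ≤ (1 + c + n) N²`, and a single term is
bounded by the sum. -/
theorem le_of_sum_sq_le {a : Fin n → ℝ} {N c : ℝ} (hc : 0 ≤ c) (hN : 0 ≤ N)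
    (hsum : ∑ j, a j ^ 2 ≤ (1 + c) * N ^ 2 + 2 * N * ∑ j, a j) (j : Fin n) :
    a j ≤ (c + n + 2) * N := by
  have hcomp : (a j - N) ^ 2 ≤ ∑ i, (a i - N) ^ 2 :=
    Finset.single_le_sum (f := fun i => (a i - N) ^ 2) (fun i _ => sq_nonneg _) (Finset.mem_univ j)
  have hexp : ∑ i, (a i - N) ^ 2 = ∑ i, a i ^ 2 - 2 * N * ∑ i, a i + n * N ^ 2 := by
    rw [Finset.mul_sum, ← Finset.sum_sub_distrib]
    have : (n : ℝ) * N ^ 2 = ∑ _i : Fin n, N ^ 2 := by simp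
    rw [this, ← Finset.sum_add_distrib]
    exact Finset.sum_congr rfl fun i _ => by ring
  have hn : (0 : ℝ) ≤ n := Nat.cast_nonneg n
  have hsq : (a j - N) ^ 2 ≤ ((c + n + 1) * N) ^ 2 := by
    have h3 : (a j - N) ^ 2 ≤ (c + n + 1) * N ^ 2 := by linarith
    calc _ ≤ (c + n + 1) * N ^ 2 := h3
      _ ≤ (c + n + 1) ^ 2 * N ^ 2 := by
          refine mul_le_mul_of_nonneg_right ?_ (sq_nonneg N)
          nlinarith
      _ = _ := by ring
  have h5 := (abs_le.1 (abs_le_of_sq_le_sq hsq (by positivity))).2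
  linarith

theorem norm_inner_le_mul {E : Type*} [NormedAddCommGroup E] [InnerProductSpace ℂ E] {u v : E}
    {a b : ℝ} (hu : ‖u‖ ≤ a) (hv : ‖v‖ ≤ b) : ‖(inner ℂ u v : ℂ)‖ ≤ a * b :=
  (norm_inner_le_norm _ _).trans
    (mul_le_mul hu hv (norm_nonneg _) ((norm_nonneg _).trans hu))

theorem IsPotential.norm_rmul_mul_le (hw : IsPotential α c w) {s : ℝ} (hs : α + s ≤ 0)
    (u : L2 n) : ‖rmul (fun x => w x * japPow s x) u‖ ≤ c * ‖u‖ :=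
  norm_bmul_apply_le (hw.isBddMeas_mul hs) (fun x => by
    rw [Complex.norm_real]
    exact hw.bound_mul hs x) u

/-- The kinetic energy with weight `⟨x⟩ ^ (-α)` is bounded relative to `p² + w`. -/
theorem norm_weighted_momentum_le (hα₀ : 0 ≤ α) (hα : α ≤ 2) (hw : IsPotential α c w)
    (f : 𝓢(Rn n, ℂ)) {N : ℝ} (h1 : ‖schr w f‖ ≤ N) (h2 : ‖emb n f‖ ≤ N) (j : Fin n) :
    ‖emb n (sm (japPow (-α / 2)) (momentum j f))‖ ≤ (c + n + 2) * N := by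
  have hN : 0 ≤ N := (norm_nonneg _).trans h1
  have hJ1 : ∀ x : Rn n, |japPow (-α) x| ≤ 1 := fun x => by
    rw [abs_of_pos (japPow_pos _ x)]; exact japPow_le_one (by linarith) x
  -- The three contributions are the pairing with `p² + w`, giving `N²`, the bounded function
  -- `w⟨x⟩^(-α)`, giving `c N²`, and the derivative of the weight, which is linear in the unknown
  -- norms.
  refine le_of_sum_sq_le (a := fun j => ‖emb n (sm (japPow (-α / 2)) (momentum j f))‖)
    hw.nonneg hN ?_ j
  have b1 : ‖(inner ℂ (emb n (sm (japPow (-α)) f)) (schr w f) : ℂ)‖ ≤ N * N := by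
    refine norm_inner_le_mul ?_ h1
    have := norm_emb_sm_le_of_bdd (temperate_japPow (-α)) hJ1 f
    linarith
  have b2 : ‖(inner ℂ (emb n f) (rmul (fun x => w x * japPow (-α) x) (emb n f)) : ℂ)‖ ≤
      N * (c * N) :=
    norm_inner_le_mul h2 ((hw.norm_rmul_mul_le (by linarith) _).trans
      (mul_le_mul_of_nonneg_left h2 hw.nonneg))
  have b3 : ‖∑ j, (inner ℂ (emb n (sm (kinErr α j) f))
      (emb n (sm (japPow (-α / 2)) (momentum j f))) : ℂ)‖ ≤
      2 * N * ∑ j, ‖emb n (sm (japPow (-α / 2)) (momentum j f))‖ := by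
    rw [Finset.mul_sum]
    refine norm_sum_le_of_le _ fun j _ => norm_inner_le_mul ?_ le_rfl
    exact (norm_emb_sm_le_of_bdd (temperate_kinErr α j) (abs_kinErr_le_two hα₀ hα j) f).trans
      (by linarith)
  have e1 : ((∑ j, ‖emb n (sm (japPow (-α / 2)) (momentum j f))‖ ^ 2 : ℝ) : ℂ) =
      ∑ j, inner ℂ (emb n (sm (japPow (-α / 2)) (momentum j f)))
        (emb n (sm (japPow (-α / 2)) (momentum j f))) := by
    push_cast
    exact Finset.sum_congr rfl fun j _ => by rw [inner_self_eq_norm_sq_to_K]; rfl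
  have e2 : ∑ j, ‖emb n (sm (japPow (-α / 2)) (momentum j f))‖ ^ 2 =
      ‖((∑ j, ‖emb n (sm (japPow (-α / 2)) (momentum j f))‖ ^ 2 : ℝ) : ℂ)‖ := by
    rw [Complex.norm_real, Real.norm_of_nonneg (Finset.sum_nonneg fun j _ => by positivity)]
  rw [e2, e1, sum_inner_weighted_momentum, inner_weighted_momentumSq hα hw]
  refine (norm_sub_le _ _).trans ?_
  rw [norm_mul, Complex.norm_I, one_mul]
  refine (add_le_add ((norm_sub_le _ _).trans (add_le_add b1 b2)) b3).trans (le_of_eq ?_)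
  ring

/-! #### Commutators of `p²` with multipliers -/

/-- `g` is a multiplier with first and second derivatives `∂_j g = g₁ j`, `∂_j² g = g₂ j`. -/
structure IsMultiplier (g : Rn n → ℝ) (g₁ g₂ : Fin n → Rn n → ℝ) : Prop where
  temperate : g.HasTemperateGrowth
  temperate₁ : ∀ j, (g₁ j).HasTemperateGrowth
  temperate₂ : ∀ j, (g₂ j).HasTemperateGrowth
  deriv : ∀ j x, HasLineDerivAt ℝ g (g₁ j x) x (ej j)
  deriv₂ : ∀ j x, HasLineDerivAt ℝ (g₁ j) (g₂ j x) x (ej j)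

/-- The commutator `[p², g] = ∑_j (-2i (∂_j g) p_j - ∂_j² g)`. -/
def kinComm (g₁ g₂ : Fin n → Rn n → ℝ) : 𝓢(Rn n, ℂ) →ₗ[ℂ] 𝓢(Rn n, ℂ) :=
  ∑ j, ((-2 * Complex.I) • (sm (g₁ j)).toLinearMap ∘ₗ (momentum j).toLinearMap -
    (sm (g₂ j)).toLinearMap)

theorem kinComm_apply (g₁ g₂ : Fin n → Rn n → ℝ) (f : 𝓢(Rn n, ℂ)) :
    kinComm g₁ g₂ f = ∑ j, ((-2 * Complex.I) • sm (g₁ j) (momentum j f) - sm (g₂ j) f) := by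
  simp [kinComm, LinearMap.sum_apply]

variable {g : Rn n → ℝ} {g₁ g₂ : Fin n → Rn n → ℝ}

theorem IsMultiplier.momentumSq_sm (hg : IsMultiplier g g₁ g₂) (f : 𝓢(Rn n, ℂ)) :
    momentumSq n (sm g f) = sm g (momentumSq n f) + kinComm g₁ g₂ f := by
  rw [momentumSq_apply, momentumSq_apply, kinComm_apply, map_sum, ← Finset.sum_add_distrib]
  refine Finset.sum_congr rfl fun j _ => ?_
  rw [momentum_sm hg.temperate (hg.temperate₁ j) (hg.deriv j), map_sub, map_smul,
    momentum_sm hg.temperate (hg.temperate₁ j) (hg.deriv j),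
    momentum_sm (hg.temperate₁ j) (hg.temperate₂ j) (hg.deriv₂ j), smul_sub, smul_smul,
    Complex.I_mul_I]
  module

/-- A commutator of two symmetric operators is antisymmetric, so no separate integration by parts
for the first order expression is needed. -/
theorem IsMultiplier.inner_kinComm (hg : IsMultiplier g g₁ g₂) (f k : 𝓢(Rn n, ℂ)) :
    inner ℂ (emb n (kinComm g₁ g₂ f)) (emb n k) =
      -inner ℂ (emb n f) (emb n (kinComm g₁ g₂ k)) := by
  have e1 : kinComm g₁ g₂ f = momentumSq n (sm g f) - sm g (momentumSq n f) := by
    rw [hg.momentumSq_sm]; abel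
  have e2 : kinComm g₁ g₂ k = momentumSq n (sm g k) - sm g (momentumSq n k) := by
    rw [hg.momentumSq_sm]; abel
  have s : ∀ a b : 𝓢(Rn n, ℂ), inner ℂ (emb n (momentumSq n a)) (emb n b) =
      inner ℂ (emb n a) (emb n (momentumSq n b)) := symmetric_kin
  rw [e1, e2, map_sub, map_sub, inner_sub_left, inner_sub_right, s, inner_sm hg.temperate,
    inner_sm hg.temperate, s]
  ring

theorem IsMultiplier.schr_sm (hα : α ≤ 2) (hw : IsPotential α c w) (hg : IsMultiplier g g₁ g₂)
    (hb : IsBddMeas fun x => ((g x : ℝ) : ℂ)) (f : 𝓢(Rn n, ℂ)) :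
    schr w (sm g f) = rmul g (schr w f) + emb n (kinComm g₁ g₂ f) := by
  rw [schr_apply, schr_apply, hg.momentumSq_sm, pot_sm hα hw hg.temperate hb, map_add, map_add,
    rmul_emb hb hg.temperate]
  abel

/-- Momenta are controlled only with weight `⟨x⟩^(-α/2)`, so first derivatives of the multiplier
must decay at that rate, while second derivatives need only be bounded. The bound depends on the
potential only through `c`, hence is uniform over truncations. -/
theorem IsMultiplier.norm_kinComm_le (hα₀ : 0 ≤ α) (hα : α ≤ 2) (hw : IsPotential α c w)
    (hg : IsMultiplier g g₁ g₂) {κ₁ κ₂ : ℝ} (h₁ : ∀ j x, |g₁ j x| ≤ κ₁ * japPow (-α / 2) x)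
    (h₂ : ∀ j x, |g₂ j x| ≤ κ₂) (f : 𝓢(Rn n, ℂ)) {N : ℝ} (hN : ‖schr w f‖ ≤ N)
    (hN' : ‖emb n f‖ ≤ N) :
    ‖emb n (kinComm g₁ g₂ f)‖ ≤ n * (2 * κ₁ * (c + n + 2) + κ₂) * N := by
  rw [kinComm_apply, map_sum]
  have hN0 : 0 ≤ N := (norm_nonneg _).trans hN
  calc _ ≤ ∑ _j : Fin n, (2 * κ₁ * (c + n + 2) + κ₂) * N := by
        refine norm_sum_le_of_le _ fun j _ => ?_
        have hκ₁ : 0 ≤ κ₁ :=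
          nonneg_of_mul_nonneg_left ((abs_nonneg _).trans (h₁ j 0)) (japPow_pos _ 0)
        have hκ₂ : 0 ≤ κ₂ := (abs_nonneg _).trans (h₂ j 0)
        rw [map_sub, map_smul]
        refine (norm_sub_le _ _).trans ?_
        rw [add_mul]
        refine add_le_add ?_ ?_
        · rw [norm_smul]
          have b1 := norm_emb_sm_le (hg.temperate₁ j) (temperate_japPow (-α / 2))
            (C := κ₁) (fun x => by rw [abs_of_pos (japPow_pos (-α / 2) x)]; exact h₁ j x)
            (momentum j f)
          have b2 := norm_weighted_momentum_le hα₀ hα hw f hN hN' j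
          have : ‖(-2 * Complex.I : ℂ)‖ = 2 := by simp
          rw [this]
          calc _ ≤ 2 * (κ₁ * ((c + n + 2) * N)) := by
                refine mul_le_mul_of_nonneg_left (b1.trans ?_) zero_le_two
                exact mul_le_mul_of_nonneg_left b2 hκ₁
            _ = _ := by ring
        · exact (norm_emb_sm_le_of_bdd (hg.temperate₂ j) (h₂ j) f).trans
            (mul_le_mul_of_nonneg_left hN' hκ₂)
    _ = _ := by simp [mul_assoc]

theorem isMultiplier_regWeight {ε : ℝ} (hε : 0 ≤ ε) (s : ℝ) :
    IsMultiplier (regWeight s ε : Rn n → ℝ) (regD s ε) (regDD s ε) where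
  temperate := temperate_regWeight hε s
  temperate₁ := temperate_regD hε s
  temperate₂ := temperate_regDD hε s
  deriv j x := hasLineDerivAt_regWeight hε s x j
  deriv₂ j x := hasLineDerivAt_regD hε s x j

end Schroedinger

end

end MourreRepulsive


namespace MourreRepulsive

noncomputable section

/-! ### Essential self-adjointness -/

section EssentialSelfAdjointness

variable {n : ℕ}

open Laplacian LineDeriv FourierTransform in
theorem momentumSq_eq_fourierMultiplier (f : 𝓢(Rn n, ℂ)) :
    momentumSq n f =
      ((2 * Real.pi) ^ 2) • SchwartzMap.fourierMultiplierCLM ℂ (fun ξ : Rn n => ‖ξ‖ ^ 2) f := by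
  have h1 := SchwartzMap.laplacian_eq_fourierMultiplierCLM f
  rw [SchwartzMap.laplacian_eq_sum (EuclideanSpace.basisFun (Fin n) ℝ)] at h1
  have h2 : momentumSq n f =
      -∑ i, ∂_{EuclideanSpace.basisFun (Fin n) ℝ i} (∂_{EuclideanSpace.basisFun (Fin n) ℝ i} f) := by
    rw [momentumSq_apply, ← Finset.sum_neg_distrib]
    refine Finset.sum_congr rfl fun j _ => ?_
    have h3 : momentum j (momentum j f) =
        (-Complex.I) • (-Complex.I) • LineDeriv.lineDerivOpCLM ℂ 𝓢(Rn n, ℂ) (ej j)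
          (LineDeriv.lineDerivOpCLM ℂ 𝓢(Rn n, ℂ) (ej j) f) := by
      simp only [momentum, FunLike.coe_smul, Pi.smul_apply, map_smul]
    rw [h3, smul_smul, neg_mul_neg, Complex.I_mul_I, neg_one_smul,
      EuclideanSpace.basisFun_apply]
    rfl
  rw [h2, h1, neg_smul, neg_neg]

-- The multiplier `1 / (c + (2π)²|ξ|²)` is `c⁻¹` times `eta ε` with `ε = (2π)²/c`. It has temperate
-- growth, so the solution of the equation stays in the Schwartz space.
open FourierTransform in
theorem exists_momentumSq_add_eq {c : ℝ} (hc : 0 < c) (h : 𝓢(Rn n, ℂ)) :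
    ∃ f, momentumSq n f + (c : ℂ) • f = h := by
  set ε := (2 * Real.pi) ^ 2 / c with hε
  have hε0 : 0 ≤ ε := by positivity
  have hG := temperate_eta (n := n) hε0
  have hS : (fun ξ : Rn n => ‖ξ‖ ^ 2).HasTemperateGrowth := by fun_prop
  refine ⟨c⁻¹ • SchwartzMap.fourierMultiplierCLM ℂ (eta ε : Rn n → ℝ) h, ?_⟩
  rw [momentumSq_eq_fourierMultiplier, map_smul,
    SchwartzMap.fourierMultiplierCLM_fourierMultiplierCLM_apply hS hG,
    SchwartzMap.fourierMultiplierCLM_apply, SchwartzMap.fourierMultiplierCLM_apply,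
    Complex.coe_smul, smul_smul, smul_smul, mul_inv_cancel₀ hc.ne', one_smul,
    ← FourierTransform.fourierInv_smul, ← FourierTransform.fourierInv_add]
  conv_rhs => rw [← FourierTransform.fourierInv_fourier_eq (E := 𝓢(Rn n, ℂ)) (F := 𝓢(Rn n, ℂ)) h]
  congr 1
  ext ξ
  rw [add_apply, smul_apply,
    SchwartzMap.smulLeftCLM_apply_apply (hS.mul hG), SchwartzMap.smulLeftCLM_apply_apply hG,
    smul_smul, ← add_smul]
  have h1 : 0 < 1 + ε * ‖ξ‖ ^ 2 := by positivity
  have : (2 * Real.pi) ^ 2 * c⁻¹ * ((fun ξ : Rn n => ‖ξ‖ ^ 2) * (eta ε : Rn n → ℝ) : Rn n → ℝ) ξ + eta ε ξ = 1 := by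
    rw [Pi.mul_apply, eta, ← div_eq_mul_inv, ← hε]
    field_simp
    ring
  rw [this, one_smul]

theorem denseRange_kin_add {c : ℝ} (hc : 0 < c) : DenseRange (kin n + (c : ℂ) • emb n) := by
  refine denseRange_emb.mono ?_
  rintro _ ⟨h, rfl⟩
  obtain ⟨f, rfl⟩ := exists_momentumSq_add_eq hc h
  refine ⟨f, ?_⟩
  simp only [LinearMap.add_apply, LinearMap.smul_apply, map_add, map_smul]
  rfl

theorem mul_norm_le_norm_kin_add {c : ℝ} (hc : 0 ≤ c) (f : 𝓢(Rn n, ℂ)) :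
    c * ‖emb n f‖ ≤ ‖(kin n + (c : ℂ) • emb n) f‖ := by
  refine le_of_sq_le_sq ?_ (norm_nonneg _)
  have h0 : 0 ≤ RCLike.re (inner ℂ (kin n f) (emb n f) : ℂ) := by
    have := inner_kin f f
    rw [kin, LinearMap.comp_apply]
    change 0 ≤ RCLike.re (inner ℂ (emb n (momentumSq n f)) (emb n f) : ℂ)
    rw [this, map_sum]
    exact Finset.sum_nonneg fun j _ => inner_self_nonneg
  rw [LinearMap.add_apply, LinearMap.smul_apply, norm_add_sq (𝕜 := ℂ), inner_smul_right, norm_smul,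
    Complex.norm_real, Real.norm_of_nonneg hc]
  have h1 : RCLike.re ((c : ℂ) * inner ℂ (kin n f) (emb n f)) =
      c * RCLike.re (inner ℂ (kin n f) (emb n f) : ℂ) := by simp
  rw [h1]
  have := mul_nonneg hc h0
  nlinarith [sq_nonneg ‖kin n f‖]

theorem norm_pot_le {w : Rn n → ℝ} {c : ℝ} (hw : IsPotential 0 c w) (f : 𝓢(Rn n, ℂ)) :
    ‖pot w f‖ ≤ c * ‖emb n f‖ := by
  refine norm_le_of_ae ?_
  filter_upwards [pot_coe zero_le_two hw f, emb_coe f] with x h1 h2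
  rw [h1, h2, norm_mul, Complex.norm_real]
  refine mul_le_mul_of_nonneg_right ?_ (norm_nonneg _)
  simpa [japPow_zero] using hw.bound x

/-- The dense range of `p² + c` is transported by successive perturbations of relative bound below
one. The detour through a large imaginary shift `μ` makes room for the bounded potential. -/
theorem denseRange_shift_schr_of_bdd {w : Rn n → ℝ} {B : ℝ} (hw : IsPotential 0 B w) {s : ℝ}
    (hs : |s| = 1) : DenseRange (shift (emb n) (schr w) (s * Complex.I)) := by
  have hB := hw.nonneg
  -- With `|μ| = B + 2` the potential has relative bound `B/(B+2)`, and moving the shift from `μ`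
  -- back to `s` has relative bound `(B+1)/(B+2)`.
  set μ : ℝ := s * (B + 2) with hμ
  have hμa : |μ| = B + 2 := by
    rw [hμ, abs_mul, hs, one_mul, abs_of_nonneg (by linarith)]
  set c : ℝ := 2 * (B + 2) with hc
  have hc0 : 0 < c := by linarith
  have symm1 : SymmetricOn (emb n) (kin n + (c : ℂ) • emb n) := fun f g => by
    simp only [LinearMap.add_apply, LinearMap.smul_apply, inner_add_left, inner_add_right,
      inner_smul_left, inner_smul_right, Complex.conj_ofReal, symmetric_kin f g]
  have hlow := fun f => mul_norm_le_norm_kin_add (n := n) hc0.le f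
  -- add `μ i`
  have d1 : DenseRange (kin n + (c : ℂ) • emb n + ((μ : ℂ) * Complex.I) • emb n) := by
    refine denseRange_add_of_norm_le (denseRange_kin_add hc0) (k := 1 / 2) (by norm_num)
      (by norm_num) fun f => ?_
    rw [LinearMap.smul_apply, norm_smul]
    simp only [norm_mul, Complex.norm_real, Real.norm_eq_abs, Complex.norm_I, mul_one, hμa]
    have := hlow f
    rw [hc] at this
    linarith
  -- remove `c`
  have d2 : DenseRange (kin n + (c : ℂ) • emb n + ((μ : ℂ) * Complex.I) • emb n +
      (-(c : ℂ)) • emb n) := by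
    -- As `|μ| = c/2`, the squared norm of `(p² + c + iμ)f` is at least `(5/4)(c‖f‖)²`. The relative
    -- bound is `2/√5`, just below `9/10`.
    refine denseRange_add_of_norm_le d1 (k := 9 / 10) (by norm_num) (by norm_num) fun f => ?_
    rw [LinearMap.smul_apply, norm_smul, norm_neg, Complex.norm_real, Real.norm_of_nonneg hc0.le]
    refine le_of_sq_le_sq ?_ (by positivity)
    have h1 := symm1.norm_shift_sq μ f
    rw [shift] at h1
    rw [mul_pow (9 / 10 : ℝ), h1]
    have h2 : (c * ‖emb n f‖) ^ 2 ≤ ‖(kin n + (c : ℂ) • emb n) f‖ ^ 2 :=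
      pow_le_pow_left₀ (by positivity) (hlow f) 2
    have h3 : μ ^ 2 = (c / 2) ^ 2 := by rw [← sq_abs, hμa, hc]; ring
    rw [h3]
    nlinarith [sq_nonneg (c * ‖emb n f‖)]
  have e2 : kin n + (c : ℂ) • emb n + ((μ : ℂ) * Complex.I) • emb n + (-(c : ℂ)) • emb n =
      shift (emb n) (kin n) (μ * Complex.I) := by
    rw [shift]; module
  rw [e2] at d2
  -- add the potential
  have d3 : DenseRange (shift (emb n) (kin n) (μ * Complex.I) + pot w) := by
    refine denseRange_add_of_norm_le d2 (k := B / (B + 2)) (by positivity) ?_ fun f => ?_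
    · rw [div_lt_one (by linarith)]; linarith
    · have h1 := symmetric_kin.mul_norm_le_shift μ f
      rw [hμa] at h1
      rw [div_mul_eq_mul_div, le_div_iff₀ (by linarith)]
      have := norm_pot_le hw f
      nlinarith
  have e3 : shift (emb n) (kin n) (μ * Complex.I) + pot w =
      shift (emb n) (schr w) (μ * Complex.I) := by
    rw [shift, shift, schr]; abel
  rw [e3] at d3
  have d4 : DenseRange (shift (emb n) (schr w) (μ * Complex.I) +
      (((s - μ : ℝ) : ℂ) * Complex.I) • emb n) := by
    refine denseRange_add_of_norm_le d3 (k := (B + 1) / (B + 2)) (by positivity) ?_ fun f => ?_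
    · rw [div_lt_one (by linarith)]; linarith
    · have h1 := (symmetric_schr zero_le_two hw).mul_norm_le_shift μ f
      rw [hμa] at h1
      have h2 : |s - μ| = B + 1 := by
        rw [hμ, show s - s * (B + 2) = -(s * (B + 1)) by ring, abs_neg, abs_mul, hs, one_mul,
          abs_of_nonneg (by linarith)]
      rw [LinearMap.smul_apply, norm_smul, norm_mul, Complex.norm_real, Complex.norm_I, mul_one,
        Real.norm_eq_abs, h2, div_mul_eq_mul_div, le_div_iff₀ (by linarith)]
      nlinarith
  have e4 : shift (emb n) (schr w) (μ * Complex.I) + (((s - μ : ℝ) : ℂ) * Complex.I) • emb n =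
      shift (emb n) (schr w) (s * Complex.I) := by
    rw [shift, shift]
    push_cast
    module
  rwa [e4] at d4

theorem div_one_add_le_rpow {t s : ℝ} (ht : 0 ≤ t) (hs₀ : 0 ≤ s) (hs : s ≤ 1) :
    t / (1 + t) ≤ t ^ s := by
  rw [div_le_iff₀ (by linarith)]
  rcases le_total t 1 with h | h
  · have := Real.rpow_le_rpow_of_exponent_ge_of_imp ht h hs (fun h0 h1 => by
      simp_all)
    rw [Real.rpow_one] at this
    nlinarith [Real.rpow_nonneg ht s]
  · have := Real.one_le_rpow h hs₀
    nlinarith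

variable {α c : ℝ} {w : Rn n → ℝ}

theorem IsPotential.mul_eta (hw : IsPotential α c w) {ε : ℝ} (hε : 0 ≤ ε) :
    IsPotential α c fun x => w x * eta ε x where
  cont := hw.cont.mul (continuous_of_temperate (temperate_eta hε))
  bound x := by
    rw [abs_mul, abs_of_pos (eta_pos hε x)]
    calc _ ≤ |w x| * 1 := mul_le_mul_of_nonneg_left (eta_le_one hε x) (abs_nonneg _)
      _ ≤ _ := by rw [mul_one]; exact hw.bound x

theorem IsPotential.mul_eta_bdd (hα : α ≤ 2) (hw : IsPotential α c w) {ε : ℝ} (hε : 0 < ε)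
    (hε1 : ε ≤ 1) : IsPotential 0 (c / ε) fun x => w x * eta ε x where
  cont := (hw.mul_eta hε.le).cont
  bound x := by
    rw [japPow_zero, mul_one, abs_mul, abs_of_pos (eta_pos hε.le x), le_div_iff₀ hε]
    have h1 := eps_japPow_two_mul_eta_le hε.le hε1 x
    have h2 := japPow_le_japPow hα x
    have h3 := hw.bound x
    have h4 := (eta_pos hε.le x).le
    have h5 := hw.nonneg
    calc |w x| * eta ε x * ε ≤ c * japPow 2 x * eta ε x * ε := by
          gcongr
          exact h3.trans (mul_le_mul_of_nonneg_left h2 h5)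
      _ = c * (ε * japPow 2 x * eta ε x) := by ring
      _ ≤ c * 1 := mul_le_mul_of_nonneg_left h1 h5
      _ = c := mul_one c

/-- With `t = ε'|x|²` the truncation changes `w` by the factor `t/(1+t) ≤ t^(1-α/2)`. The growth
`⟨x⟩^α ⟨x⟩^(2-α) = ⟨x⟩²` is absorbed by the fixed outer cutoff. -/
theorem IsPotential.abs_sub_mul_eta_le (hα₀ : 0 ≤ α) (hα : α ≤ 2) (hw : IsPotential α c w)
    {ε ε' : ℝ} (hε : 0 < ε) (hε1 : ε ≤ 1) (hε' : 0 ≤ ε') (x : Rn n) :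
    |(w x * eta ε' x - w x) * eta ε x| ≤ c / ε * ε' ^ (1 - α / 2) := by
  have h1 := eps_japPow_two_mul_eta_le hε.le hε1 x
  have ht : 0 ≤ ε' * ‖x‖ ^ 2 := by positivity
  have e1 : w x * eta ε' x - w x = -(w x * (ε' * ‖x‖ ^ 2 / (1 + ε' * ‖x‖ ^ 2))) := by
    rw [eta]; field_simp; ring
  have h2 := div_one_add_le_rpow ht (s := 1 - α / 2) (by linarith) (by linarith)
  have h3 : (ε' * ‖x‖ ^ 2) ^ (1 - α / 2) ≤ ε' ^ (1 - α / 2) * japPow (2 - α) x := by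
    rw [Real.mul_rpow hε' (by positivity)]
    refine mul_le_mul_of_nonneg_left ?_ (Real.rpow_nonneg hε' _)
    rw [japPow, show (2 - α) / 2 = 1 - α / 2 by ring]
    exact Real.rpow_le_rpow (by positivity) (by linarith) (by linarith)
  have h0 : 0 ≤ ε' * ‖x‖ ^ 2 / (1 + ε' * ‖x‖ ^ 2) := by positivity
  have hr := Real.rpow_nonneg hε' (1 - α / 2)
  rw [e1, neg_mul, abs_neg, abs_mul, abs_mul, abs_of_pos (eta_pos hε.le x), abs_of_nonneg h0,
    div_mul_eq_mul_div, le_div_iff₀ hε]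
  have hη := (eta_pos hε.le x).le
  have hc := hw.nonneg
  calc _ ≤ (c * japPow α x) * (ε' ^ (1 - α / 2) * japPow (2 - α) x) * eta ε x * ε := by
        gcongr
        · exact mul_nonneg hc (japPow_pos α x).le
        · exact hw.bound x
        · exact h2.trans h3
    _ = c * ε' ^ (1 - α / 2) * (ε * (japPow α x * japPow (2 - α) x) * eta ε x) := by ring
    _ = c * ε' ^ (1 - α / 2) * (ε * japPow 2 x * eta ε x) := by
        rw [japPow_mul]; congr 4; ring
    _ ≤ c * ε' ^ (1 - α / 2) * 1 := mul_le_mul_of_nonneg_left h1 (mul_nonneg hc hr)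
    _ = _ := mul_one _

/-- Because `α < 2`, the truncation error tends to zero with the truncation parameter. It matters
that the truncated potential satisfies the original growth bound with the same `c`: later estimates
then do not see the bound `B`. -/
theorem exists_bdd_potential (hα₀ : 0 ≤ α) (hα : α < 2) (hw : IsPotential α c w) {ε : ℝ}
    (hε : 0 < ε) (hε1 : ε ≤ 1) {δ : ℝ} (hδ : 0 < δ) :
    ∃ (w' : Rn n → ℝ) (B : ℝ), IsPotential 0 B w' ∧ IsPotential α c w' ∧
      ∀ x, |(w' x - w x) * eta ε x| ≤ δ := by
  have hs : 0 < 1 - α / 2 := by linarith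
  have h1 : Filter.Tendsto (fun e : ℝ => c / ε * e ^ (1 - α / 2)) (nhdsWithin 0 (Set.Ioi 0))
      (nhds 0) := by
    have h2 := ((Real.continuousAt_rpow_const 0 (1 - α / 2) (Or.inr hs.le)).tendsto.const_mul
      (c / ε)).mono_left (nhdsWithin_le_nhds (s := Set.Ioi 0))
    rwa [Real.zero_rpow hs.ne', mul_zero] at h2
  obtain ⟨e, h2, he0, he1⟩ := ((h1.eventually_le_const hδ).and
    (Ioc_mem_nhdsGT (zero_lt_one' ℝ))).exists
  exact ⟨_, _, hw.mul_eta_bdd hα.le he0 he1, hw.mul_eta he0.le, fun x =>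
    (hw.abs_sub_mul_eta_le hα₀ hα.le hε hε1 he0.le x).trans h2⟩

theorem regWeight_zero (ε : ℝ) : (regWeight 0 ε : Rn n → ℝ) = eta ε := by
  ext x
  simp [regWeight, japPow_zero]

theorem isMultiplier_eta {ε : ℝ} (hε : 0 ≤ ε) :
    IsMultiplier (eta ε : Rn n → ℝ) (regD 0 ε) (regDD 0 ε) := by
  rw [← regWeight_zero]; exact isMultiplier_regWeight hε 0

theorem isBddMeas_eta {ε : ℝ} (hε : 0 ≤ ε) : IsBddMeas fun x : Rn n => ((eta ε x : ℝ) : ℂ) :=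
  isBddMeas_temperate (temperate_eta hε) (C := 1) fun x => by
    rw [abs_of_pos (eta_pos hε x)]; exact eta_le_one hε x

theorem norm_rmul_eta_le {ε : ℝ} (hε : 0 ≤ ε) (u : L2 n) : ‖rmul (eta ε) u‖ ≤ ‖u‖ := by
  have := norm_bmul_apply_le (isBddMeas_eta (n := n) hε) (C := 1) (fun x => by
    rw [Complex.norm_real, Real.norm_of_nonneg (eta_pos hε x).le]; exact eta_le_one hε x) u
  rwa [one_mul] at this

/-- The size of the commutator of `p²` with the cutoff `eta ε`. -/
def cutoffErr (n : ℕ) (α c ε : ℝ) : ℝ :=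
  n * (2 * (2 * ε ^ ((1 - α / 2) / 2)) * (c + n + 2) + 10 * ε)

theorem norm_kinComm_eta_le (hα₀ : 0 ≤ α) (hα : α ≤ 2) (hw : IsPotential α c w) {ε : ℝ}
    (hε : 0 < ε) (hε1 : ε ≤ 1) (f : 𝓢(Rn n, ℂ)) {N : ℝ} (hN : ‖schr w f‖ ≤ N)
    (hN' : ‖emb n f‖ ≤ N) :
    ‖emb n (kinComm (regD 0 ε) (regDD 0 ε) f)‖ ≤ cutoffErr n α c ε * N := by
  refine (isMultiplier_eta hε.le).norm_kinComm_le hα₀ hα hw (fun j x => ?_) (fun j x => ?_) f hN hN'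
  · have := abs_regD_zero_le hε hε1 (show 0 ≤ α / 2 by linarith) (show α / 2 ≤ 1 by linarith) j x
    rwa [← neg_div] at this
  · exact abs_regDD_zero_le hε.le hε1 j x

theorem tendsto_rmul_eta (u : L2 n) :
    Filter.Tendsto (fun k : ℕ => rmul (eta (1 / ((k : ℝ) + 1))) u) Filter.atTop (nhds u) := by
  have hpos : ∀ k : ℕ, 0 ≤ 1 / ((k : ℝ) + 1) := fun k => by positivity
  have h1 := tendsto_bmul_zero (n := n)
    (g := fun (k : ℕ) x => (-1 : ℂ) + ((eta (1 / ((k : ℝ) + 1)) x : ℝ) : ℂ)) (C := 2)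
    (fun k => (isBddMeas_const _).add (isBddMeas_eta (hpos k))) (fun k x => by
      refine (norm_add_le _ _).trans ?_
      rw [Complex.norm_real, Real.norm_of_nonneg (eta_pos (hpos k) x).le]
      have := eta_le_one (hpos k) x
      simp only [norm_neg, norm_one]
      linarith) (fun x => by
      have h2 : Filter.Tendsto (fun k : ℕ => eta (1 / ((k : ℝ) + 1)) x) Filter.atTop (nhds 1) := by
        have h3 := ((tendsto_one_div_add_atTop_nhds_zero_nat (𝕜 := ℝ)).mul_const (‖x‖ ^ 2)).const_add
          1
        rw [zero_mul, add_zero] at h3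
        have h4 := h3.inv₀ one_ne_zero
        rwa [inv_one] at h4
      have h3 := ((Complex.continuous_ofReal.tendsto _).comp h2).const_add (-1 : ℂ)
      simpa using h3) u
  have h2 := h1.const_add u
  rw [add_zero] at h2
  refine h2.congr fun k => ?_
  rw [bmul_add (isBddMeas_const _) (isBddMeas_eta (hpos k)), bmul_const]
  simp [rmul]

/-- Approximate `ηψ` by `A = (p² + w' + si)f` with a bounded truncation `w'`. Then `ηA` is `(p² + w
+ si)(ηf)`, which is orthogonal to `ψ`, plus a truncation error, minus `[p², η]f`. Letting the
approximation parameter tend to zero leaves only the commutator. -/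
theorem norm_rmul_eta_sq_le (hα₀ : 0 ≤ α) (hα : α < 2) (hw : IsPotential α c w) {s : ℝ}
    (hs : |s| = 1) {ψ : L2 n} (hψ : ∀ f, inner ℂ (shift (emb n) (schr w) (s * Complex.I) f) ψ = 0)
    {ε : ℝ} (hε : 0 < ε) (hε1 : ε ≤ 1) :
    ‖rmul (eta ε) ψ‖ ^ 2 ≤ cutoffErr n α c ε * ‖ψ‖ * ‖ψ‖ := by
  set κ := cutoffErr n α c ε
  have hb := isBddMeas_eta (n := n) hε.le
  have hη := temperate_eta (n := n) hε.le
  have key : ∀ δ : ℝ, 0 < δ → ‖rmul (eta ε) ψ‖ ^ 2 ≤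
      (δ * (‖ψ‖ + δ) + κ * (‖ψ‖ + δ) + δ) * ‖ψ‖ := by
    intro δ hδ
    obtain ⟨w', B, hB, hw', hww⟩ := exists_bdd_potential hα₀ hα hw hε hε1 hδ
    obtain ⟨f, hf⟩ := (denseRange_shift_schr_of_bdd hB hs).exists_dist_lt (rmul (eta ε) ψ) hδ
    rw [dist_eq_norm] at hf
    set A := shift (emb n) (schr w') (s * Complex.I) f with hA
    have hAN : ‖A‖ ≤ ‖ψ‖ + δ := by
      have h1 : A = rmul (eta ε) ψ - (rmul (eta ε) ψ - A) := by abel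
      rw [h1]
      exact (norm_sub_le _ _).trans (add_le_add (norm_rmul_eta_le hε.le ψ) hf.le)
    have hsymm := symmetric_schr hα.le hw'
    have hN1 : ‖schr w' f‖ ≤ ‖ψ‖ + δ := (hsymm.norm_le_shift s f).trans hAN
    have hN2 : ‖emb n f‖ ≤ ‖ψ‖ + δ := by
      have := hsymm.mul_norm_le_shift s f
      rw [hs, one_mul] at this
      exact this.trans hAN
    have hC := norm_kinComm_eta_le hα₀ hα.le hw' hε hε1 f hN1 hN2
    have hP : ‖pot w' (sm (eta ε) f) - pot w (sm (eta ε) f)‖ ≤ δ * ‖emb n f‖ := by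
      refine norm_le_of_ae ?_
      filter_upwards [pot_coe hα.le hw' (sm (eta ε) f), pot_coe hα.le hw (sm (eta ε) f), emb_coe f,
        Lp.coeFn_sub (pot w' (sm (eta ε) f)) (pot w (sm (eta ε) f))] with x h1 h2 h3 h4
      rw [h4, Pi.sub_apply, h1, h2, h3, sm_apply hη]
      have e : (w' x : ℂ) * (eta ε x * f x) - w x * (eta ε x * f x) =
          (((w' x - w x) * eta ε x : ℝ) : ℂ) * f x := by push_cast; ring
      rw [e, norm_mul, Complex.norm_real]
      exact mul_le_mul_of_nonneg_right (hww x) (norm_nonneg _)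
    have e1 : rmul (eta ε) A = shift (emb n) (schr w) (s * Complex.I) (sm (eta ε) f) +
        (pot w' (sm (eta ε) f) - pot w (sm (eta ε) f)) -
        emb n (kinComm (regD 0 ε) (regDD 0 ε) f) := by
      have h1 := (isMultiplier_eta hε.le).schr_sm hα.le hw' hb f
      have h2 : schr w' (sm (eta ε) f) - schr w (sm (eta ε) f) =
          pot w' (sm (eta ε) f) - pot w (sm (eta ε) f) := by
        rw [schr_apply, schr_apply]; abel
      rw [hA, shift_apply, shift_apply, map_add, map_smul, rmul_emb hb hη, ← h2, h1]
      abel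
    have e2 : inner ℂ (rmul (eta ε) ψ) (rmul (eta ε) ψ) =
        inner ℂ (rmul (eta ε) ψ - A) (rmul (eta ε) ψ) + (inner ℂ (pot w' (sm (eta ε) f) -
          pot w (sm (eta ε) f)) ψ - inner ℂ (emb n (kinComm (regD 0 ε) (regDD 0 ε) f)) ψ) := by
      have h1 := inner_rmul hb A ψ
      rw [e1, inner_sub_left, inner_add_left, hψ, zero_add] at h1
      rw [h1, inner_sub_left]
      ring
    have e3 : ‖rmul (eta ε) ψ‖ ^ 2 = ‖(inner ℂ (rmul (eta ε) ψ) (rmul (eta ε) ψ) : ℂ)‖ := by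
      rw [inner_self_eq_norm_sq_to_K]; simp
    rw [e3, e2]
    refine (norm_add_le _ _).trans ((add_le_add (norm_inner_le_mul hf.le
      (norm_rmul_eta_le hε.le ψ)) ((norm_sub_le _ _).trans (add_le_add
        (norm_inner_le_mul (hP.trans (mul_le_mul_of_nonneg_left hN2 hδ.le)) le_rfl)
        (norm_inner_le_mul hC le_rfl)))).trans (le_of_eq ?_))
    ring
  have hF : Continuous fun δ : ℝ => (δ * (‖ψ‖ + δ) + κ * (‖ψ‖ + δ) + δ) * ‖ψ‖ := by fun_prop
  have := ge_of_tendsto ((hF.tendsto 0).mono_left (nhdsWithin_le_nhds (s := Set.Ioi 0)))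
    (eventually_nhdsWithin_of_forall fun δ hδ => key δ hδ)
  simpa using this

theorem tendsto_cutoffErr (hα : α < 2) :
    Filter.Tendsto (fun k : ℕ => cutoffErr n α c (1 / ((k : ℝ) + 1))) Filter.atTop (nhds 0) := by
  have hs : 0 < (1 - α / 2) / 2 := by linarith
  have h1 : ContinuousAt (cutoffErr n α c) 0 := by
    unfold cutoffErr
    have := Real.continuousAt_rpow_const 0 ((1 - α / 2) / 2) (Or.inr hs.le)
    fun_prop
  have h2 := h1.tendsto.comp (tendsto_one_div_add_atTop_nhds_zero_nat (𝕜 := ℝ))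
  have h3 : cutoffErr n α c 0 = 0 := by simp [cutoffErr, Real.zero_rpow hs.ne']
  rwa [h3] at h2

/-- As `ε` tends to zero, `η_ε ψ` tends to `ψ` while the commutator constant vanishes, so a vector
orthogonal to the range is zero. -/
theorem denseRange_shift_schr (hα₀ : 0 ≤ α) (hα : α < 2) (hw : IsPotential α c w) {s : ℝ}
    (hs : |s| = 1) : DenseRange (shift (emb n) (schr w) (s * Complex.I)) := by
  refine denseRange_of_forall_inner_eq_zero fun ψ hψ => ?_
  have h1 := ((tendsto_rmul_eta ψ).norm).pow 2
  have h2 := ((tendsto_cutoffErr (n := n) (c := c) hα).mul_const ‖ψ‖).mul_const ‖ψ‖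
  have h3 := le_of_tendsto_of_tendsto' h1 h2 fun k => by
    refine norm_rmul_eta_sq_le hα₀ hα hw hs hψ (by positivity) ?_
    rw [div_le_one (by positivity)]
    have : (0 : ℝ) ≤ k := Nat.cast_nonneg k
    linarith
  rw [zero_mul, zero_mul] at h3
  exact norm_eq_zero.1 (pow_eq_zero_iff two_ne_zero |>.1 (le_antisymm h3 (sq_nonneg _)))

/-- `p² + w` is essentially self-adjoint on the Schwartz functions. -/
theorem essSelfAdjoint_schr (hα₀ : 0 ≤ α) (hα : α < 2) (hw : IsPotential α c w) :
    EssSelfAdjoint (emb n) (schr w) where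
  dense := denseRange_emb
  symm := symmetric_schr hα.le hw
  plus := by simpa using denseRange_shift_schr hα₀ hα hw (s := 1) (by simp)
  minus := by simpa using denseRange_shift_schr hα₀ hα hw (s := -1) (by simp)

end EssentialSelfAdjointness

end

end MourreRepulsive


namespace MourreRepulsive

noncomputable section

/-! ### Identification of the graphs of the operators -/

section Graphs

/-- The graph of `closure` is the closed graph only for a closable operator. If `(0, v)` is a limit
of graph points, symmetry makes `v` orthogonal to the dense initial domain, so `v = 0`. -/
theorem SymmetricOn.closure_graph {E D : Type*} [NormedAddCommGroup E] [InnerProductSpace ℂ E]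
    [AddCommGroup D] [Module ℂ D] {i T : D →ₗ[ℂ] E} (h : SymmetricOn i T) (hi : DenseRange i)
    {S : E →ₗ.[ℂ] E} (hS : S.graph = LinearMap.range (i.prod T)) :
    S.closure.graph = (LinearMap.range (i.prod T)).topologicalClosure := by
  have h0 : ∀ q ∈ (LinearMap.range (i.prod T)).topologicalClosure, ∀ g,
      inner ℂ q.2 (i g) = inner ℂ q.1 (T g) := by
    intro q hq g
    have hcl : IsClosed {q : E × E | inner ℂ q.2 (i g) = inner ℂ q.1 (T g)} :=
      isClosed_eq (by fun_prop) (by fun_prop)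
    refine closure_minimal ?_ hcl hq
    rintro _ ⟨f, rfl⟩
    exact h f g
  have hc : S.IsClosable := by
    refine ⟨(LinearMap.range (i.prod T)).topologicalClosure.toLinearPMap, ?_⟩
    rw [hS, Submodule.toLinearPMap_graph_eq]
    rintro ⟨u, v⟩ hq (rfl : u = 0)
    have h2 : Dense ((LinearMap.range i : Submodule ℂ E) : Set E) := by
      rwa [LinearMap.coe_range]
    refine h2.eq_zero_of_inner_left ℂ ?_
    rintro _ ⟨g, rfl⟩
    simpa using h0 _ hq g
  rw [← hc.graph_closure_eq_closure_graph, hS]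

variable {n : ℕ}

theorem mem_schwartzGraph_iff (D : 𝓢(Rn n, ℂ) →ₗ[ℂ] (Rn n → ℂ)) {T : 𝓢(Rn n, ℂ) →ₗ[ℂ] L2 n}
    (hT : ∀ f, T f =ᵐ[volume] D f) : schwartzGraph D = LinearMap.range ((emb n).prod T) := by
  ext ⟨u, v⟩
  constructor
  · rintro ⟨f, h1, h2⟩
    refine ⟨f, Prod.ext (Lp.ext ?_) (Lp.ext ?_)⟩
    · exact (emb_coe f).trans h1.symm
    · exact (hT f).trans h2.symm
  · rintro ⟨f, hf⟩
    obtain ⟨rfl, rfl⟩ := Prod.ext_iff.1 hf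
    exact ⟨f, emb_coe f, hT f⟩

theorem closure_schwartzOp_graph (D : 𝓢(Rn n, ℂ) →ₗ[ℂ] (Rn n → ℂ)) {T : 𝓢(Rn n, ℂ) →ₗ[ℂ] L2 n}
    (hT : ∀ f, T f =ᵐ[volume] D f) (h : SymmetricOn (emb n) T) :
    (schwartzOp D).closure.graph = (LinearMap.range ((emb n).prod T)).topologicalClosure :=
  h.closure_graph denseRange_emb ((schwartzOp_graph D).trans (mem_schwartzGraph_iff D hT))

/-- The repulsive potential. -/
def repulsive (σ α : ℝ) (x : Rn n) : ℝ := -(σ * ‖x‖ ^ α)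

variable {σ α : ℝ}

theorem isPotential_repulsive (hσ : 0 ≤ σ) (hα₀ : 0 ≤ α) :
    IsPotential α σ (repulsive σ α : Rn n → ℝ) where
  cont := (continuous_const.mul (continuous_norm.rpow_const fun _ => Or.inr hα₀)).neg
  bound x := by
    rw [repulsive, abs_neg, abs_of_nonneg (by positivity)]
    refine mul_le_mul_of_nonneg_left ?_ hσ
    have h1 := norm_le_japPow_one x
    refine (Real.rpow_le_rpow (norm_nonneg x) h1 hα₀).trans (le_of_eq ?_)
    rw [japPow, japPow, ← Real.rpow_mul (by positivity)]
    congr 1; ring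

theorem freeHamiltonian_graph (hσ : 0 ≤ σ) (hα₀ : 0 ≤ α) (hα : α ≤ 2) :
    (freeHamiltonian n σ α).graph =
      (LinearMap.range ((emb n).prod (schr (repulsive σ α)))).topologicalClosure := by
  have hw := isPotential_repulsive (n := n) hσ hα₀
  refine closure_schwartzOp_graph _ (fun f => ?_) (symmetric_schr hα hw)
  filter_upwards [Lp.coeFn_add (emb n (momentumSq n f)) (pot (repulsive σ α) f),
    emb_coe (momentumSq n f), pot_coe hα hw f] with x h1 h2 h3
  rw [schr_apply, h1, Pi.add_apply, h2, h3]
  change _ = momentumSq n f x - ((σ * ‖x‖ ^ α : ℝ) : ℂ) * f x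
  rw [repulsive]
  push_cast
  ring

variable {V : Rn n → ℝ} {B : ℝ}

theorem IsPotential.add {c c' : ℝ} {w w' : Rn n → ℝ} (hw : IsPotential α c w)
    (hw' : IsPotential α c' w') : IsPotential α (c + c') fun x => w x + w' x where
  cont := hw.cont.add hw'.cont
  bound x := by
    rw [add_mul]
    exact (abs_add_le _ _).trans (add_le_add (hw.bound x) (hw'.bound x))

theorem isPotential_of_bdd (hα₀ : 0 ≤ α) (hV : Continuous V) (hB : ∀ x, |V x| ≤ B) :
    IsPotential α B V where
  cont := hV
  bound x := (hB x).trans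
    (le_mul_of_one_le_right ((abs_nonneg _).trans (hB x)) (one_le_japPow hα₀ x))

/-- The potential of the Hamiltonian. -/
def totalPot (σ α : ℝ) (V : Rn n → ℝ) (x : Rn n) : ℝ := repulsive σ α x + V x

theorem isPotential_totalPot (hσ : 0 ≤ σ) (hα₀ : 0 ≤ α) (hV : Continuous V)
    (hB : ∀ x, |V x| ≤ B) : IsPotential α (σ + B) (totalPot σ α V) :=
  (isPotential_repulsive hσ hα₀).add (isPotential_of_bdd hα₀ hV hB)

theorem schr_totalPot (hσ : 0 ≤ σ) (hα₀ : 0 ≤ α) (hα : α ≤ 2) (hV : Continuous V)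
    (hB : ∀ x, |V x| ≤ B) (f : 𝓢(Rn n, ℂ)) :
    schr (totalPot σ α V) f = schr (repulsive σ α) f + rmul V (emb n f) := by
  have hw := isPotential_repulsive (n := n) hσ hα₀
  have : pot (totalPot σ α V) f = pot (repulsive σ α) f + rmul V (emb n f) := by
    refine Lp.ext ?_
    filter_upwards [pot_coe hα (isPotential_totalPot hσ hα₀ hV hB) f, pot_coe hα hw f, emb_coe f,
      bmul_coe (isBddMeas_ofReal hV hB) (emb n f),
      Lp.coeFn_add (pot (repulsive σ α) f) (rmul V (emb n f))] with x h1 h2 h3 h4 h5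
    rw [h1, h5, Pi.add_apply, h2, totalPot]
    refine Eq.trans ?_ (congrArg _ h4.symm)
    rw [h3]; push_cast; ring
  rw [schr_apply, schr_apply, this]
  abel

theorem mem_mulOp_graph (hV : Continuous V) (hB : ∀ x, |V x| ≤ B) (u v : L2 n) :
    (u, v) ∈ (mulOp V).graph ↔ v = rmul V u := by
  rw [mulOp_graph]
  constructor
  · intro h
    exact Lp.ext (Filter.EventuallyEq.trans h (bmul_coe (isBddMeas_ofReal hV hB) u).symm)
  · rintro rfl
    exact bmul_coe (isBddMeas_ofReal hV hB) u

/-- As `V` is bounded, `(u, v) ↦ (u, v + V u)` and its inverse are continuous. They exchange the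
graphs of `H₀` and `H` on Schwartz functions, hence also the closures. -/
theorem hamiltonian_graph (hσ : 0 ≤ σ) (hα₀ : 0 ≤ α) (hα : α ≤ 2) (hV : Continuous V)
    (hB : ∀ x, |V x| ≤ B) : (hamiltonian σ α V).graph =
      (LinearMap.range ((emb n).prod (schr (totalPot σ α V)))).topologicalClosure := by
  have hs := schr_totalPot (n := n) hσ hα₀ hα hV hB
  have h1 : ∀ u v : L2 n, (u, v) ∈ (hamiltonian σ α V).graph ↔
      (u, v - rmul V u) ∈ (freeHamiltonian n σ α).graph := by
    intro u v
    rw [hamiltonian, LinearPMap.mem_graph_iff]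
    constructor
    · rintro ⟨y, rfl, rfl⟩
      have h2 := (mem_mulOp_graph hV hB _ _).1 ((mulOp V).mem_graph ⟨y, y.2.2⟩)
      rw [LinearPMap.add_apply, ← h2, add_sub_cancel_right]
      exact (freeHamiltonian n σ α).mem_graph ⟨y, y.2.1⟩
    · intro h
      have hu : u ∈ (mulOp V).domain :=
        LinearPMap.mem_domain_of_mem_graph ((mem_mulOp_graph hV hB u _).2 rfl)
      have hu' := LinearPMap.mem_domain_of_mem_graph h
      refine ⟨⟨u, hu', hu⟩, rfl, ?_⟩
      rw [LinearPMap.add_apply]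
      have e1 := (mem_mulOp_graph hV hB _ _).1 ((mulOp V).mem_graph ⟨u, hu⟩)
      have e2 := (freeHamiltonian n σ α).mem_graph_snd_inj h
        ((freeHamiltonian n σ α).mem_graph ⟨u, hu'⟩) rfl
      rw [e1, ← e2]
      simp
  ext ⟨u, v⟩
  rw [h1, freeHamiltonian_graph hσ hα₀ hα]
  constructor
  · intro h
    have h2 := map_mem_closure (f := fun q : L2 n × L2 n => (q.1, q.2 + rmul V q.1))
      (t := (LinearMap.range ((emb n).prod (schr (totalPot σ α V))) : Submodule ℂ _))
      (by fun_prop) h (by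
        rintro _ ⟨f, rfl⟩
        exact ⟨f, Prod.ext rfl (hs f)⟩)
    rw [sub_add_cancel] at h2
    exact h2
  · intro h
    exact map_mem_closure (f := fun q : L2 n × L2 n => (q.1, q.2 - rmul V q.1))
      (t := (LinearMap.range ((emb n).prod (schr (repulsive σ α))) : Submodule ℂ _))
      (by fun_prop) h (by
        rintro _ ⟨f, rfl⟩
        refine ⟨f, Prod.ext rfl ?_⟩
        change schr (repulsive σ α) f = schr (totalPot σ α V) f - rmul V (emb n f)
        rw [hs f, add_sub_cancel_right])

/-! #### The conjugate operator -/

/-- The vector field `⟨x⟩ ^ (-α) x`. -/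
def field (α : ℝ) (j : Fin n) (x : Rn n) : ℝ := japPow (-α) x * x j

theorem temperate_field (α : ℝ) (j : Fin n) : (field α j : Rn n → ℝ).HasTemperateGrowth :=
  (temperate_japPow _).mul (temperate_coord j)

/-- The conjugate operator on the Schwartz functions. -/
def conjS (n : ℕ) (α : ℝ) : 𝓢(Rn n, ℂ) →ₗ[ℂ] 𝓢(Rn n, ℂ) :=
  ∑ j, (((sm (field α j)).comp (momentum j) + (momentum j).comp (sm (field α j)) :
    𝓢(Rn n, ℂ) →L[ℂ] 𝓢(Rn n, ℂ)) : 𝓢(Rn n, ℂ) →ₗ[ℂ] 𝓢(Rn n, ℂ))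

theorem conjS_apply (f : 𝓢(Rn n, ℂ)) :
    conjS n α f = ∑ j, (sm (field α j) (momentum j f) + momentum j (sm (field α j) f)) := by
  simp [conjS, LinearMap.sum_apply]

theorem symmetric_conjS : SymmetricOn (emb n) (emb n ∘ₗ conjS n α) := by
  intro f g
  simp only [LinearMap.comp_apply, conjS_apply, map_sum, sum_inner, inner_sum]
  refine Finset.sum_congr rfl fun j _ => ?_
  rw [map_add, map_add, inner_add_left, inner_add_right, inner_sm (temperate_field α j),
    inner_momentum, inner_momentum, inner_sm (temperate_field α j), add_comm]

theorem conjugateOp_graph : (conjugateOp n α).graph =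
    (LinearMap.range ((emb n).prod (emb n ∘ₗ conjS n α))).topologicalClosure := by
  refine closure_schwartzOp_graph _ (fun f => (emb_coe _).trans ?_) symmetric_conjS
  refine Filter.Eventually.of_forall fun x => ?_
  rw [conjS_apply, sum_apply]
  rfl

/-! #### Bounds for the perturbation -/

/-- The decay is assumed only at large `|x|`; on the remaining ball continuity and compactness
supply the constant. -/
theorem exists_abs_le_of_decay {θ : ℝ} {V : Rn n → ℝ} (hV : Continuous V)
    (h : ∃ C R : ℝ, ∀ x : Rn n, R ≤ ‖x‖ → |V x| ≤ C * japPow (-θ) x) :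
    ∃ C : ℝ, ∀ x, |V x| ≤ C * japPow (-θ) x := by
  obtain ⟨C, R, hC⟩ := h
  have hcont : Continuous fun x => |V x| * japPow θ x := hV.abs.mul (continuous_japPow θ)
  obtain ⟨M, hM⟩ := (isCompact_closedBall (0 : Rn n) R).bddAbove_image hcont.continuousOn
  refine ⟨max C M, fun x => ?_⟩
  have hJ : japPow θ x * japPow (-θ) x = 1 := by rw [japPow_mul]; simp [japPow_zero]
  rcases le_total R ‖x‖ with hx | hx
  · exact (hC x hx).trans (mul_le_mul_of_nonneg_right (le_max_left _ _) (japPow_pos _ x).le)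
  · have h1 : |V x| * japPow θ x ≤ M :=
      hM ⟨x, by simpa using hx, rfl⟩
    calc |V x| = |V x| * japPow θ x * japPow (-θ) x := by rw [mul_assoc, hJ, mul_one]
      _ ≤ max C M * japPow (-θ) x :=
          mul_le_mul_of_nonneg_right (h1.trans (le_max_right _ _)) (japPow_pos _ x).le

end Graphs

end

end MourreRepulsive


namespace MourreRepulsive

noncomputable section

/-! ### Operators bounded relative to the Hamiltonian -/

section RelativeBounds

variable {n : ℕ}

/-- `A` is bounded relative to `p² + w`. -/
def RelBdd (w : Rn n → ℝ) (A : 𝓢(Rn n, ℂ) →ₗ[ℂ] L2 n) : Prop :=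
  ∃ C : ℝ, ∀ f, ‖A f‖ ≤ C * ‖shift (emb n) (schr w) Complex.I f‖

/-- The operator `A (p² + w + i)⁻¹`. -/
def relOp (w : Rn n → ℝ) (A : 𝓢(Rn n, ℂ) →ₗ[ℂ] L2 n) : L2 n →L[ℂ] L2 n :=
  A.extendOfNorm (shift (emb n) (schr w) Complex.I)

/-- The resolvent of `p² + w` at `-i`. -/
def res (w : Rn n → ℝ) : L2 n →L[ℂ] L2 n := coreResolvent (emb n) (schr w) Complex.I

variable {α c : ℝ} {w : Rn n → ℝ}

theorem RelBdd.add {A B : 𝓢(Rn n, ℂ) →ₗ[ℂ] L2 n} (hA : RelBdd w A) (hB : RelBdd w B) :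
    RelBdd w (A + B) := by
  obtain ⟨C, hC⟩ := hA
  obtain ⟨C', hC'⟩ := hB
  refine ⟨C + C', fun f => ?_⟩
  rw [add_mul]
  exact (norm_add_le _ _).trans (add_le_add (hC f) (hC' f))

theorem RelBdd.smul {A : 𝓢(Rn n, ℂ) →ₗ[ℂ] L2 n} (hA : RelBdd w A) (z : ℂ) :
    RelBdd w (z • A) := by
  obtain ⟨C, hC⟩ := hA
  refine ⟨‖z‖ * C, fun f => ?_⟩
  rw [LinearMap.smul_apply, norm_smul, mul_assoc]
  exact mul_le_mul_of_nonneg_left (hC f) (norm_nonneg z)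

theorem RelBdd.zero : RelBdd w 0 := ⟨0, fun f => by simp⟩

theorem RelBdd.sum {ι : Type*} {s : Finset ι} {A : ι → 𝓢(Rn n, ℂ) →ₗ[ℂ] L2 n}
    (hA : ∀ j ∈ s, RelBdd w (A j)) : RelBdd w (∑ j ∈ s, A j) := by
  classical
  induction s using Finset.induction_on with
  | empty => exact RelBdd.zero
  | insert j s hj ih =>
    rw [Finset.sum_insert hj]
    exact (hA j (Finset.mem_insert_self _ _)).add
      (ih fun i hi => hA i (Finset.mem_insert_of_mem hi))

variable (h : EssSelfAdjoint (emb n) (schr w))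
include h

theorem relOp_apply {A : 𝓢(Rn n, ℂ) →ₗ[ℂ] L2 n} (hA : RelBdd w A) (f : 𝓢(Rn n, ℂ)) :
    relOp w A (shift (emb n) (schr w) Complex.I f) = A f :=
  LinearMap.extendOfNorm_eq h.plus hA f

theorem norm_relOp_le {A : 𝓢(Rn n, ℂ) →ₗ[ℂ] L2 n} {C : ℝ}
    (hC : ∀ f, ‖A f‖ ≤ C * ‖shift (emb n) (schr w) Complex.I f‖) (hC0 : 0 ≤ C) :
    ‖relOp w A‖ ≤ C :=
  LinearMap.opNorm_extendOfNorm_le h.plus hC0 hC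

theorem res_apply (f : 𝓢(Rn n, ℂ)) :
    res w (shift (emb n) (schr w) Complex.I f) = emb n f := h.resolvent_plus f

theorem ext_of_core {A B : L2 n →L[ℂ] L2 n}
    (hAB : ∀ f, A (shift (emb n) (schr w) Complex.I f) = B (shift (emb n) (schr w) Complex.I f)) :
    A = B := by
  ext1 k
  refine DenseRange.induction_on (p := fun k => A k = B k) h.plus k
    (isClosed_eq A.continuous B.continuous) hAB

theorem relBdd_sm {b : Rn n → ℝ} (hb : b.HasTemperateGrowth) {C : ℝ} (hC : ∀ x, |b x| ≤ C) :
    RelBdd w (emb n ∘ₗ (sm b).toLinearMap) :=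
  ⟨C, fun f => (norm_emb_sm_le_of_bdd hb hC f).trans (mul_le_mul_of_nonneg_left
    (by simpa using h.norm_le_plus f) ((abs_nonneg _).trans (hC 0)))⟩

theorem norm_weighted_momentum_le_shift (hα₀ : 0 ≤ α) (hα : α ≤ 2) (hw : IsPotential α c w)
    (j : Fin n) (f : 𝓢(Rn n, ℂ)) : ‖emb n (sm (japPow (-α / 2)) (momentum j f))‖ ≤
      (c + n + 2) * ‖shift (emb n) (schr w) Complex.I f‖ :=
  norm_weighted_momentum_le hα₀ hα hw f (by simpa using h.norm_apply_le_plus f)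
    (by simpa using h.norm_le_plus f) j

theorem relBdd_sm_momentum (hα₀ : 0 ≤ α) (hα : α ≤ 2) (hw : IsPotential α c w) {a : Rn n → ℝ}
    (ha : a.HasTemperateGrowth) {C : ℝ} (hC : ∀ x, |a x| ≤ C * japPow (-α / 2) x) (j : Fin n) :
    RelBdd w (emb n ∘ₗ (sm a).toLinearMap ∘ₗ (momentum j).toLinearMap) := by
  refine ⟨C * (c + n + 2), fun f => ?_⟩
  have hC0 : 0 ≤ C := nonneg_of_mul_nonneg_left ((abs_nonneg _).trans (hC 0)) (japPow_pos _ 0)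
  have := norm_emb_sm_le ha (temperate_japPow (-α / 2)) (C := C) (fun x => by
    rw [abs_of_pos (japPow_pos (-α / 2) x)]; exact hC x) (momentum j f)
  rw [mul_assoc]
  exact this.trans (mul_le_mul_of_nonneg_left
    (norm_weighted_momentum_le_shift h hα₀ hα hw j f) hC0)

/-! #### Commutators of multipliers with the resolvent -/

variable {g : Rn n → ℝ} {g₁ g₂ : Fin n → Rn n → ℝ}

theorem norm_kinComm_le_shift (hα₀ : 0 ≤ α) (hα : α ≤ 2) (hw : IsPotential α c w)
    (hg : IsMultiplier g g₁ g₂) {κ₁ κ₂ : ℝ} (h₁ : ∀ j x, |g₁ j x| ≤ κ₁ * japPow (-α / 2) x)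
    (h₂ : ∀ j x, |g₂ j x| ≤ κ₂) (f : 𝓢(Rn n, ℂ)) :
    ‖(emb n ∘ₗ kinComm g₁ g₂) f‖ ≤ n * (2 * κ₁ * (c + n + 2) + κ₂) *
      ‖shift (emb n) (schr w) Complex.I f‖ :=
  hg.norm_kinComm_le hα₀ hα hw h₁ h₂ f (by simpa using h.norm_apply_le_plus f)
    (by simpa using h.norm_le_plus f)

/-- On the core this is `g(H + i)f + [p², g]f = (H + i)(g f)`: the multiplier preserves the Schwartz
space, and the relative bound extends the commutator term to all of `L²`. -/
theorem rmul_mul_res (hα : α ≤ 2) (hw : IsPotential α c w) (hg : IsMultiplier g g₁ g₂)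
    (hb : IsBddMeas fun x => ((g x : ℝ) : ℂ)) (hk : RelBdd w (emb n ∘ₗ kinComm g₁ g₂)) :
    rmul g * res w = res w * (rmul g + relOp w (emb n ∘ₗ kinComm g₁ g₂)) := by
  refine ext_of_core h fun f => ?_
  have e1 : rmul g (shift (emb n) (schr w) Complex.I f) +
      relOp w (emb n ∘ₗ kinComm g₁ g₂) (shift (emb n) (schr w) Complex.I f) =
      shift (emb n) (schr w) Complex.I (sm g f) := by
    rw [relOp_apply h hk, shift_apply, shift_apply, hg.schr_sm hα hw hb, map_add, map_smul,
      rmul_emb hb hg.temperate]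
    simp only [LinearMap.comp_apply]
    abel
  change rmul g (res w _) = res w (rmul g _ + relOp w _ _)
  rw [e1, res_apply h, res_apply h, rmul_emb hb hg.temperate]

theorem norm_commutator_res_le (hα₀ : 0 ≤ α) (hα : α ≤ 2) (hw : IsPotential α c w)
    (hg : IsMultiplier g g₁ g₂) (hb : IsBddMeas fun x => ((g x : ℝ) : ℂ)) {κ₁ κ₂ : ℝ}
    (h₁ : ∀ j x, |g₁ j x| ≤ κ₁ * japPow (-α / 2) x) (h₂ : ∀ j x, |g₂ j x| ≤ κ₂)
    (hκ₁ : 0 ≤ κ₁) (hκ₂ : 0 ≤ κ₂) :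
    ‖rmul g * res w - res w * rmul g‖ ≤ n * (2 * κ₁ * (c + n + 2) + κ₂) := by
  have hc := hw.nonneg
  have hk := norm_kinComm_le_shift h hα₀ hα hw hg h₁ h₂
  rw [rmul_mul_res h hα hw hg hb ⟨_, hk⟩, mul_add, add_sub_cancel_left]
  refine (norm_mul_le _ _).trans ?_
  have h1 : ‖res w‖ ≤ 1 := h.norm_resolvent_le
  have h2 := norm_relOp_le h hk (by positivity)
  nlinarith [norm_nonneg (res w), norm_nonneg (relOp w (emb n ∘ₗ kinComm g₁ g₂))]

theorem inner_kinComm_res (hg : IsMultiplier g g₁ g₂) (hk : RelBdd w (emb n ∘ₗ kinComm g₁ g₂))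
    (f : 𝓢(Rn n, ℂ)) (k : L2 n) : inner ℂ (emb n (kinComm g₁ g₂ f)) (res w k) =
      -inner ℂ (emb n f) (relOp w (emb n ∘ₗ kinComm g₁ g₂) k) := by
  refine DenseRange.induction_on (p := fun k => inner ℂ (emb n (kinComm g₁ g₂ f)) (res w k) =
      -inner ℂ (emb n f) (relOp w (emb n ∘ₗ kinComm g₁ g₂) k)) h.plus k
    (isClosed_eq (by fun_prop) (by fun_prop)) fun a => ?_
  rw [res_apply h, relOp_apply h hk, hg.inner_kinComm]
  rfl

omit h in
/-- Multiplication by an unbounded weight commutes with the resolvent up to a bounded term. -/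
theorem weighted_resolvent (h : EssSelfAdjoint (emb n) (schr w)) (hα : α ≤ 2)
    (hw : IsPotential α c w) (hg : IsMultiplier g g₁ g₂)
    (hk : RelBdd w (emb n ∘ₗ kinComm g₁ g₂)) {k gu gk : L2 n}
    (hu : gu =ᵐ[volume] fun x => (g x : ℂ) * res w k x)
    (hgk : gk =ᵐ[volume] fun x => (g x : ℂ) * k x) :
    gu = res w (gk + relOp w (emb n ∘ₗ kinComm g₁ g₂) k) := by
  -- Testing against `(H - i)f` turns `R` into its adjoint and removes it. The possibly unbounded
  -- weight can then be moved onto Schwartz functions, where it acts without domain questions.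
  refine eq_of_denseRange_inner h.minus fun f => ?_
  have hadj : ∀ a v, inner ℂ (shift (emb n) (schr w) (-Complex.I) a) (res w v) =
      inner ℂ (emb n a) v := fun a v => by
    rw [res, ← ContinuousLinearMap.adjoint_inner_left, h.adjoint_resolvent, h.resolvent_minus]
  rw [hadj, inner_add_right]
  have e1 : inner ℂ (shift (emb n) (schr w) (-Complex.I) f) gu =
      inner ℂ (shift (emb n) (schr w) (-Complex.I) (sm g f) - emb n (kinComm g₁ g₂ f))
        (res w k) := by
    have e0 : shift (emb n) (schr w) (-Complex.I) (sm g f) - emb n (kinComm g₁ g₂ f) =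
        emb n (sm g (momentumSq n f)) + pot w (sm g f) + (-Complex.I) • emb n (sm g f) := by
      rw [shift_apply, schr_apply, hg.momentumSq_sm, map_add]; abel
    have e0' : shift (emb n) (schr w) (-Complex.I) f =
        emb n (momentumSq n f) + pot w f + (-Complex.I) • emb n f := rfl
    rw [e0, e0', L2.inner_def, L2.inner_def]
    refine integral_congr_ae ?_
    filter_upwards [hu, Lp.coeFn_add (emb n (sm g (momentumSq n f)) + pot w (sm g f))
      ((-Complex.I) • emb n (sm g f)), Lp.coeFn_add (emb n (sm g (momentumSq n f)))
      (pot w (sm g f)), Lp.coeFn_smul (-Complex.I) (emb n (sm g f)),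
      Lp.coeFn_add (emb n (momentumSq n f) + pot w f) ((-Complex.I) • emb n f),
      Lp.coeFn_add (emb n (momentumSq n f)) (pot w f), Lp.coeFn_smul (-Complex.I) (emb n f),
      emb_coe (sm g (momentumSq n f)), emb_coe (sm g f), emb_coe (momentumSq n f), emb_coe f,
      pot_coe hα hw f, pot_coe hα hw (sm g f)] with x h1 h2 h3 h4 h5 h6 h7 h8 h9 h10 h11 h12 h13
    rw [h1, h2, h5, Pi.add_apply, Pi.add_apply, h3, h4, h6, h7, Pi.add_apply, Pi.add_apply,
      Pi.smul_apply, Pi.smul_apply, h8, h9, h10, h11, h12, h13, sm_apply hg.temperate,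
      sm_apply hg.temperate]
    simp only [RCLike.inner_apply, map_mul, map_add, Complex.conj_ofReal, smul_eq_mul]
    ring
  have e2 : inner ℂ (emb n (sm g f)) k = inner ℂ (emb n f) gk := by
    rw [L2.inner_def, L2.inner_def]
    refine integral_congr_ae ?_
    filter_upwards [hgk, emb_coe f, emb_coe (sm g f)] with x h1 h2 h3
    rw [h1, h2, h3, sm_apply hg.temperate]
    simp only [RCLike.inner_apply, map_mul, Complex.conj_ofReal]
    ring
  rw [e1, inner_sub_left, hadj, inner_kinComm_res h hg hk, e2]
  ring

omit h in
theorem isBddMeas_regWeight {s : ℝ} (hs : s ≤ 2) {ε : ℝ} (hε : 0 < ε) (hε1 : ε ≤ 1) :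
    IsBddMeas fun x : Rn n => ((regWeight s ε x : ℝ) : ℂ) := by
  refine isBddMeas_temperate (temperate_regWeight hε.le s) (C := ε⁻¹) fun x => ?_
  have h1 := eps_japPow_two_mul_eta_le hε.le hε1 x
  have h2 := japPow_le_japPow hs x
  have h3 := eta_pos hε.le x
  have h4 := japPow_pos s x
  rw [regWeight, abs_of_pos (mul_pos h4 h3), ← one_div, le_div_iff₀ hε]
  calc _ ≤ japPow 2 x * eta ε x * ε := by gcongr
    _ ≤ 1 := by linarith

-- Fatou's lemma as the regularization parameter `1/(k+1)` tends to zero.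
omit h in
theorem memLp_of_norm_rmul_regWeight_le (s : ℝ) (hs : s ≤ 2) (u : L2 n) {M : ℝ}
    (hM : ∀ k : ℕ, ‖rmul (regWeight s (1 / ((k : ℝ) + 1))) u‖ ≤ M) :
    MemLp (fun x => ((japPow s x : ℝ) : ℂ) * u x) 2 volume := by
  have hpos : ∀ k : ℕ, 0 ≤ 1 / ((k : ℝ) + 1) := fun k => by positivity
  have hmeas : AEStronglyMeasurable (fun x => ((japPow s x : ℝ) : ℂ) * u x) volume :=
    ((Complex.continuous_ofReal.comp (continuous_japPow s)).aestronglyMeasurable).mul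
      (Lp.aestronglyMeasurable u)
  have hb : ∀ k : ℕ, IsBddMeas fun x : Rn n => ((regWeight s (1 / ((k : ℝ) + 1)) x : ℝ) : ℂ) := by
    intro k
    have he1 : 1 / ((k : ℝ) + 1) ≤ 1 := by
      rw [div_le_one (by positivity)]
      have : (0 : ℝ) ≤ k := Nat.cast_nonneg k
      linarith
    exact isBddMeas_regWeight hs (by positivity) he1
  refine ⟨hmeas, ?_⟩
  have h1 := Lp.eLpNorm_lim_le_liminf_eLpNorm (p := 2) (μ := (volume : Measure (Rn n)))
    (f := fun (k : ℕ) => (rmul (regWeight s (1 / ((k : ℝ) + 1))) u : Rn n → ℂ))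
    (fun k => Lp.aestronglyMeasurable _) (fun x => ((japPow s x : ℝ) : ℂ) * u x) (by
      have : ∀ᵐ x, ∀ k : ℕ, (rmul (regWeight s (1 / ((k : ℝ) + 1))) u : Rn n → ℂ) x =
          ((regWeight s (1 / ((k : ℝ) + 1)) x : ℝ) : ℂ) * u x :=
        ae_all_iff.2 fun k => bmul_coe (hb k) u
      filter_upwards [this] with x hx
      simp only [hx]
      refine Filter.Tendsto.mul_const _ ((Complex.continuous_ofReal.tendsto _).comp ?_)
      have h3 := ((tendsto_one_div_add_atTop_nhds_zero_nat (𝕜 := ℝ)).mul_const (‖x‖ ^ 2)).const_add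
        1
      rw [zero_mul, add_zero] at h3
      have h4 := (h3.inv₀ one_ne_zero).const_mul (japPow s x)
      rwa [inv_one, mul_one] at h4)
  refine h1.trans_lt ?_
  have h2 : ∀ k : ℕ, eLpNorm (rmul (regWeight s (1 / ((k : ℝ) + 1))) u : Rn n → ℂ) 2 volume ≤
      ENNReal.ofReal M := fun k => by
    rw [← Lp.enorm_def, ← ofReal_norm]
    exact ENNReal.ofReal_le_ofReal (hM k)
  refine (Filter.liminf_le_of_le (a := ENNReal.ofReal M) ?_ ?_).trans_lt ENNReal.ofReal_lt_top
  · isBoundedDefault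
  · intro b hb
    obtain ⟨k, hk⟩ := hb.exists
    exact hk.trans (h2 k)

end RelativeBounds

end

end MourreRepulsive


namespace MourreRepulsive

noncomputable section

/-! ### The functional calculus preserves weights -/

section Weights

variable {n : ℕ} {α c : ℝ} {w : Rn n → ℝ}

/-- `φ` of the closure of `p² + w`. -/
def fcalc (w : Rn n → ℝ) (φ : ℝ → ℝ) : L2 n →L[ℂ] L2 n := cfc (resolventSymbol φ) (res w)

/-- `(T + i) φ(T)`. -/
def fcalcShift (w : Rn n → ℝ) (φ : ℝ → ℝ) : L2 n →L[ℂ] L2 n :=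
  fcalc w (fun s => s * φ s) + Complex.I • fcalc w φ

theorem fcalc_eq (h : EssSelfAdjoint (emb n) (schr w)) {φ : ℝ → ℝ} (hφ : ContDiff ℝ ∞ φ)
    (hc : HasCompactSupport φ) : fcalc w φ = res w * fcalcShift w φ :=
  h.cfc_eq_resolvent_mul hφ hc

theorem abs_regD_weight_le (hα₀ : 0 ≤ α) (hα : α ≤ 2) {ε : ℝ} (hε : 0 ≤ ε) (hε1 : ε ≤ 1)
    (j : Fin n) (x : Rn n) : |regD (1 - α / 2) ε j x| ≤ 3 * japPow (-α / 2) x := by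
  have := abs_regD_le hε hε1 (show 0 ≤ 1 - α / 2 by linarith) (by linarith) j x
  rwa [show 1 - α / 2 - 1 = -α / 2 by ring] at this

theorem abs_regDD_weight_le (hα₀ : 0 ≤ α) (hα : α ≤ 2) {ε : ℝ} (hε : 0 ≤ ε) (hε1 : ε ≤ 1)
    (j : Fin n) (x : Rn n) : |regDD (1 - α / 2) ε j x| ≤ 17 :=
  abs_regDD_le hε hε1 (show 0 ≤ 1 - α / 2 by linarith) (by linarith) j x

theorem norm_rmul_regWeight_le {s ε : ℝ} (hs : s ≤ 2) (hε : 0 < ε) (hε1 : ε ≤ 1) {ψ gψ : L2 n}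
    (hψ : gψ =ᵐ[volume] fun x => ((japPow s x : ℝ) : ℂ) * ψ x) :
    ‖rmul (regWeight s ε) ψ‖ ≤ ‖gψ‖ := by
  refine (norm_le_of_ae (C := 1) ?_).trans_eq (one_mul _)
  filter_upwards [bmul_coe (isBddMeas_regWeight hs hε hε1) ψ, hψ] with x h4 h5
  refine (congrArg norm h4).trans_le ?_
  rw [h5, one_mul, norm_mul, norm_mul, Complex.norm_real, Complex.norm_real, Real.norm_eq_abs,
    Real.norm_eq_abs, regWeight, abs_mul, abs_of_pos (eta_pos hε.le x)]
  gcongr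
  exact mul_le_of_le_one_right (abs_nonneg _) (eta_le_one hε.le x)

theorem norm_apply_apply_le_of_commutator {E : Type*} [NormedAddCommGroup E] [NormedSpace ℂ E]
    {M A : E →L[ℂ] E} {b m : ℝ} (hb : ‖M * A - A * M‖ ≤ b) {ψ : E} (hm : ‖M ψ‖ ≤ m) :
    ‖M (A ψ)‖ ≤ ‖A‖ * m + b * ‖ψ‖ := by
  have h2 : M (A ψ) = A (M ψ) + (M * A - A * M) ψ := by
    change _ = _ + (M (A ψ) - A (M ψ))
    abel
  rw [h2]
  exact (norm_add_le _ _).trans (add_le_add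
    ((ContinuousLinearMap.le_opNorm _ _).trans (mul_le_mul_of_nonneg_left hm (norm_nonneg _)))
    ((ContinuousLinearMap.le_opNorm _ _).trans (mul_le_mul_of_nonneg_right hb (norm_nonneg _))))

theorem norm_commutator_regWeight_res_le (h : EssSelfAdjoint (emb n) (schr w)) (hα₀ : 0 ≤ α)
    (hα : α ≤ 2) (hw : IsPotential α c w) {ε : ℝ} (hε : 0 < ε) (hε1 : ε ≤ 1) :
    ‖rmul (regWeight (1 - α / 2) ε) * res w - res w * rmul (regWeight (1 - α / 2) ε)‖ ≤
      n * (2 * 3 * (c + n + 2) + 17) :=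
  norm_commutator_res_le h hα₀ hα hw (isMultiplier_regWeight hε.le _)
    (isBddMeas_regWeight (by linarith) hε hε1)
    (abs_regD_weight_le hα₀ hα hε.le hε1) (abs_regDD_weight_le hα₀ hα hε.le hε1)
    (by norm_num) (by norm_num)

/-- For `ρ = 1 - α/2` the gradient of the regularized weight is `O(⟨x⟩^(-α/2))` uniformly in `ε`, so
its commutator with the resolvent, and hence with `φ(H)`, is uniformly bounded. The regularization
is then removed by Fatou. -/
theorem memLp_weight_fcalc (h : EssSelfAdjoint (emb n) (schr w)) (hα₀ : 0 ≤ α) (hα : α ≤ 2)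
    (hw : IsPotential α c w) {φ : ℝ → ℝ} (hφ : ContDiff ℝ ∞ φ) (hc : HasCompactSupport φ)
    {ψ gψ : L2 n} (hψ : gψ =ᵐ[volume] fun x => ((japPow (1 - α / 2) x : ℝ) : ℂ) * ψ x) :
    MemLp (fun x => ((japPow (1 - α / 2) x : ℝ) : ℂ) * fcalc w φ ψ x) 2 volume := by
  obtain ⟨C, hC0, hC⟩ :=
    EssSelfAdjoint.exists_norm_commutator_cfc_le (E := L2 n) (D := 𝓢(Rn n, ℂ)) hφ hc
  have hs : 1 - α / 2 ≤ 2 := by linarith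
  refine memLp_of_norm_rmul_regWeight_le (1 - α / 2) hs (fcalc w φ ψ)
    (M := ‖fcalc w φ‖ * ‖gψ‖ + C * (n * (2 * 3 * (c + n + 2) + 17)) * ‖ψ‖) fun k => ?_
  have he : 0 < 1 / ((k : ℝ) + 1) := by positivity
  have he1 : 1 / ((k : ℝ) + 1) ≤ 1 := by
    rw [div_le_one (by positivity)]
    have : (0 : ℝ) ≤ k := Nat.cast_nonneg k
    linarith
  exact norm_apply_apply_le_of_commutator (hC (emb n) (schr w) h _
    (isSelfAdjoint_rmul (isBddMeas_regWeight hs he he1)) _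
    (norm_commutator_regWeight_res_le h hα₀ hα hw he he1)) (norm_rmul_regWeight_le hs he he1 hψ)

theorem regWeight_eps_zero (s : ℝ) : (regWeight s 0 : Rn n → ℝ) = japPow s := by
  ext x; simp [regWeight, eta_zero]

/-- The preservation of the weight is applied to `φ` and to `s φ(s)`, so that `(H + i)φ(H)ψ` also
lies in the domain of the weight. The weight then passes through the resolvent at the cost of a
bounded term. -/
theorem exists_fcalc_eq_weight_mul_res (h : EssSelfAdjoint (emb n) (schr w)) (hα₀ : 0 ≤ α)
    (hα : α ≤ 2) (hw : IsPotential α c w) {φ : ℝ → ℝ} (hφ : ContDiff ℝ ∞ φ)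
    (hc : HasCompactSupport φ)
    {ψ gψ : L2 n} (hψ : gψ =ᵐ[volume] fun x => ((japPow (1 - α / 2) x : ℝ) : ℂ) * ψ x) :
    ∃ k : L2 n, fcalc w φ ψ = rmul (japPow (-(1 - α / 2))) (res w k) := by
  have hsφ : ContDiff ℝ ∞ fun s => s * φ s := contDiff_id.mul hφ
  have hsc : HasCompactSupport fun s => s * φ s := hc.mul_left
  have m1 := memLp_weight_fcalc h hα₀ hα hw hφ hc hψ
  have m2 := memLp_weight_fcalc h hα₀ hα hw hsφ hsc hψ
  set gk : L2 n := m2.toLp _ + Complex.I • m1.toLp _ with hgk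
  have e1 : gk =ᵐ[volume] fun x => ((japPow (1 - α / 2) x : ℝ) : ℂ) * fcalcShift w φ ψ x := by
    filter_upwards [Lp.coeFn_add (m2.toLp _) (Complex.I • m1.toLp _), m1.coeFn_toLp,
      Lp.coeFn_smul Complex.I (m1.toLp _), m2.coeFn_toLp,
      Lp.coeFn_add (fcalc w (fun s => s * φ s) ψ) (Complex.I • fcalc w φ ψ),
      Lp.coeFn_smul Complex.I (fcalc w φ ψ)] with x h1 h2 h3 h4 h5 h6
    rw [h1, Pi.add_apply, h3, Pi.smul_apply, h2, h4]
    change _ = _ * (fcalc w (fun s => s * φ s) ψ + Complex.I • fcalc w φ ψ : L2 n) x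
    rw [h5, Pi.add_apply, h6, Pi.smul_apply, smul_eq_mul, smul_eq_mul]
    ring
  have e2 : m1.toLp _ =ᵐ[volume]
      fun x => ((japPow (1 - α / 2) x : ℝ) : ℂ) * res w (fcalcShift w φ ψ) x := by
    refine m1.coeFn_toLp.trans ?_
    rw [fcalc_eq h hφ hc]
    rfl
  have hm := isMultiplier_regWeight (n := n) le_rfl (1 - α / 2)
  have hk : RelBdd w (emb n ∘ₗ kinComm (regD (1 - α / 2) 0) (regDD (1 - α / 2) 0)) :=
    ⟨_, norm_kinComm_le_shift h hα₀ hα hw hm (abs_regD_weight_le hα₀ hα le_rfl zero_le_one)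
      (abs_regDD_weight_le hα₀ hα le_rfl zero_le_one)⟩
  rw [regWeight_eps_zero] at hm
  have := weighted_resolvent h hα hw hm hk e2 e1
  refine ⟨_, Eq.trans ?_ (congrArg (rmul (japPow (-(1 - α / 2)))) this)⟩
  refine Lp.ext ?_
  filter_upwards [m1.coeFn_toLp, bmul_coe (isBddMeas_japPow (n := n)
    (show -(1 - α / 2) ≤ 0 by linarith)) (m1.toLp _)] with x h1 h2
  refine Eq.trans ?_ h2.symm
  rw [h1, ← mul_assoc, ← Complex.ofReal_mul, japPow_mul]
  simp [japPow_zero]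

end Weights

/-! ### The conjugate operator with cutoffs -/

section ConjugateOperator

variable {n : ℕ} {α : ℝ}

/-- `∂_i` of the field `⟨x⟩ ^ (-α) x_j`. -/
def fieldGrad (α : ℝ) (i j : Fin n) (x : Rn n) : ℝ :=
  (if j = i then japPow (-α) x else 0) + (-α) * (x i * (x j * japPow (-α - 2) x))

/-- The divergence of `⟨x⟩ ^ (-α) x`. -/
def fieldDiv (α : ℝ) (x : Rn n) : ℝ := (n - α) * japPow (-α) x + α * japPow (-α - 2) x

theorem temperate_fieldGrad (α : ℝ) (i j : Fin n) :
    (fieldGrad α i j : Rn n → ℝ).HasTemperateGrowth := by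
  have h1 := temperate_const_mul (-α) ((temperate_coord (n := n) i).mul
    ((temperate_coord j).mul (temperate_japPow (-α - 2))))
  by_cases hij : j = i
  · have : (fieldGrad α i j : Rn n → ℝ) =
        japPow (-α) + fun x => (-α) * (x i * (x j * japPow (-α - 2) x)) := by
      ext x; simp [fieldGrad, hij]
    rw [this]
    exact (temperate_japPow _).add h1
  · have : (fieldGrad α i j : Rn n → ℝ) = fun x => (-α) * (x i * (x j * japPow (-α - 2) x)) := by
      ext x; simp [fieldGrad, hij]
    rw [this]
    exact h1

theorem hasLineDerivAt_field (α : ℝ) (i j : Fin n) (x : Rn n) :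
    HasLineDerivAt ℝ (field α j) (fieldGrad α i j x) x (ej i) := by
  refine HasDerivAt.congr_deriv
    (HasLineDerivAt.real_mul (hasLineDerivAt_japPow (-α) x i) (hasLineDerivAt_coord x j i)) ?_
  rw [fieldGrad]
  split_ifs <;> ring

theorem sum_coord_sq (x : Rn n) : ∑ j, x j * x j = ‖x‖ ^ 2 := by
  rw [EuclideanSpace.norm_sq_eq]
  exact Finset.sum_congr rfl fun j _ => by rw [Real.norm_eq_abs, sq_abs, sq]

theorem sum_fieldGrad (α : ℝ) (x : Rn n) : ∑ j, fieldGrad α j j x = fieldDiv α x := by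
  simp only [fieldGrad, if_true, Finset.sum_add_distrib, ← Finset.mul_sum, Finset.sum_const,
    Finset.card_univ, Fintype.card_fin, nsmul_eq_mul]
  have h1 : ∑ j, x j * (x j * japPow (-α - 2) x) = ‖x‖ ^ 2 * japPow (-α - 2) x := by
    rw [← sum_coord_sq, Finset.sum_mul]
    exact Finset.sum_congr rfl fun j _ => by ring
  have h2 : (1 + ‖x‖ ^ 2) * japPow (-α - 2) x = japPow (-α) x := by
    rw [← japPow_two, japPow_mul]; congr 1; ring
  rw [h1, fieldDiv]
  linear_combination (-α) * h2

theorem temperate_fieldDiv (α : ℝ) : (fieldDiv α : Rn n → ℝ).HasTemperateGrowth :=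
  (temperate_const_mul _ (temperate_japPow _)).add (temperate_const_mul _ (temperate_japPow _))

theorem conjS_eq (f : 𝓢(Rn n, ℂ)) : conjS n α f =
    ∑ j, (2 : ℂ) • sm (field α j) (momentum j f) - Complex.I • sm (fieldDiv α) f := by
  have h1 : sm (fieldDiv α) f = ∑ j, sm (fieldGrad α j j) f := by
    ext x
    rw [sum_apply, sm_apply (temperate_fieldDiv α), ← sum_fieldGrad]
    push_cast
    rw [Finset.sum_mul]
    exact Finset.sum_congr rfl fun j _ => (sm_apply (temperate_fieldGrad α j j) f x).symm
  rw [conjS_apply, h1, Finset.smul_sum, ← Finset.sum_sub_distrib]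
  refine Finset.sum_congr rfl fun j _ => ?_
  rw [momentum_sm (temperate_field α j) (temperate_fieldGrad α j j)
    (hasLineDerivAt_field α j j)]
  module

theorem abs_field_le (α : ℝ) (j : Fin n) (x : Rn n) : |field α j x| ≤ japPow (1 - α) x := by
  rw [field, abs_mul, abs_of_pos (japPow_pos _ x), mul_comm]
  have := abs_coord_mul_japPow_le (-α) x j
  rwa [show -α + 1 = 1 - α by ring] at this

theorem abs_fieldDiv_le (hα₀ : 0 ≤ α) (hα : α ≤ 2) (x : Rn n) :
    |fieldDiv α x| ≤ (n + 4) * japPow (-α) x := by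
  have h1 := japPow_le_japPow (show -α - 2 ≤ -α by linarith) x
  have h2 := japPow_pos (-α) x
  have h3 := japPow_pos (-α - 2) x
  have hn : (0 : ℝ) ≤ n := Nat.cast_nonneg n
  rw [fieldDiv, abs_le]
  constructor <;> nlinarith

variable {c : ℝ} {w : Rn n → ℝ}

/-- The conjugate operator applied after a decaying multiplier is bounded relative to `p² + w`. -/
theorem relBdd_conjS_sm (h : EssSelfAdjoint (emb n) (schr w)) (hα₀ : 0 ≤ α) (hα : α ≤ 2)
    (hw : IsPotential α c w) {q : Rn n → ℝ} {q' : Fin n → Rn n → ℝ} (hq : q.HasTemperateGrowth)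
    (hq' : ∀ j, (q' j).HasTemperateGrowth) (hd : ∀ j x, HasLineDerivAt ℝ q (q' j x) x (ej j))
    {C : ℝ} (h₀ : ∀ x, |q x| ≤ C * japPow (-(1 - α / 2)) x)
    (h₁ : ∀ j x, |q' j x| ≤ C * japPow (-(1 - α / 2)) x) :
    RelBdd w (emb n ∘ₗ conjS n α ∘ₗ (sm q).toLinearMap) := by
  have hC : 0 ≤ C := nonneg_of_mul_nonneg_left ((abs_nonneg _).trans (h₀ 0)) (japPow_pos _ 0)
  have e : emb n ∘ₗ conjS n α ∘ₗ (sm q).toLinearMap =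
      ∑ j, ((2 : ℂ) • (emb n ∘ₗ (sm fun x => field α j x * q x).toLinearMap ∘ₗ
        (momentum j).toLinearMap) +
        (-2 * Complex.I) • (emb n ∘ₗ (sm fun x => field α j x * q' j x).toLinearMap)) +
      (-Complex.I) • (emb n ∘ₗ (sm fun x => fieldDiv α x * q x).toLinearMap) := by
    ext1 f
    simp only [LinearMap.comp_apply, LinearMap.add_apply, LinearMap.smul_apply,
      LinearMap.sum_apply, ContinuousLinearMap.coe_coe]
    rw [conjS_eq, map_sub, map_sum, map_smul, sm_sm (temperate_fieldDiv α) hq, sub_eq_add_neg,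
      neg_smul]
    congr 1
    refine Finset.sum_congr rfl fun j _ => ?_
    rw [momentum_sm hq (hq' j) (hd j), map_sub (sm (field α j)), map_smul (sm (field α j)),
      sm_sm (temperate_field α j) hq, sm_sm (temperate_field α j) (hq' j), map_smul, map_sub,
      map_smul]
    module
  rw [e]
  -- The powers combine as `⟨x⟩^(1-α) ⟨x⟩^(-(1-α/2)) = ⟨x⟩^(-α/2)`, exactly the weight with which
  -- the momentum is controlled.
  have b1 : ∀ (j : Fin n) (x : Rn n) (a : ℝ), |a| ≤ C * japPow (-(1 - α / 2)) x →
      |field α j x * a| ≤ C * japPow (-α / 2) x := fun j x a ha => by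
    rw [abs_mul]
    calc _ ≤ japPow (1 - α) x * (C * japPow (-(1 - α / 2)) x) :=
          mul_le_mul (abs_field_le α j x) ha (abs_nonneg _) (japPow_pos _ x).le
      _ = C * (japPow (1 - α) x * japPow (-(1 - α / 2)) x) := by ring
      _ = _ := by rw [japPow_mul]; congr 2; ring
  have b2 : ∀ x : Rn n, |fieldDiv α x * q x| ≤ (n + 4) * C := fun x => by
    have h1 := (abs_fieldDiv_le hα₀ hα x).trans
      (mul_le_of_le_one_right (by positivity) (japPow_le_one (by linarith) x))
    have h2 := (h₀ x).trans (mul_le_of_le_one_right hC (japPow_le_one (by linarith) x))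
    rw [abs_mul]
    exact mul_le_mul h1 h2 (abs_nonneg _) (by positivity)
  refine RelBdd.add (RelBdd.sum fun j _ => RelBdd.add (RelBdd.smul ?_ _) (RelBdd.smul ?_ _))
    (RelBdd.smul ?_ _)
  · exact relBdd_sm_momentum h hα₀ hα hw ((temperate_field α j).mul hq)
      (fun x => b1 j x _ (h₀ x)) j
  · exact relBdd_sm h ((temperate_field α j).mul (hq' j)) (C := C)
      (fun x => (b1 j x _ (h₁ j x)).trans
        (mul_le_of_le_one_right hC (japPow_le_one (by linarith) x)))
  · exact relBdd_sm h ((temperate_fieldDiv α).mul hq) b2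

theorem relBdd_conjS_japPow (h : EssSelfAdjoint (emb n) (schr w)) (hα₀ : 0 ≤ α) (hα : α ≤ 2)
    (hw : IsPotential α c w) :
    RelBdd w (emb n ∘ₗ conjS n α ∘ₗ (sm (japPow (-(1 - α / 2)))).toLinearMap) := by
  refine relBdd_conjS_sm h hα₀ hα hw (temperate_japPow _)
    (q' := fun j x => -(1 - α / 2) * (x j * japPow (-(1 - α / 2) - 2) x))
    (fun j => temperate_const_mul _ ((temperate_coord j).mul (temperate_japPow _)))
    (fun j x => hasLineDerivAt_japPow _ x j) (C := 1) (fun x => ?_) (fun j x => ?_)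
  · rw [one_mul, abs_of_pos (japPow_pos _ x)]
  · rw [one_mul, abs_mul, abs_neg, abs_of_nonneg (show 0 ≤ 1 - α / 2 by linarith), abs_mul,
      abs_of_pos (japPow_pos _ x)]
    have h1 := abs_coord_mul_japPow_le (-(1 - α / 2) - 2) x j
    have h2 := japPow_le_japPow (show -(1 - α / 2) - 2 + 1 ≤ -(1 - α / 2) by linarith) x
    have h3 : 0 ≤ |x j| * japPow (-(1 - α / 2) - 2) x :=
      mul_nonneg (abs_nonneg _) (japPow_pos _ x).le
    nlinarith

/-- For fixed `ε` the cutoff is at most `ε⁻¹⟨x⟩^(-(1-α/2))`. The constant blows up as `ε` tends to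
zero, but only boundedness at each fixed `ε` is used. -/
theorem relBdd_conjS_eta (h : EssSelfAdjoint (emb n) (schr w)) (hα₀ : 0 ≤ α) (hα : α ≤ 2)
    (hw : IsPotential α c w) {ε : ℝ} (hε : 0 < ε) (hε1 : ε ≤ 1) :
    RelBdd w (emb n ∘ₗ conjS n α ∘ₗ (sm (eta ε)).toLinearMap) := by
  have hr : 0 ≤ 2 * ε ^ ((1 - (1 - α / 2)) / 2) :=
    mul_nonneg zero_le_two (Real.rpow_nonneg hε.le _)
  refine relBdd_conjS_sm h hα₀ hα hw (temperate_eta hε.le) (q' := regD 0 ε)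
    (isMultiplier_eta hε.le).temperate₁ (isMultiplier_eta hε.le).deriv
    (C := ε⁻¹ + 2 * ε ^ ((1 - (1 - α / 2)) / 2)) (fun x => ?_) (fun j x => ?_)
  · have h1 := eps_japPow_two_mul_eta_le hε.le hε1 x
    have h3 := eta_pos hε.le x
    have h4 := japPow_pos (-(1 - α / 2)) x
    rw [abs_of_pos h3, add_mul]
    have h5 : eta ε x * 1 = eta ε x * (japPow (1 - α / 2) x * japPow (-(1 - α / 2)) x) := by
      rw [japPow_mul]; simp [japPow_zero]
    have h6 : eta ε x * japPow (1 - α / 2) x ≤ ε⁻¹ := by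
      rw [← one_div, le_div_iff₀ hε]
      calc _ ≤ eta ε x * japPow 2 x * ε := by
            gcongr
            exact japPow_le_japPow (by linarith) x
        _ ≤ 1 := by linarith
    calc eta ε x = eta ε x * japPow (1 - α / 2) x * japPow (-(1 - α / 2)) x := by
          rw [mul_assoc, ← h5, mul_one]
      _ ≤ ε⁻¹ * japPow (-(1 - α / 2)) x := mul_le_mul_of_nonneg_right h6 h4.le
      _ ≤ _ := le_add_of_nonneg_right (mul_nonneg hr h4.le)
  · refine (abs_regD_zero_le hε hε1 (show 0 ≤ 1 - α / 2 by linarith) (by linarith) j x).trans ?_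
    rw [add_mul]
    exact le_add_of_nonneg_left (mul_nonneg (inv_nonneg.2 hε.le) (japPow_pos _ x).le)

/-- Both `⟨x⟩^(-ρ)R k` and `𝒜⟨x⟩^(-ρ)R k` are continuous in `k`, and the pair lies in the graph of
`𝒜` when `k = (H + i)f`; the graph is closed. -/
theorem weight_mul_res_mem_domain (h : EssSelfAdjoint (emb n) (schr w)) (hα₀ : 0 ≤ α) (hα : α ≤ 2)
    (hw : IsPotential α c w) (k : L2 n) :
    rmul (japPow (-(1 - α / 2))) (res w k) ∈ (conjugateOp n α).domain := by
  have hr := relBdd_conjS_japPow h hα₀ hα hw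
  refine LinearPMap.mem_domain_of_mem_graph
    (y := relOp w (emb n ∘ₗ conjS n α ∘ₗ (sm (japPow (-(1 - α / 2)))).toLinearMap) k) ?_
  rw [conjugateOp_graph]
  refine DenseRange.induction_on (p := fun k => (rmul (japPow (-(1 - α / 2))) (res w k),
    relOp w (emb n ∘ₗ conjS n α ∘ₗ (sm (japPow (-(1 - α / 2)))).toLinearMap) k) ∈
    (LinearMap.range ((emb n).prod (emb n ∘ₗ conjS n α))).topologicalClosure) h.plus k
    ((Submodule.isClosed_topologicalClosure _).preimage (by fun_prop)) fun f => ?_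
  refine Submodule.le_topologicalClosure _ ⟨sm (japPow (-(1 - α / 2))) f, ?_⟩
  rw [relOp_apply h hr, res_apply h, rmul_emb (isBddMeas_japPow (by linarith))
    (temperate_japPow _)]
  rfl

end ConjugateOperator

end

end MourreRepulsive


namespace MourreRepulsive

noncomputable section

/-! ### The commutator on Schwartz functions -/

section Commutator

variable {n : ℕ} {α c : ℝ} {w : Rn n → ℝ}

-- Both momenta are Fourier multipliers.
open LineDeriv in
theorem momentum_comm (i j : Fin n) (f : 𝓢(Rn n, ℂ)) :
    momentum i (momentum j f) = momentum j (momentum i f) := by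
  have h1 : ∀ i : Fin n, (fun x : Rn n => inner ℝ x (ej i)).HasTemperateGrowth := fun i => by
    fun_prop
  have h2 : ∀ (i : Fin n) (f : 𝓢(Rn n, ℂ)), momentum i f = (-Complex.I) •
      ((2 * Real.pi * Complex.I : ℂ) • SchwartzMap.fourierMultiplierCLM ℂ
        (fun x : Rn n => inner ℝ x (ej i)) f) := fun i f => by
    rw [← SchwartzMap.lineDeriv_eq_fourierMultiplierCLM]
    rfl
  have h3 : ∀ (i : Fin n) (z : ℂ) (f : 𝓢(Rn n, ℂ)), SchwartzMap.fourierMultiplierCLM ℂ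
      (fun x : Rn n => inner ℝ x (ej i)) (z • f) =
      z • SchwartzMap.fourierMultiplierCLM ℂ (fun x : Rn n => inner ℝ x (ej i)) f := by
    intro i z f
    have := (SchwartzMap.fourierMultiplierCLM_ofReal (F := ℂ) ℂ (h1 i) (z • f)).symm
    rw [this, map_smul, SchwartzMap.fourierMultiplierCLM_ofReal ℂ (h1 i)]
  simp only [h2, h3]
  rw [SchwartzMap.fourierMultiplierCLM_fourierMultiplierCLM_apply (h1 i) (h1 j),
    SchwartzMap.fourierMultiplierCLM_fourierMultiplierCLM_apply (h1 j) (h1 i),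
    mul_comm (fun x : Rn n => inner ℝ x (ej i))]

/-- `∂_i` of the divergence. -/
def fieldDivD (α : ℝ) (i : Fin n) (x : Rn n) : ℝ :=
  (n - α) * (-α * (x i * japPow (-α - 2) x)) +
    α * ((-α - 2) * (x i * japPow (-α - 2 - 2) x))

theorem temperate_fieldDivD (α : ℝ) (i : Fin n) :
    (fieldDivD α i : Rn n → ℝ).HasTemperateGrowth :=
  (temperate_const_mul _ (temperate_const_mul _ ((temperate_coord i).mul (temperate_japPow _)))).add
    (temperate_const_mul _ (temperate_const_mul _ ((temperate_coord i).mul (temperate_japPow _))))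

theorem hasLineDerivAt_fieldDiv (α : ℝ) (i : Fin n) (x : Rn n) :
    HasLineDerivAt ℝ (fieldDiv α) (fieldDivD α i x) x (ej i) :=
  HasLineDerivAt.real_add (HasLineDerivAt.real_const_mul _ (hasLineDerivAt_japPow _ x i))
    (HasLineDerivAt.real_const_mul _ (hasLineDerivAt_japPow _ x i))

theorem momentum_conjS (i : Fin n) (f : 𝓢(Rn n, ℂ)) : momentum i (conjS n α f) =
    conjS n α (momentum i f) - (2 * Complex.I) • ∑ j, sm (fieldGrad α i j) (momentum j f) -
      sm (fieldDivD α i) f := by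
  rw [conjS_eq, conjS_eq, map_sub, map_sum, map_smul,
    momentum_sm (temperate_fieldDiv α) (temperate_fieldDivD α i) (hasLineDerivAt_fieldDiv α i),
    smul_sub, smul_smul, Complex.I_mul_I, Finset.smul_sum]
  have : ∑ j, momentum i ((2 : ℂ) • sm (field α j) (momentum j f)) =
      ∑ j, (2 : ℂ) • sm (field α j) (momentum j (momentum i f)) -
        ∑ j, (2 * Complex.I) • sm (fieldGrad α i j) (momentum j f) := by
    rw [← Finset.sum_sub_distrib]
    refine Finset.sum_congr rfl fun j _ => ?_
    rw [map_smul, momentum_sm (temperate_field α j) (temperate_fieldGrad α i j)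
      (hasLineDerivAt_field α i j), momentum_comm i j]
    module
  rw [this]
  module

theorem inner_conjS (f g : 𝓢(Rn n, ℂ)) :
    inner ℂ (emb n (conjS n α f)) (emb n g) = inner ℂ (emb n f) (emb n (conjS n α g)) :=
  symmetric_conjS f g

theorem fieldGrad_symm (α : ℝ) (i j : Fin n) : (fieldGrad α i j : Rn n → ℝ) = fieldGrad α j i := by
  ext x
  simp only [fieldGrad, eq_comm (a := i)]
  ring

/-- The commutator of the kinetic energy with the conjugate operator. -/
theorem commutator_kin (f g : 𝓢(Rn n, ℂ)) :
    inner ℂ (emb n (momentumSq n f)) (emb n (conjS n α g)) -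
      inner ℂ (emb n (conjS n α f)) (emb n (momentumSq n g)) =
    ∑ i, (-(4 * Complex.I) * ∑ j, inner ℂ (emb n (momentum i f))
        (emb n (sm (fieldGrad α i j) (momentum j g))) -
      inner ℂ (emb n (momentum i f)) (emb n (sm (fieldDivD α i) g)) +
      inner ℂ (emb n (sm (fieldDivD α i) f)) (emb n (momentum i g))) := by
  -- The Jacobian is symmetric, so the two halves of the commutator contribute equally; this turns
  -- the coefficient `2` into `4`.
  have h1 : ∑ i, ∑ j, (inner ℂ (emb n (sm (fieldGrad α i j) (momentum j f)))
        (emb n (momentum i g)) : ℂ) =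
      ∑ i, ∑ j, inner ℂ (emb n (momentum i f))
        (emb n (sm (fieldGrad α i j) (momentum j g))) := by
    rw [Finset.sum_comm]
    refine Finset.sum_congr rfl fun i _ => Finset.sum_congr rfl fun j _ => ?_
    rw [inner_sm (temperate_fieldGrad α j i), fieldGrad_symm]
  rw [inner_kin, inner_kin', ← Finset.sum_sub_distrib]
  have h2 : ∀ i : Fin n, (inner ℂ (emb n (momentum i f)) (emb n (momentum i (conjS n α g))) -
      inner ℂ (emb n (momentum i (conjS n α f))) (emb n (momentum i g)) : ℂ) =
      (-(2 * Complex.I) * ∑ j, inner ℂ (emb n (momentum i f))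
        (emb n (sm (fieldGrad α i j) (momentum j g))) -
      inner ℂ (emb n (momentum i f)) (emb n (sm (fieldDivD α i) g)) +
      inner ℂ (emb n (sm (fieldDivD α i) f)) (emb n (momentum i g))) -
      (2 * Complex.I) * ∑ j, inner ℂ (emb n (sm (fieldGrad α i j) (momentum j f)))
        (emb n (momentum i g)) := by
    intro i
    rw [momentum_conjS, momentum_conjS]
    simp only [map_sub, map_smul, map_sum, inner_sub_left, inner_sub_right, inner_smul_left,
      inner_smul_right, inner_sum, sum_inner, inner_conjS, map_mul, Complex.conj_I, map_ofNat]
    ring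
  rw [Finset.sum_congr rfl fun i _ => h2 i, Finset.sum_sub_distrib, ← Finset.mul_sum, h1,
    Finset.mul_sum, ← Finset.sum_sub_distrib]
  exact Finset.sum_congr rfl fun i _ => by ring

/-! #### The potential -/

theorem integrable_weight_mul {F : Rn n → ℝ} {C : ℝ} (hF : AEStronglyMeasurable F volume)
    (hC : ∀ x, |F x| ≤ C * japPow 2 x) (f g : 𝓢(Rn n, ℂ)) :
    Integrable (fun x => (F x : ℂ) * (starRingEnd ℂ (f x) * g x)) volume := by
  have hb : IsBddMeas fun x : Rn n => ((F x * japPow (-2) x : ℝ) : ℂ) := by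
    refine ⟨Complex.continuous_ofReal.comp_aestronglyMeasurable
      (hF.mul (continuous_japPow (-2)).aestronglyMeasurable), C, fun x => ?_⟩
    rw [Complex.norm_real, Real.norm_eq_abs, abs_mul, abs_of_pos (japPow_pos _ x)]
    calc _ ≤ C * japPow 2 x * japPow (-2) x :=
          mul_le_mul_of_nonneg_right (hC x) (japPow_pos _ x).le
      _ = C := by rw [mul_assoc, japPow_mul]; simp [japPow_zero]
  refine (L2.integrable_inner (𝕜 := ℂ) (emb n f)
    (rmul (fun x => F x * japPow (-2) x) (emb n (sm (japPow 2) g)))).congr ?_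
  filter_upwards [bmul_coe hb (emb n (sm (japPow 2) g)), emb_coe f,
    emb_coe (sm (japPow 2) g)] with x h1 h2 h3
  rw [h2]
  refine (congrArg (inner ℂ (f x)) h1).trans ?_
  rw [h3, sm_apply (temperate_japPow 2)]
  have : (japPow (-2) x : ℂ) * japPow 2 x = 1 := by
    rw [← Complex.ofReal_mul, japPow_mul]; simp [japPow_zero]
  simp only [RCLike.inner_apply]
  push_cast
  linear_combination (F x * g x * starRingEnd ℂ (f x) : ℂ) * this

/-- Integration by parts of `F` against `f̄ g`. Only line derivatives of `F` and growth bounds are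
required, because `|x|^α` is not smooth at the origin. -/
theorem integral_weight_momentum {F F' : Rn n → ℝ} {j : Fin n} {C : ℝ}
    (hF : AEStronglyMeasurable F volume) (hC : ∀ x, |F x| ≤ C * japPow 2 x)
    (hF' : AEStronglyMeasurable F' volume) (hC' : ∀ x, |F' x| ≤ C * japPow 2 x)
    (hd : ∀ x, HasLineDerivAt ℝ F (F' x) x (ej j)) (f g : 𝓢(Rn n, ℂ)) :
    (∫ x, (F x : ℂ) * (starRingEnd ℂ (f x) * momentum j g x)) -
      (∫ x, (F x : ℂ) * (starRingEnd ℂ (momentum j f x) * g x)) =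
    Complex.I * ∫ x, (F' x : ℂ) * (starRingEnd ℂ (f x) * g x) := by
  have i1 := integrable_weight_mul hF hC f (momentum j g)
  have i2 := integrable_weight_mul hF hC (momentum j f) g
  have i3 := integrable_weight_mul hF' hC' f g
  have i4 := integrable_weight_mul hF hC f g
  have i5 := (i1.sub i2).const_mul Complex.I
  have hG : ∀ x, HasLineDerivAt ℝ (fun x => starRingEnd ℂ (f x) * g x)
      (Complex.I * (starRingEnd ℂ (f x) * momentum j g x -
        starRingEnd ℂ (momentum j f x) * g x)) x (ej j) := by
    intro x
    have h1 := hasLineDerivAt_schwartz f x (ej j)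
    have h2 := hasLineDerivAt_schwartz g x (ej j)
    have h3 := (Complex.conjCLE : ℂ →L[ℝ] ℂ).hasFDerivAt.comp_hasDerivAt (0 : ℝ) h1
    refine HasDerivAt.congr_deriv (HasDerivAt.mul h3 h2) ?_
    simp only [momentum_apply, map_mul, map_neg, Complex.conj_I, zero_smul,
      add_zero, ContinuousLinearEquiv.coe_coe, Complex.conjCLE_apply]
    linear_combination (starRingEnd ℂ (f x) * lineDeriv ℝ g x (ej j) +
      starRingEnd ℂ (lineDeriv ℝ f x (ej j)) * g x) * Complex.I_mul_I
  have key := integral_bilinear_hasLineDerivAt_right_eq_neg_left_of_integrable (μ := volume)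
    (f := F) (f' := F') (B := ContinuousLinearMap.lsmul ℝ ℝ (E := ℂ)) (v := ej j)
    (g := fun x => starRingEnd ℂ (f x) * g x)
    (g' := fun x => Complex.I * (starRingEnd ℂ (f x) * momentum j g x -
        starRingEnd ℂ (momentum j f x) * g x))
    (by simpa using i3) (by
      refine i5.congr (Filter.Eventually.of_forall fun x => ?_)
      simp only [Pi.sub_apply, ContinuousLinearMap.lsmul_apply, Complex.real_smul]
      ring) (by simpa using i4) (fun x _ => hd x) (fun x _ => hG x)
  simp only [ContinuousLinearMap.lsmul_apply, Complex.real_smul] at key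
  have e1 : ∫ x, (F x : ℂ) * (Complex.I * (starRingEnd ℂ (f x) * momentum j g x -
      starRingEnd ℂ (momentum j f x) * g x)) = Complex.I *
      ((∫ x, (F x : ℂ) * (starRingEnd ℂ (f x) * momentum j g x)) -
      ∫ x, (F x : ℂ) * (starRingEnd ℂ (momentum j f x) * g x)) := by
    rw [← integral_sub i1 i2, ← integral_const_mul]
    refine integral_congr_ae (Filter.Eventually.of_forall fun x => ?_)
    ring
  rw [e1] at key
  linear_combination (-Complex.I) * key + ((∫ x, (F x : ℂ) * (starRingEnd ℂ (f x) * momentum j g x)) -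
      ∫ x, (F x : ℂ) * (starRingEnd ℂ (momentum j f x) * g x)) * Complex.I_mul_I

/-- `Y` is the derivative of the potential `w` along the field `⟨x⟩ ^ (-α) x`; it is given by the
derivatives `D j` of `⟨x⟩ ^ (-α) x_j w`. -/
structure IsFieldDeriv (α : ℝ) (w Y : Rn n → ℝ) (D : Fin n → Rn n → ℝ) (C : ℝ) : Prop where
  meas : ∀ j, AEStronglyMeasurable (D j) volume
  bound : ∀ j x, |D j x| ≤ C * japPow 2 x
  deriv : ∀ j x, HasLineDerivAt ℝ (fun x => w x * field α j x) (D j x) x (ej j)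
  sum_eq : ∀ x, ∑ j, D j x = Y x + w x * fieldDiv α x

theorem inner_pot_emb (hα : α ≤ 2) (hw : IsPotential α c w) (f k : 𝓢(Rn n, ℂ)) :
    inner ℂ (pot w f) (emb n k) = ∫ x, (w x : ℂ) * (starRingEnd ℂ (f x) * k x) := by
  rw [L2.inner_def]
  refine integral_congr_ae ?_
  filter_upwards [pot_coe hα hw f, emb_coe k] with x h1 h2
  rw [h1, h2]
  simp only [RCLike.inner_apply, map_mul, Complex.conj_ofReal]
  ring

theorem inner_emb_pot (hα : α ≤ 2) (hw : IsPotential α c w) (f k : 𝓢(Rn n, ℂ)) :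
    inner ℂ (emb n f) (pot w k) = ∫ x, (w x : ℂ) * (starRingEnd ℂ (f x) * k x) := by
  rw [← inner_pot hα hw, inner_pot_emb hα hw]

variable {Y : Rn n → ℝ} {D : Fin n → Rn n → ℝ} {C : ℝ}

theorem abs_potential_mul_field_le (hw : IsPotential α c w) (j : Fin n) (x : Rn n) :
    |w x * field α j x| ≤ c * japPow 2 x := by
  rw [abs_mul]
  calc _ ≤ (c * japPow α x) * japPow (1 - α) x :=
        mul_le_mul (hw.bound x) (abs_field_le α j x) (abs_nonneg _)
          (mul_nonneg hw.nonneg (japPow_pos _ x).le)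
    _ = c * japPow 1 x := by rw [mul_assoc, japPow_mul]; congr 2; ring
    _ ≤ _ := mul_le_mul_of_nonneg_left (japPow_le_japPow (by norm_num) x) hw.nonneg

/-- The commutator of the potential with the conjugate operator. -/
theorem commutator_pot (hα₀ : 0 ≤ α) (hα : α ≤ 2) (hw : IsPotential α c w)
    (hY : IsFieldDeriv α w Y D C) (hYb : IsBddMeas fun x => ((Y x : ℝ) : ℂ))
    (f g : 𝓢(Rn n, ℂ)) :
    inner ℂ (pot w f) (emb n (conjS n α g)) - inner ℂ (emb n (conjS n α f)) (pot w g) =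
      2 * Complex.I * inner ℂ (emb n f) (rmul Y (emb n g)) := by
  have hX : ∀ j, Continuous (field α j : Rn n → ℝ) := fun j =>
    continuous_of_temperate (temperate_field α j)
  have hM : ∀ j, AEStronglyMeasurable (fun x => w x * field α j x) volume := fun j =>
    (hw.cont.mul (hX j)).aestronglyMeasurable
  have hB : ∀ j x, |w x * field α j x| ≤ max c C * japPow 2 x := fun j x =>
    (abs_potential_mul_field_le hw j x).trans
      (mul_le_mul_of_nonneg_right (le_max_left _ _) (japPow_pos _ x).le)
  have hB' : ∀ j x, |D j x| ≤ max c C * japPow 2 x := fun j x =>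
    (hY.bound j x).trans (mul_le_mul_of_nonneg_right (le_max_right _ _) (japPow_pos _ x).le)
  -- The product `w X_j` is differentiated as a whole. The resulting `w div X` cancels the
  -- divergence term of `𝒜`, and only the derivative of `w` along the field survives.
  have ibp := fun j => integral_weight_momentum (hM j) (hB j) (hY.meas j) (hB' j) (hY.deriv j) f g
  have e1 : ∀ j, inner ℂ (pot w f) (emb n (sm (field α j) (momentum j g))) =
      ∫ x, ((w x * field α j x : ℝ) : ℂ) * (starRingEnd ℂ (f x) * momentum j g x) := fun j => by
    rw [inner_pot_emb hα hw]
    refine integral_congr_ae (Filter.Eventually.of_forall fun x => ?_)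
    simp only [sm_apply (temperate_field α j)]
    push_cast; ring
  have e2 : ∀ j, inner ℂ (emb n (sm (field α j) (momentum j f))) (pot w g) =
      ∫ x, ((w x * field α j x : ℝ) : ℂ) * (starRingEnd ℂ (momentum j f x) * g x) := fun j => by
    rw [inner_emb_pot hα hw]
    refine integral_congr_ae (Filter.Eventually.of_forall fun x => ?_)
    simp only [sm_apply (temperate_field α j), map_mul, Complex.conj_ofReal]
    push_cast; ring
  have hWD : ∀ x, |w x * fieldDiv α x| ≤ (c * (n + 4)) * japPow 2 x := fun x => by
    rw [abs_mul]
    calc _ ≤ (c * japPow α x) * ((n + 4) * japPow (-α) x) :=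
          mul_le_mul (hw.bound x) (abs_fieldDiv_le hα₀ hα x) (abs_nonneg _)
            (mul_nonneg hw.nonneg (japPow_pos _ x).le)
      _ = c * (n + 4) * (japPow α x * japPow (-α) x) := by ring
      _ = c * (n + 4) * japPow 0 x := by rw [japPow_mul]; congr 2; ring
      _ ≤ _ := mul_le_mul_of_nonneg_left (japPow_le_japPow (by norm_num) x)
          (mul_nonneg hw.nonneg (by positivity))
  have iWD := integrable_weight_mul (F := fun x => w x * fieldDiv α x)
    (hw.cont.mul (continuous_of_temperate (temperate_fieldDiv α))).aestronglyMeasurable hWD f g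
  have e3 : inner ℂ (pot w f) (emb n (sm (fieldDiv α) g)) =
      ∫ x, ((w x * fieldDiv α x : ℝ) : ℂ) * (starRingEnd ℂ (f x) * g x) := by
    rw [inner_pot_emb hα hw]
    refine integral_congr_ae (Filter.Eventually.of_forall fun x => ?_)
    simp only [sm_apply (temperate_fieldDiv α)]
    push_cast; ring
  have e4 : inner ℂ (emb n (sm (fieldDiv α) f)) (pot w g) =
      ∫ x, ((w x * fieldDiv α x : ℝ) : ℂ) * (starRingEnd ℂ (f x) * g x) := by
    rw [inner_emb_pot hα hw]
    refine integral_congr_ae (Filter.Eventually.of_forall fun x => ?_)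
    simp only [sm_apply (temperate_fieldDiv α), map_mul, Complex.conj_ofReal]
    push_cast; ring
  have e5 : inner ℂ (emb n f) (rmul Y (emb n g)) =
      (∑ j, ∫ x, (D j x : ℂ) * (starRingEnd ℂ (f x) * g x)) -
        ∫ x, ((w x * fieldDiv α x : ℝ) : ℂ) * (starRingEnd ℂ (f x) * g x) := by
    rw [← integral_finsetSum _ fun j _ => integrable_weight_mul (hY.meas j) (hY.bound j) f g,
      ← integral_sub (integrable_finsetSum _ fun j _ =>
        integrable_weight_mul (hY.meas j) (hY.bound j) f g) iWD, L2.inner_def]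
    refine integral_congr_ae ?_
    filter_upwards [bmul_coe hYb (emb n g), emb_coe f, emb_coe g] with x h1 h2 h3
    rw [h2]
    refine (congrArg (inner ℂ (f x)) h1).trans ?_
    rw [h3, ← Finset.sum_mul, ← Complex.ofReal_sum, hY.sum_eq]
    simp only [RCLike.inner_apply]
    push_cast; ring
  rw [conjS_eq, conjS_eq, map_sub, map_sub, map_sum, map_sum, map_smul, map_smul, inner_sub_left,
    inner_sub_right, inner_sum, sum_inner, inner_smul_left, inner_smul_right, e3, e4, e5]
  have e6 : ∀ j, (inner ℂ (pot w f) (emb n ((2 : ℂ) • sm (field α j) (momentum j g))) : ℂ) =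
      2 * inner ℂ (emb n ((2 : ℂ) • sm (field α j) (momentum j f))) (pot w g) / 2 +
        2 * Complex.I * ∫ x, (D j x : ℂ) * (starRingEnd ℂ (f x) * g x) := fun j => by
    rw [map_smul, map_smul, inner_smul_left, inner_smul_right, e1, e2, map_ofNat]
    linear_combination 2 * ibp j
  rw [Finset.sum_congr rfl fun j _ => e6 j, Finset.sum_add_distrib, ← Finset.mul_sum]
  simp only [Complex.conj_I]
  have e7 : ∀ z : ℂ, 2 * z / 2 = z := fun z => by ring
  simp only [e7]
  ring

/-! #### The commutator in terms of weighted momenta -/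

/-- The weighted momentum `⟨x⟩ ^ (-α/2) p_i`. -/
def wmom (α : ℝ) (i : Fin n) : 𝓢(Rn n, ℂ) →ₗ[ℂ] L2 n :=
  emb n ∘ₗ (sm (japPow (-α / 2))).toLinearMap ∘ₗ (momentum i).toLinearMap

/-- `⟨x⟩ ^ α ∂_i (⟨x⟩ ^ (-α) x_j)`. -/
def gradWeight (α : ℝ) (i j : Fin n) (x : Rn n) : ℝ :=
  (if j = i then 1 else 0) + (-α) * (x i * (x j * japPow (-2) x))

/-- `⟨x⟩ ^ (α/2) ∂_i div (⟨x⟩ ^ (-α) x)`. -/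
def divWeight (α : ℝ) (i : Fin n) (x : Rn n) : ℝ :=
  (n - α) * (-α * (x i * japPow (-α / 2 - 2) x)) +
    α * ((-α - 2) * (x i * japPow (-α / 2 - 4) x))

theorem temperate_gradWeight (α : ℝ) (i j : Fin n) :
    (gradWeight α i j : Rn n → ℝ).HasTemperateGrowth :=
  (Function.HasTemperateGrowth.const _).add (temperate_const_mul (-α) ((temperate_coord i).mul
    ((temperate_coord j).mul (temperate_japPow (-2)))))

theorem temperate_divWeight (α : ℝ) (i : Fin n) :
    (divWeight α i : Rn n → ℝ).HasTemperateGrowth :=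
  (temperate_const_mul _ (temperate_const_mul _ ((temperate_coord i).mul (temperate_japPow _)))).add
    (temperate_const_mul _ (temperate_const_mul _ ((temperate_coord i).mul (temperate_japPow _))))

theorem fieldGrad_eq (α : ℝ) (i j : Fin n) (x : Rn n) :
    fieldGrad α i j x = japPow (-α / 2) x * (gradWeight α i j x * japPow (-α / 2) x) := by
  have h1 : japPow (-α / 2) x * japPow (-α / 2) x = japPow (-α) x := by
    rw [japPow_mul]; congr 1; ring
  have h2 : japPow (-α) x * japPow (-2) x = japPow (-α - 2) x := by
    rw [japPow_mul]; congr 1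
  rw [fieldGrad, gradWeight, ← h2, ← h1]
  split_ifs <;> ring

theorem fieldDivD_eq (α : ℝ) (i : Fin n) (x : Rn n) :
    fieldDivD α i x = japPow (-α / 2) x * divWeight α i x := by
  have h1 : japPow (-α / 2) x * japPow (-α / 2 - 2) x = japPow (-α - 2) x := by
    rw [japPow_mul]; congr 1; ring
  have h2 : japPow (-α / 2) x * japPow (-α / 2 - 4) x = japPow (-α - 2 - 2) x := by
    rw [japPow_mul]; congr 1; ring
  rw [fieldDivD, divWeight, ← h2, ← h1]
  ring

theorem abs_gradWeight_le (hα₀ : 0 ≤ α) (i j : Fin n) (x : Rn n) : |gradWeight α i j x| ≤ 1 + α := by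
  have h1 := abs_coord_le x i
  have h2 := abs_coord_mul_japPow_le (-2) x j
  have h3 : |x i| * (|x j| * japPow (-2) x) ≤ 1 := by
    calc _ ≤ japPow 1 x * japPow (-2 + 1) x :=
          mul_le_mul h1 h2 (mul_nonneg (abs_nonneg _) (japPow_pos _ x).le) (japPow_pos _ x).le
      _ = 1 := by rw [japPow_mul]; norm_num [japPow_zero]
  rw [gradWeight]
  refine (abs_add_le _ _).trans (add_le_add ?_ ?_)
  · split_ifs <;> simp
  · rw [abs_mul, abs_neg, abs_of_nonneg hα₀, abs_mul, abs_mul, abs_of_pos (japPow_pos (-2) x)]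
    nlinarith

theorem abs_divWeight_le (hα₀ : 0 ≤ α) (hα : α ≤ 2) (i : Fin n) (x : Rn n) :
    |divWeight α i x| ≤ (2 * (n + 2) + 8) * japPow (-1) x := by
  have h1 := (abs_coord_mul_japPow_le (-α / 2 - 2) x i).trans
    (japPow_le_japPow (show -α / 2 - 2 + 1 ≤ -1 by linarith) x)
  have h2 := (abs_coord_mul_japPow_le (-α / 2 - 4) x i).trans
    (japPow_le_japPow (show -α / 2 - 4 + 1 ≤ -1 by linarith) x)
  have hn : (0 : ℝ) ≤ n := Nat.cast_nonneg n
  have h3 : |(n : ℝ) - α| ≤ n + 2 := by rw [abs_le]; constructor <;> linarith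
  have a1 : 0 ≤ |x i| * japPow (-α / 2 - 2) x := mul_nonneg (abs_nonneg _) (japPow_pos _ x).le
  have a2 : 0 ≤ |x i| * japPow (-α / 2 - 4) x := mul_nonneg (abs_nonneg _) (japPow_pos _ x).le
  rw [divWeight, add_mul]
  refine (abs_add_le _ _).trans (add_le_add ?_ ?_)
  · rw [abs_mul, abs_mul, abs_mul, abs_neg, abs_of_nonneg hα₀, abs_of_pos (japPow_pos _ x)]
    refine (mul_le_mul h3 (mul_le_mul hα h1 a1 zero_le_two) (mul_nonneg hα₀ a1)
      (by positivity)).trans_eq ?_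
    ring
  · rw [abs_mul, abs_mul, abs_mul, abs_of_nonneg hα₀, abs_of_pos (japPow_pos _ x)]
    have h4 : |-α - 2| ≤ 4 := by rw [abs_le]; constructor <;> linarith
    refine (mul_le_mul hα (mul_le_mul h4 h2 a2 (by norm_num)) (mul_nonneg (abs_nonneg _) a2)
      zero_le_two).trans_eq ?_
    ring

theorem isBddMeas_gradWeight (hα₀ : 0 ≤ α) (i j : Fin n) :
    IsBddMeas fun x : Rn n => ((gradWeight α i j x : ℝ) : ℂ) :=
  isBddMeas_temperate (temperate_gradWeight α i j) (abs_gradWeight_le hα₀ i j)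

theorem isBddMeas_divWeight (hα₀ : 0 ≤ α) (hα : α ≤ 2) (i : Fin n) :
    IsBddMeas fun x : Rn n => ((divWeight α i x : ℝ) : ℂ) :=
  isBddMeas_temperate (temperate_divWeight α i) (C := 2 * (n + 2) + 8) fun x =>
    (abs_divWeight_le hα₀ hα i x).trans
      (mul_le_of_le_one_right (by positivity) (japPow_le_one (by norm_num) x))

/-- Factoring `⟨x⟩^(-α/2)` out of both sides of the Jacobian and out of `∇ div X` leaves bounded
coefficients between weighted momenta and the identity, all of which are bounded relative to `p² +
w`. This is why the form extends to a bounded operator between resolvents. -/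
theorem commutator_schr (hα₀ : 0 ≤ α) (hα : α ≤ 2) (hw : IsPotential α c w)
    (hY : IsFieldDeriv α w Y D C) (hYb : IsBddMeas fun x => ((Y x : ℝ) : ℂ))
    (f g : 𝓢(Rn n, ℂ)) :
    Complex.I * (inner ℂ (schr w f) (emb n (conjS n α g)) -
      inner ℂ (emb n (conjS n α f)) (schr w g)) =
    ∑ i, (4 * ∑ j, inner ℂ (wmom α i f) (rmul (gradWeight α i j) (wmom α j g)) -
      Complex.I * inner ℂ (wmom α i f) (rmul (divWeight α i) (emb n g)) +
      Complex.I * inner ℂ (rmul (divWeight α i) (emb n f)) (wmom α i g)) -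
      2 * inner ℂ (emb n f) (rmul Y (emb n g)) := by
  have hJ := temperate_japPow (n := n) (-α / 2)
  have e1 : ∀ i j, (inner ℂ (emb n (momentum i f))
      (emb n (sm (fieldGrad α i j) (momentum j g))) : ℂ) =
      inner ℂ (wmom α i f) (rmul (gradWeight α i j) (wmom α j g)) := fun i j => by
    have : sm (fieldGrad α i j) (momentum j g) =
        sm (japPow (-α / 2)) (sm (gradWeight α i j) (sm (japPow (-α / 2)) (momentum j g))) := by
      have hM : (fun x => gradWeight α i j x * japPow (-α / 2) x).HasTemperateGrowth :=
        (temperate_gradWeight α i j).mul hJ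
      rw [sm_sm (temperate_gradWeight α i j) hJ, sm_sm hJ hM]
      congr 2
      ext x
      exact fieldGrad_eq α i j x
    rw [this, ← inner_sm hJ, ← rmul_emb (isBddMeas_gradWeight hα₀ i j) (temperate_gradWeight α i j)]
    rfl
  have e2 : ∀ k, ∀ i, sm (fieldDivD α i) k = sm (japPow (-α / 2)) (sm (divWeight α i) k) :=
    fun k i => by
      rw [sm_sm hJ (temperate_divWeight α i)]
      congr 2
      ext x
      exact fieldDivD_eq α i x
  have e3 : ∀ i, (inner ℂ (emb n (momentum i f)) (emb n (sm (fieldDivD α i) g)) : ℂ) =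
      inner ℂ (wmom α i f) (rmul (divWeight α i) (emb n g)) := fun i => by
    rw [e2, ← inner_sm hJ, rmul_emb (isBddMeas_divWeight hα₀ hα i) (temperate_divWeight α i)]
    rfl
  have e4 : ∀ i, (inner ℂ (emb n (sm (fieldDivD α i) f)) (emb n (momentum i g)) : ℂ) =
      inner ℂ (rmul (divWeight α i) (emb n f)) (wmom α i g) := fun i => by
    rw [e2, inner_sm hJ, rmul_emb (isBddMeas_divWeight hα₀ hα i) (temperate_divWeight α i)]
    rfl
  have h1 := commutator_kin (α := α) f g
  have h2 := commutator_pot hα₀ hα hw hY hYb f g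
  simp only [e1, e3, e4] at h1
  rw [schr_apply, schr_apply, inner_add_left, inner_add_right]
  have h3 : Complex.I * ∑ i, (-(4 * Complex.I) * ∑ j, inner ℂ (wmom α i f)
        (rmul (gradWeight α i j) (wmom α j g)) -
      inner ℂ (wmom α i f) (rmul (divWeight α i) (emb n g)) +
      inner ℂ (rmul (divWeight α i) (emb n f)) (wmom α i g)) =
      ∑ i, (4 * ∑ j, inner ℂ (wmom α i f) (rmul (gradWeight α i j) (wmom α j g)) -
      Complex.I * inner ℂ (wmom α i f) (rmul (divWeight α i) (emb n g)) +
      Complex.I * inner ℂ (rmul (divWeight α i) (emb n f)) (wmom α i g)) := by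
    rw [Finset.mul_sum]
    refine Finset.sum_congr rfl fun i _ => ?_
    linear_combination (-4 * ∑ j, inner ℂ (wmom α i f)
        (rmul (gradWeight α i j) (wmom α j g))) * Complex.I_mul_I
  rw [← h3]
  linear_combination Complex.I * h1 + Complex.I * h2 +
    (2 * inner ℂ (emb n f) (rmul Y (emb n g))) * Complex.I_mul_I

end Commutator

end

end MourreRepulsive


namespace MourreRepulsive

noncomputable section

/-! ### The commutator form on the domain -/

section CommutatorForm

variable {n : ℕ} {α c : ℝ} {w : Rn n → ℝ}

/-- The bounded operator `⟨x⟩ ^ (-α/2) p_i (H + i)⁻¹`. -/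
def momOp (w : Rn n → ℝ) (α : ℝ) (i : Fin n) : L2 n →L[ℂ] L2 n := relOp w (wmom α i)

open ContinuousLinearMap in
/-- The bounded operator of the commutator form between resolvents. -/
def commOp (w : Rn n → ℝ) (α : ℝ) (Y : Rn n → ℝ) : L2 n →L[ℂ] L2 n :=
  ∑ i, ((4 : ℂ) • ∑ j, adjoint (momOp w α i) * (rmul (gradWeight α i j) * momOp w α j) -
      Complex.I • (adjoint (momOp w α i) * (rmul (divWeight α i) * res w)) +
      Complex.I • (adjoint (res w) * (rmul (divWeight α i) * momOp w α i))) -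
    (2 : ℂ) • (adjoint (res w) * (rmul Y * res w))

theorem relBdd_wmom (h : EssSelfAdjoint (emb n) (schr w)) (hα₀ : 0 ≤ α) (hα : α ≤ 2)
    (hw : IsPotential α c w) (i : Fin n) : RelBdd w (wmom α i) :=
  ⟨_, norm_weighted_momentum_le_shift h hα₀ hα hw i⟩

variable {Y : Rn n → ℝ} {D : Fin n → Rn n → ℝ} {C : ℝ}

theorem inner_commOp (hα₀ : 0 ≤ α) (hα : α ≤ 2) (k l : L2 n) :
    inner ℂ k (commOp w α Y l) =
    ∑ i, (4 * ∑ j, inner ℂ (momOp w α i k) (rmul (gradWeight α i j) (momOp w α j l)) -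
      Complex.I * inner ℂ (momOp w α i k) (rmul (divWeight α i) (res w l)) +
      Complex.I * inner ℂ (rmul (divWeight α i) (res w k)) (momOp w α i l)) -
      2 * inner ℂ (res w k) (rmul Y (res w l)) := by
  have h1 : ∀ A B : L2 n →L[ℂ] L2 n, inner ℂ k ((ContinuousLinearMap.adjoint A * B) l) =
      inner ℂ (A k) (B l) := fun A B => ContinuousLinearMap.adjoint_inner_right A k (B l)
  rw [commOp]
  simp only [sub_apply, add_apply, sum_apply, smul_apply, inner_sub_right, inner_add_right,
    inner_sum, inner_smul_right, h1]
  congr 1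
  refine Finset.sum_congr rfl fun i _ => ?_
  rw [inner_rmul (isBddMeas_divWeight hα₀ hα i)]
  rfl

theorem inner_commOp_core (h : EssSelfAdjoint (emb n) (schr w)) (hα₀ : 0 ≤ α) (hα : α ≤ 2)
    (hw : IsPotential α c w) (hY : IsFieldDeriv α w Y D C)
    (hYb : IsBddMeas fun x => ((Y x : ℝ) : ℂ)) (f g : 𝓢(Rn n, ℂ)) :
    inner ℂ (shift (emb n) (schr w) Complex.I f)
      (commOp w α Y (shift (emb n) (schr w) Complex.I g)) =
    Complex.I * (inner ℂ (schr w f) (emb n (conjS n α g)) -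
      inner ℂ (emb n (conjS n α f)) (schr w g)) := by
  rw [inner_commOp hα₀ hα, commutator_schr hα₀ hα hw hY hYb]
  simp only [momOp, relOp_apply h (relBdd_wmom h hα₀ hα hw _), res_apply h]

/-! #### Cutoffs -/

/-- `k ↦ (H + i) η (H + i)⁻¹ k` for the cutoff `η = eta ε`. -/
def cutRes (w : Rn n → ℝ) (ε : ℝ) : L2 n →L[ℂ] L2 n :=
  rmul (eta ε) + relOp w (emb n ∘ₗ kinComm (regD 0 ε) (regDD 0 ε))

/-- `k ↦ 𝒜 η (H + i)⁻¹ k` for the cutoff `η = eta ε`. -/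
def cutConj (w : Rn n → ℝ) (α ε : ℝ) : L2 n →L[ℂ] L2 n :=
  relOp w (emb n ∘ₗ conjS n α ∘ₗ (sm (eta ε)).toLinearMap)

theorem norm_kinComm_eta_le_shift (h : EssSelfAdjoint (emb n) (schr w)) (hα₀ : 0 ≤ α) (hα : α ≤ 2)
    (hw : IsPotential α c w) {ε : ℝ} (hε : 0 < ε) (hε1 : ε ≤ 1) (f : 𝓢(Rn n, ℂ)) :
    ‖(emb n ∘ₗ kinComm (regD 0 ε) (regDD 0 ε)) f‖ ≤
      cutoffErr n α c ε * ‖shift (emb n) (schr w) Complex.I f‖ :=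
  norm_kinComm_eta_le hα₀ hα hw hε hε1 f (by simpa using h.norm_apply_le_plus f)
    (by simpa using h.norm_le_plus f)

theorem cutRes_core (h : EssSelfAdjoint (emb n) (schr w)) (hα₀ : 0 ≤ α) (hα : α ≤ 2)
    (hw : IsPotential α c w) {ε : ℝ} (hε : 0 < ε) (hε1 : ε ≤ 1) (f : 𝓢(Rn n, ℂ)) :
    cutRes w ε (shift (emb n) (schr w) Complex.I f) =
      shift (emb n) (schr w) Complex.I (sm (eta ε) f) := by
  have hb := isBddMeas_eta (n := n) hε.le
  have hη := temperate_eta (n := n) hε.le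
  rw [cutRes, add_apply, relOp_apply h ⟨_, norm_kinComm_eta_le_shift h hα₀ hα hw hε hε1⟩,
    shift_apply, shift_apply, (isMultiplier_eta hε.le).schr_sm hα hw hb, map_add, map_smul,
    rmul_emb hb hη]
  simp only [LinearMap.comp_apply]
  abel

/-- With the cutoff inserted every term is continuous in `k` and `l`, so the identity on the core
extends by density. The vector `cutRes w ε k - i η R k` plays the role of `H η R k`. -/
theorem inner_cutRes_commOp (h : EssSelfAdjoint (emb n) (schr w)) (hα₀ : 0 ≤ α) (hα : α ≤ 2)
    (hw : IsPotential α c w) (hY : IsFieldDeriv α w Y D C)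
    (hYb : IsBddMeas fun x => ((Y x : ℝ) : ℂ)) {ε : ℝ} (hε : 0 < ε) (hε1 : ε ≤ 1) (k l : L2 n) :
    inner ℂ (cutRes w ε k) (commOp w α Y (cutRes w ε l)) = Complex.I *
      (inner ℂ (cutRes w ε k - Complex.I • rmul (eta ε) (res w k)) (cutConj w α ε l) -
        inner ℂ (cutConj w α ε k) (cutRes w ε l - Complex.I • rmul (eta ε) (res w l))) := by
  refine DenseRange.induction_on₂ (p := fun k l => inner ℂ (cutRes w ε k)
    (commOp w α Y (cutRes w ε l)) = Complex.I *
      (inner ℂ (cutRes w ε k - Complex.I • rmul (eta ε) (res w k)) (cutConj w α ε l) -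
        inner ℂ (cutConj w α ε k) (cutRes w ε l - Complex.I • rmul (eta ε) (res w l)))) h.plus
    (isClosed_eq (by fun_prop) (by fun_prop)) (fun f g => ?_) k l
  have hb := isBddMeas_eta (n := n) hε.le
  have hη := temperate_eta (n := n) hε.le
  rw [cutRes_core h hα₀ hα hw hε hε1, cutRes_core h hα₀ hα hw hε hε1,
    inner_commOp_core h hα₀ hα hw hY hYb, cutConj,
    relOp_apply h (relBdd_conjS_eta h hα₀ hα hw hε hε1),
    relOp_apply h (relBdd_conjS_eta h hα₀ hα hw hε hε1), res_apply h, res_apply h,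
    rmul_emb hb hη, rmul_emb hb hη, shift_apply, shift_apply, add_sub_cancel_right,
    add_sub_cancel_right]
  rfl

/-- The commutator term has norm at most `cutoffErr`, which vanishes in the limit because `α < 2`.
-/
theorem tendsto_cutRes (h : EssSelfAdjoint (emb n) (schr w)) (hα₀ : 0 ≤ α) (hα : α < 2)
    (hw : IsPotential α c w) (k : L2 n) :
    Filter.Tendsto (fun m : ℕ => cutRes w (1 / ((m : ℝ) + 1)) k) Filter.atTop (nhds k) := by
  have h1 : Filter.Tendsto (fun m : ℕ => relOp w (emb n ∘ₗ kinComm (regD 0 (1 / ((m : ℝ) + 1)))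
      (regDD 0 (1 / ((m : ℝ) + 1)))) k) Filter.atTop (nhds 0) := by
    have h2 := (tendsto_cutoffErr (n := n) (c := c) hα).mul_const ‖k‖
    rw [zero_mul] at h2
    refine squeeze_zero_norm (fun m => ?_) h2
    have he : 0 < 1 / ((m : ℝ) + 1) := by positivity
    have he1 : 1 / ((m : ℝ) + 1) ≤ 1 := by
      rw [div_le_one (by positivity)]
      have : (0 : ℝ) ≤ m := Nat.cast_nonneg m
      linarith
    have h0 : 0 ≤ cutoffErr n α c (1 / ((m : ℝ) + 1)) := by
      have := hw.nonneg
      unfold cutoffErr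
      positivity
    exact (ContinuousLinearMap.le_opNorm _ _).trans (mul_le_mul_of_nonneg_right
      (norm_relOp_le h (norm_kinComm_eta_le_shift h hα₀ hα.le hw he he1) h0) (norm_nonneg _))
  have := (tendsto_rmul_eta k).add h1
  rwa [add_zero] at this

/-! #### Cutoffs of the conjugate operator -/

/-- The derivative of the cutoff along the field `⟨x⟩ ^ (-α) x`. -/
def cutField (α ε : ℝ) (x : Rn n) : ℝ := japPow (-α) x * (-2 * ε * (‖x‖ ^ 2 * eta ε x ^ 2))

theorem temperate_cutField (α : ℝ) {ε : ℝ} (hε : 0 ≤ ε) :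
    (cutField α ε : Rn n → ℝ).HasTemperateGrowth := by
  have h1 : (fun x : Rn n => ‖x‖ ^ 2).HasTemperateGrowth := by fun_prop
  exact (temperate_japPow _).mul (temperate_const_mul _ (h1.mul ((temperate_eta hε).pow 2)))

theorem sum_field_mul_regD (α ε : ℝ) (x : Rn n) :
    ∑ j, field α j x * regD 0 ε j x = cutField α ε x := by
  have h1 : regRadial 0 ε x = -2 * ε * eta ε x ^ 2 := by simp [regRadial, japPow_zero]
  rw [cutField, ← sum_coord_sq, Finset.sum_mul, Finset.mul_sum, Finset.mul_sum]
  refine Finset.sum_congr rfl fun j _ => ?_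
  rw [field, regD, h1]
  ring

theorem eps_norm_sq_mul_eta_le {ε : ℝ} (hε : 0 ≤ ε) (x : Rn n) : ε * ‖x‖ ^ 2 * eta ε x ≤ 1 := by
  rw [eta, mul_inv_le_iff₀ (one_add_eps_pos hε x)]
  linarith

theorem abs_cutField_le (hα₀ : 0 ≤ α) {ε : ℝ} (hε : 0 ≤ ε) (x : Rn n) :
    |cutField α ε x| ≤ 2 := by
  have h1 := eps_norm_sq_mul_eta_le hε x
  have h2 := eta_le_one hε x
  have h3 := eta_pos hε x
  have h4 := japPow_le_one (show -α ≤ 0 by linarith) x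
  have h5 := japPow_pos (-α) x
  have h6 : 0 ≤ ε * ‖x‖ ^ 2 * eta ε x := by positivity
  have h7 : |cutField α ε x| = 2 * (japPow (-α) x * ((ε * ‖x‖ ^ 2 * eta ε x) * eta ε x)) := by
    rw [cutField, abs_mul, abs_of_pos h5, show -2 * ε * (‖x‖ ^ 2 * eta ε x ^ 2) =
      -(2 * ((ε * ‖x‖ ^ 2 * eta ε x) * eta ε x)) by ring, abs_neg, abs_of_nonneg (by positivity)]
    ring
  rw [h7]
  have h8 : (ε * ‖x‖ ^ 2 * eta ε x) * eta ε x ≤ 1 := mul_le_one₀ h1 h3.le h2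
  have h9 := mul_le_one₀ h4 (mul_nonneg h6 h3.le) h8
  linarith

theorem isBddMeas_cutField (hα₀ : 0 ≤ α) {ε : ℝ} (hε : 0 ≤ ε) :
    IsBddMeas fun x : Rn n => ((cutField α ε x : ℝ) : ℂ) :=
  isBddMeas_temperate (temperate_cutField α hε) (abs_cutField_le hα₀ hε)

theorem conjS_sm_eta {ε : ℝ} (hε : 0 ≤ ε) (f : 𝓢(Rn n, ℂ)) :
    conjS n α (sm (eta ε) f) =
      sm (eta ε) (conjS n α f) - (2 * Complex.I) • sm (cutField α ε) f := by
  have hη := temperate_eta (n := n) hε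
  have hm := isMultiplier_eta (n := n) hε
  have h1 : sm (cutField α ε) f = ∑ j, sm (field α j) (sm (regD 0 ε j) f) := by
    ext x
    rw [sum_apply, sm_apply (temperate_cutField α hε), ← sum_field_mul_regD]
    push_cast
    rw [Finset.sum_mul]
    refine Finset.sum_congr rfl fun j _ => ?_
    rw [sm_apply (temperate_field α j), sm_apply (hm.temperate₁ j)]
    ring
  rw [conjS_eq, conjS_eq, h1, map_sub, map_sum, map_smul, Finset.smul_sum,
    sm_sm (temperate_fieldDiv α) hη, sm_sm hη (temperate_fieldDiv α), sub_right_comm,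
    ← Finset.sum_sub_distrib]
  have h2 : (fun x : Rn n => fieldDiv α x * eta ε x) = fun x => eta ε x * fieldDiv α x := by
    ext x; ring
  rw [h2]
  congr 1
  refine Finset.sum_congr rfl fun j _ => ?_
  rw [momentum_sm hη (hm.temperate₁ j) (hm.deriv j), map_sub (sm (field α j)),
    map_smul (sm (field α j)), map_smul, sm_sm (temperate_field α j) hη,
    sm_sm hη (temperate_field α j)]
  have h3 : (fun x : Rn n => field α j x * eta ε x) = fun x => eta ε x * field α j x := by
    ext x; ring
  rw [h3]
  module

/-- Two points of the graph of `𝒜` lie over `ηR k`. One arises by approximating `k` from the core of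
`H`, the other by applying the cutoff to an approximation of `R k` in the graph norm of `𝒜`.
Single-valuedness identifies them, so no simultaneous approximation in both graph norms is needed.
-/
theorem cutConj_eq (h : EssSelfAdjoint (emb n) (schr w)) (hα₀ : 0 ≤ α) (hα : α ≤ 2)
    (hw : IsPotential α c w) {ε : ℝ} (hε : 0 < ε) (hε1 : ε ≤ 1) {k : L2 n}
    (hk : res w k ∈ (conjugateOp n α).domain) :
    cutConj w α ε k = rmul (eta ε) (conjugateOp n α ⟨_, hk⟩) -
      (2 * Complex.I) • rmul (cutField α ε) (res w k) := by
  have hb := isBddMeas_eta (n := n) hε.le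
  have hη := temperate_eta (n := n) hε.le
  have h1 : (rmul (eta ε) (res w k), cutConj w α ε k) ∈ (conjugateOp n α).graph := by
    rw [conjugateOp_graph]
    refine DenseRange.induction_on (p := fun k => (rmul (eta ε) (res w k), cutConj w α ε k) ∈
      (LinearMap.range ((emb n).prod (emb n ∘ₗ conjS n α))).topologicalClosure) h.plus k
      ((Submodule.isClosed_topologicalClosure _).preimage (by fun_prop)) fun f => ?_
    refine Submodule.le_topologicalClosure _ ⟨sm (eta ε) f, ?_⟩
    rw [cutConj, relOp_apply h (relBdd_conjS_eta h hα₀ hα hw hε hε1), res_apply h,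
      rmul_emb hb hη]
    rfl
  have h2 : (rmul (eta ε) (res w k), rmul (eta ε) (conjugateOp n α ⟨_, hk⟩) -
      (2 * Complex.I) • rmul (cutField α ε) (res w k)) ∈ (conjugateOp n α).graph := by
    have h3 := (conjugateOp n α).mem_graph ⟨_, hk⟩
    rw [conjugateOp_graph] at h3 ⊢
    refine map_mem_closure (f := fun q : L2 n × L2 n => (rmul (eta ε) q.1,
      rmul (eta ε) q.2 - (2 * Complex.I) • rmul (cutField α ε) q.1))
      (t := (LinearMap.range ((emb n).prod (emb n ∘ₗ conjS n α)) : Submodule ℂ _))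
      (by fun_prop) h3 ?_
    rintro _ ⟨f, rfl⟩
    refine ⟨sm (eta ε) f, Prod.ext (rmul_emb hb hη f).symm ?_⟩
    change emb n (conjS n α (sm (eta ε) f)) = rmul (eta ε) (emb n (conjS n α f)) -
      (2 * Complex.I) • rmul (cutField α ε) (emb n f)
    rw [rmul_emb hb hη, rmul_emb (isBddMeas_cutField hα₀ hε.le) (temperate_cutField α hε.le),
      conjS_sm_eta hε.le, map_sub, map_smul]
  exact (conjugateOp n α).mem_graph_snd_inj h1 h2 rfl

theorem tendsto_rmul_cutField (hα₀ : 0 ≤ α) (u : L2 n) :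
    Filter.Tendsto (fun m : ℕ => rmul (cutField α (1 / ((m : ℝ) + 1))) u) Filter.atTop
      (nhds 0) := by
  have hpos : ∀ k : ℕ, 0 ≤ 1 / ((k : ℝ) + 1) := fun k => by positivity
  refine tendsto_bmul_zero (fun m => isBddMeas_cutField hα₀ (hpos m)) (C := 2) (fun m x => ?_)
    (fun x => ?_) u
  · rw [Complex.norm_real]
    exact abs_cutField_le hα₀ (hpos m) x
  · have h3 := tendsto_one_div_add_atTop_nhds_zero_nat (𝕜 := ℝ)
    have h4 : Continuous fun e : ℝ => japPow (-α) x * (2 * e * ‖x‖ ^ 2) := by fun_prop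
    have h5 := (h4.tendsto 0).comp h3
    simp only [mul_zero, zero_mul] at h5
    have h6 : Filter.Tendsto (fun m : ℕ => cutField α (1 / ((m : ℝ) + 1)) x) Filter.atTop
        (nhds 0) := by
      refine squeeze_zero_norm (fun m => ?_) h5
      have e2 : eta (1 / ((m : ℝ) + 1)) x ^ 2 ≤ 1 :=
        pow_le_one₀ (eta_pos (hpos m) x).le (eta_le_one (hpos m) x)
      have e3 := hpos m
      rw [Function.comp_apply, cutField, Real.norm_eq_abs, abs_mul, abs_of_pos (japPow_pos _ x),
        show ∀ e t : ℝ, -2 * e * t = -(2 * e * t) from fun e t => by ring, abs_neg,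
        abs_of_nonneg (by positivity)]
      refine mul_le_mul_of_nonneg_left ?_ (japPow_pos _ x).le
      refine mul_le_mul_of_nonneg_left ?_ (by positivity)
      exact mul_le_of_le_one_right (by positivity) e2
    have h7 := (Complex.continuous_ofReal.tendsto _).comp h6
    rw [Complex.ofReal_zero] at h7
    exact h7

theorem tendsto_cutConj (h : EssSelfAdjoint (emb n) (schr w)) (hα₀ : 0 ≤ α) (hα : α ≤ 2)
    (hw : IsPotential α c w) {k : L2 n} (hk : res w k ∈ (conjugateOp n α).domain) :
    Filter.Tendsto (fun m : ℕ => cutConj w α (1 / ((m : ℝ) + 1)) k) Filter.atTop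
      (nhds (conjugateOp n α ⟨_, hk⟩)) := by
  have h1 := (tendsto_rmul_eta (conjugateOp n α ⟨_, hk⟩)).sub
    ((tendsto_rmul_cutField hα₀ (res w k)).const_smul (2 * Complex.I))
  rw [smul_zero, sub_zero] at h1
  refine h1.congr fun m => ?_
  have he1 : 1 / ((m : ℝ) + 1) ≤ 1 := by
    rw [div_le_one (by positivity)]
    have : (0 : ℝ) ≤ m := Nat.cast_nonneg m
    linarith
  exact (cutConj_eq h hα₀ hα hw (by positivity) he1 hk).symm

/-- The commutator form is given by the bounded operator `commOp` between resolvents. -/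
theorem inner_commOp_eq (h : EssSelfAdjoint (emb n) (schr w)) (hα₀ : 0 ≤ α) (hα : α < 2)
    (hw : IsPotential α c w) (hY : IsFieldDeriv α w Y D C)
    (hYb : IsBddMeas fun x => ((Y x : ℝ) : ℂ)) {k l : L2 n}
    (hk : res w k ∈ (conjugateOp n α).domain) (hl : res w l ∈ (conjugateOp n α).domain) :
    inner ℂ k (commOp w α Y l) = Complex.I *
      (inner ℂ (k - Complex.I • res w k) (conjugateOp n α ⟨_, hl⟩) -
        inner ℂ (conjugateOp n α ⟨_, hk⟩) (l - Complex.I • res w l)) := by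
  have tN := fun k => tendsto_cutRes h hα₀ hα hw k
  have tR := fun k => (tendsto_rmul_eta (res w k)).const_smul Complex.I
  have h1 := (tN k).inner (𝕜 := ℂ) (((commOp w α Y).continuous.tendsto l).comp (tN l))
  have h2 := ((((tN k).sub (tR k)).inner (𝕜 := ℂ) (tendsto_cutConj h hα₀ hα.le hw hl)).sub
    ((tendsto_cutConj h hα₀ hα.le hw hk).inner (𝕜 := ℂ) ((tN l).sub (tR l)))).const_mul Complex.I
  refine tendsto_nhds_unique h1 (h2.congr fun m => ?_)
  have he1 : 1 / ((m : ℝ) + 1) ≤ 1 := by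
    rw [div_le_one (by positivity)]
    have : (0 : ℝ) ≤ m := Nat.cast_nonneg m
    linarith
  exact (inner_cutRes_commOp h hα₀ hα.le hw hY hYb (by positivity) he1 k l).symm

theorem commForm_eq (h : EssSelfAdjoint (emb n) (schr w)) (hα₀ : 0 ≤ α) (hα : α < 2)
    (hw : IsPotential α c w) (hY : IsFieldDeriv α w Y D C)
    (hYb : IsBddMeas fun x => ((Y x : ℝ) : ℂ)) {H : L2 n →ₗ.[ℂ] L2 n}
    (hH : H.graph = (LinearMap.range ((emb n).prod (schr w))).topologicalClosure) {k l : L2 n}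
    (hk : res w k ∈ H.domain ⊓ (conjugateOp n α).domain)
    (hl : res w l ∈ H.domain ⊓ (conjugateOp n α).domain) :
    commForm H (conjugateOp n α) ⟨_, hk⟩ ⟨_, hl⟩ = inner ℂ k (commOp w α Y l) := by
  rw [inner_commOp_eq h hα₀ hα hw hY hYb hk.2 hl.2, commForm]
  have e1 := h.apply_resolvent hH k hk.1
  have e2 := h.apply_resolvent hH l hl.1
  change Complex.I * (inner ℂ (H ⟨coreResolvent (emb n) (schr w) Complex.I k, _⟩) _ -
    inner ℂ _ (H ⟨coreResolvent (emb n) (schr w) Complex.I l, _⟩)) = _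
  rw [e1, e2]
  rfl

end CommutatorForm

end

end MourreRepulsive


namespace MourreRepulsive

noncomputable section

/-! ### Compact operators -/

section Adjoint

variable {E : Type*} [NormedAddCommGroup E] [InnerProductSpace ℂ E] [CompleteSpace E]

/-- A finite net for the image of the unit ball under `S` pulls back to a net for its image under
`T`. It is used for adjoints and for halving decay exponents. -/
theorem isCompactOperator_of_norm_sq_le {T S : E →L[ℂ] E} (hS : IsCompactOperator S) {C : ℝ}
    (hT : ∀ x, ‖T x‖ ^ 2 ≤ C * ‖x‖ * ‖S x‖) : IsCompactOperator T := by
  refine (isCompactOperator_iff_isCompact_closure_image_closedBall (T : E →ₗ[ℂ] E)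
    zero_lt_one).2 ?_
  have hC : ∀ x, ‖T x‖ ^ 2 ≤ max C 0 * ‖x‖ * ‖S x‖ := fun x => (hT x).trans (by
    gcongr
    exact le_max_left _ _)
  set D := max C 0
  have hD0 : 0 ≤ D := le_max_right _ _
  refine TotallyBounded.isCompact_of_isClosed (TotallyBounded.closure ?_) isClosed_closure
  have hS' : TotallyBounded (S '' Metric.closedBall 0 1) :=
    (hS.isCompact_closure_image_closedBall (f := (S : E →ₗ[ℂ] E)) 1).totallyBounded.subset
      subset_closure
  rw [Metric.totallyBounded_iff]
  intro ε hε
  -- Points of the unit ball differ by at most `2`, so this mesh gives `‖T(x - g y)‖² ≤ ε² D/(D+1) <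
  -- ε²`; the added one also covers `D = 0`.
  obtain ⟨t, hts, ht, hcov⟩ := Metric.finite_approx_of_totallyBounded hS'
    (ε ^ 2 / (2 * (D + 1))) (by positivity)
  choose! g hg using fun y (hy : y ∈ t) => hts hy
  refine ⟨(fun y => T (g y)) '' t, ht.image _, ?_⟩
  rintro _ ⟨x, hx, rfl⟩
  obtain ⟨y, hy, hxy⟩ := Set.mem_iUnion₂.1 (hcov ⟨x, hx, rfl⟩)
  refine Set.mem_iUnion₂.2 ⟨_, ⟨y, hy, rfl⟩, ?_⟩
  have h1 : ‖x - g y‖ ≤ 2 := by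
    have h2 := (hg y hy).1
    rw [mem_closedBall_zero_iff] at hx h2
    linarith [norm_sub_le x (g y)]
  have h2 : ‖S (x - g y)‖ < ε ^ 2 / (2 * (D + 1)) := by
    rw [map_sub, (hg y hy).2, ← dist_eq_norm]
    exact hxy
  have h3 : ‖T (x - g y)‖ ^ 2 < ε ^ 2 := by
    calc _ ≤ D * 2 * (ε ^ 2 / (2 * (D + 1))) := (hC _).trans (by gcongr)
      _ = ε ^ 2 * (D / (D + 1)) := by field_simp
      _ < ε ^ 2 * 1 := by
        gcongr
        rw [div_lt_one (by positivity)]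
        linarith
      _ = ε ^ 2 := mul_one _
  rw [Metric.mem_ball, dist_eq_norm]
  change ‖T x - T (g y)‖ < ε
  rw [← map_sub]
  exact lt_of_pow_lt_pow_left₀ 2 hε.le h3

/-- Since `‖T*x‖² = ⟨x, T T*x⟩ ≤ ‖x‖ ‖T T*x‖`, compactness passes from `T T*` to `T*`. -/
theorem isCompactOperator_adjoint {T : E →L[ℂ] E} (hT : IsCompactOperator T) :
    IsCompactOperator (ContinuousLinearMap.adjoint T) := by
  refine isCompactOperator_of_norm_sq_le (S := T * ContinuousLinearMap.adjoint T) (C := 1)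
    (hT.comp_clm (ContinuousLinearMap.adjoint T)) fun x => ?_
  rw [← inner_self_eq_norm_sq (𝕜 := ℂ), ContinuousLinearMap.adjoint_inner_left, one_mul]
  exact (RCLike.re_le_norm _).trans (norm_inner_le_norm _ _)

end Adjoint

/-! ### Compactness of operators with square integrable kernels -/

section Kernel

variable {n : ℕ} {E : Type*} [NormedAddCommGroup E] [NormedSpace ℂ E]

/-- The operator `h ↦ (ξ ↦ κ ξ h)` for a square integrable family of functionals. -/
def kerOp : Lp (E →L[ℂ] ℂ) 2 (volume : Measure (Rn n)) →L[ℂ] E →L[ℂ] L2 n :=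
  LinearMap.mkContinuous₂
    (LinearMap.mk₂ ℂ (fun κ h => (ContinuousLinearMap.apply ℂ ℂ h).compLp κ)
      (fun κ κ' h => map_add (ContinuousLinearMap.compLpₗ 2 volume
        (ContinuousLinearMap.apply ℂ ℂ h)) κ κ')
      (fun c κ h => map_smul (ContinuousLinearMap.compLpₗ 2 volume
        (ContinuousLinearMap.apply ℂ ℂ h)) c κ)
      (fun κ h h' => by rw [map_add, ContinuousLinearMap.add_compLp])
      (fun c κ h => by rw [map_smul, ContinuousLinearMap.smul_compLp])) 1
    (fun κ h => by
      rw [one_mul, mul_comm]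
      refine (ContinuousLinearMap.norm_compLp_le _ _).trans ?_
      gcongr
      refine ContinuousLinearMap.opNorm_le_bound _ (norm_nonneg _) fun L => ?_
      rw [mul_comm]
      exact L.le_opNorm h)

theorem kerOp_coe (κ : Lp (E →L[ℂ] ℂ) 2 (volume : Measure (Rn n))) (h : E) :
    kerOp κ h =ᵐ[volume] fun ξ => κ ξ h :=
  ContinuousLinearMap.coeFn_compLp _ κ

/-- Indicators give operators of rank at most one, and compactness is preserved under sums and under
norm limits, along which the operator depends continuously on its kernel. -/
theorem isCompactOperator_kerOp (κ : Lp (E →L[ℂ] ℂ) 2 (volume : Measure (Rn n))) :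
    IsCompactOperator (kerOp κ) := by
  refine Lp.induction (by simp) (fun κ => IsCompactOperator (kerOp κ)) ?_ ?_ ?_ κ
  · intro c s hs hμ
    have e : kerOp ((Lp.simpleFunc.indicatorConst 2 hs hμ.ne c :
        Lp.simpleFunc (E →L[ℂ] ℂ) 2 (volume : Measure (Rn n))) :
          Lp (E →L[ℂ] ℂ) 2 (volume : Measure (Rn n))) =
        (ContinuousLinearMap.toSpanSingleton ℂ
          (indicatorConstLp 2 hs hμ.ne (1 : ℂ) : L2 n)).comp c := by
      ext1 h
      refine Lp.ext ((kerOp_coe _ h).trans ?_)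
      rw [Lp.simpleFunc.coe_indicatorConst]
      change _ =ᵐ[volume] ((c h • indicatorConstLp 2 hs hμ.ne (1 : ℂ) : L2 n) : Rn n → ℂ)
      filter_upwards [indicatorConstLp_coeFn (p := 2) (hs := hs) (hμs := hμ.ne) (c := c),
        indicatorConstLp_coeFn (p := 2) (hs := hs) (hμs := hμ.ne) (c := (1 : ℂ)),
        Lp.coeFn_smul (c h) (indicatorConstLp 2 hs hμ.ne (1 : ℂ) : L2 n)] with x h1 h2 h3
      rw [h1, h3, Pi.smul_apply, h2]
      by_cases hx : x ∈ s <;> simp [hx]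
    rw [e]
    exact (isCompactOperator_of_locallyCompactSpace_rng
      (ContinuousLinearMap.toSpanSingleton ℂ
      (indicatorConstLp 2 hs hμ.ne (1 : ℂ) : L2 n))).comp_clm c
  · intro f g hf hg _ h1 h2
    rw [map_add]
    exact h1.add h2
  · exact isClosed_setOfPred_isCompactOperator.preimage kerOp.continuous

end Kernel

end

end MourreRepulsive


namespace MourreRepulsive

noncomputable section

/-! ### Compactness of frequency cutoffs -/

section Cutoff

open FourierTransform

variable {n : ℕ}

/-- The plane wave with frequency `ξ`. -/
def planeWave (ξ x : Rn n) : ℂ := Complex.exp ((2 * Real.pi * inner ℝ x ξ : ℝ) * Complex.I)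

theorem norm_planeWave (ξ x : Rn n) : ‖planeWave ξ x‖ = 1 := Complex.norm_exp_ofReal_mul_I _

theorem continuous_planeWave : Continuous fun q : Rn n × Rn n => planeWave q.1 q.2 := by
  unfold planeWave
  fun_prop

theorem isBddMeas_planeWave (ξ : Rn n) : IsBddMeas (planeWave ξ) :=
  ⟨(continuous_planeWave.comp (Continuous.prodMk_right ξ)).aestronglyMeasurable, 1,
    fun x => (norm_planeWave ξ x).le⟩

theorem continuous_bmul_planeWave (G : L2 n) : Continuous fun ξ => bmul (planeWave ξ) G := by
  rw [continuous_iff_seqContinuous]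
  intro s ξ hs
  have hb : ∀ k, IsBddMeas fun x => planeWave (s k) x - planeWave ξ x := fun k =>
    ⟨(isBddMeas_planeWave (s k)).1.sub (isBddMeas_planeWave ξ).1, 2, fun x =>
      (norm_sub_le _ _).trans (by rw [norm_planeWave, norm_planeWave]; norm_num)⟩
  have h1 := tendsto_bmul_zero hb (C := 2) (fun k x =>
      (norm_sub_le _ _).trans (by rw [norm_planeWave, norm_planeWave]; norm_num)) (fun x => by
    have h2 : Filter.Tendsto (fun k => planeWave (s k) x) Filter.atTop (nhds (planeWave ξ x)) :=
      ((continuous_planeWave.comp (Continuous.prodMk_left x)).tendsto ξ).comp hs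
    simpa using h2.sub_const (planeWave ξ x)) G
  have h2 : ∀ k, bmul (planeWave (s k)) G =
      bmul (fun x => planeWave (s k) x - planeWave ξ x) G + bmul (planeWave ξ) G := fun k => by
    have := bmul_add (hb k) (isBddMeas_planeWave ξ)
    simp only [sub_add_cancel] at this
    exact congrArg (fun A : L2 n →L[ℂ] L2 n => A G) this
  have h3 := h1.add_const (bmul (planeWave ξ) G)
  rw [zero_add] at h3
  exact h3.congr fun k => (h2 k).symm

/-- The integral kernel of `u ↦ 𝓕 (G u)`, cut off to frequencies of size at most `Λ`. -/
def fourierKernel (G : L2 n) (Λ : ℝ) : Rn n → L2 n →L[ℂ] ℂ :=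
  (Metric.closedBall 0 Λ).indicator fun ξ => innerSL ℂ (bmul (planeWave ξ) G)

/-- Plane waves have modulus one, so the functionals are bounded by `‖G‖`; restricting to a ball of
frequencies makes this square integrable. -/
theorem memLp_fourierKernel (G : L2 n) (Λ : ℝ) : MemLp (fourierKernel G Λ) 2 volume := by
  refine (memLp_indicator_iff_restrict (f := fun ξ => innerSL ℂ (bmul (planeWave ξ) G))
    measurableSet_closedBall).2 ?_
  have : IsFiniteMeasure ((volume : Measure (Rn n)).restrict (Metric.closedBall 0 Λ)) :=
    ⟨by simpa using measure_closedBall_lt_top⟩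
  refine MemLp.of_bound ((innerSL ℂ).continuous.comp
    (continuous_bmul_planeWave G)).aestronglyMeasurable ‖G‖ (Filter.Eventually.of_forall fun ξ => ?_)
  rw [innerSL_apply_norm]
  simpa using norm_bmul_apply_le (isBddMeas_planeWave ξ) (C := 1)
    (fun x => (norm_planeWave ξ x).le) G

/-- The indicator function of the ball of radius `Λ`. -/
def ballInd (Λ : ℝ) : Rn n → ℂ := (Metric.closedBall 0 Λ).indicator fun _ => 1

theorem norm_ballInd_le (Λ : ℝ) (x : Rn n) : ‖ballInd Λ x‖ ≤ 1 := by
  unfold ballInd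
  by_cases hx : x ∈ Metric.closedBall (0 : Rn n) Λ <;> simp [hx]

theorem isBddMeas_ballInd (Λ : ℝ) : IsBddMeas (ballInd Λ : Rn n → ℂ) :=
  ⟨(aestronglyMeasurable_const.indicator measurableSet_closedBall), 1, norm_ballInd_le Λ⟩

/-- The Fourier transform on `L²`. -/
def fourierL2 (n : ℕ) : L2 n →L[ℂ] L2 n :=
  (Lp.fourierTransformₗᵢ (Rn n) ℂ).toLinearIsometry.toContinuousLinearMap

theorem fourierL2_emb (f : 𝓢(Rn n, ℂ)) : fourierL2 n (emb n f) = emb n (𝓕 f) :=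
  SchwartzMap.toLp_fourier_eq f

theorem fourierKernel_emb {g : Rn n → ℝ} (hg : g.HasTemperateGrowth) {G : L2 n}
    (hG : G =ᵐ[volume] fun x => ((g x : ℝ) : ℂ)) (Λ : ℝ) (f : 𝓢(Rn n, ℂ)) (ξ : Rn n) :
    fourierKernel G Λ ξ (emb n f) = ballInd Λ ξ * 𝓕 (sm g f) ξ := by
  unfold ballInd fourierKernel
  by_cases hξ : ξ ∈ Metric.closedBall (0 : Rn n) Λ
  · rw [Set.indicator_of_mem hξ, Set.indicator_of_mem hξ, one_mul, innerSL_apply_apply,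
      SchwartzMap.fourier_coe, Real.fourier_eq', L2.inner_def]
    refine integral_congr_ae ?_
    filter_upwards [bmul_coe (isBddMeas_planeWave ξ) G, hG, emb_coe f] with x e1 e2 e3
    rw [e1, e2, e3, sm_apply hg, RCLike.inner_apply, map_mul, Complex.conj_ofReal, planeWave,
      ← Complex.exp_conj, smul_eq_mul, map_mul, Complex.conj_ofReal, Complex.conj_I]
    push_cast
    ring_nf
  · rw [Set.indicator_of_notMem hξ, Set.indicator_of_notMem hξ, zero_mul]
    rfl

theorem ballInd_fourier_emb_eq_kerOp {g : Rn n → ℝ} (hg : g.HasTemperateGrowth) {G : L2 n}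
    (hG : G =ᵐ[volume] fun x => ((g x : ℝ) : ℂ)) {Λ : ℝ}
    {κ : Lp (L2 n →L[ℂ] ℂ) 2 (volume : Measure (Rn n))} (hκ : κ =ᵐ[volume] fourierKernel G Λ)
    (f : 𝓢(Rn n, ℂ)) : bmul (ballInd Λ) (emb n (𝓕 (sm g f))) = kerOp κ (emb n f) := by
  refine Lp.ext ?_
  have e1 := bmul_coe (isBddMeas_ballInd Λ) (emb n (𝓕 (sm g f)))
  have e2 := emb_coe (𝓕 (sm g f))
  have e3 := kerOp_coe κ (emb n f)
  filter_upwards [e1, e2, e3, hκ] with ξ h1 h2 h3 h4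
  exact h1.trans ((congrArg (ballInd Λ ξ * ·) h2).trans ((fourierKernel_emb hg hG Λ f ξ).symm.trans
    ((congrArg (fun L : L2 n →L[ℂ] ℂ => L (emb n f)) h4).symm.trans h3.symm)))

theorem eq_of_emb_eq {A B : L2 n →L[ℂ] L2 n} (h : ∀ f, A (emb n f) = B (emb n f)) : A = B :=
  ContinuousLinearMap.ext fun u =>
    congrFun (DenseRange.equalizer denseRange_emb A.continuous B.continuous (funext h)) u

theorem ballInd_fourier_eq_kerOp {g : Rn n → ℝ} (hg : g.HasTemperateGrowth) {C : ℝ}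
    (hC : ∀ x, |g x| ≤ C) {G : L2 n} (hG : G =ᵐ[volume] fun x => ((g x : ℝ) : ℂ)) {Λ : ℝ}
    {κ : Lp (L2 n →L[ℂ] ℂ) 2 (volume : Measure (Rn n))} (hκ : κ =ᵐ[volume] fourierKernel G Λ) :
    bmul (ballInd Λ) * (fourierL2 n * rmul g) = kerOp κ := by
  refine eq_of_emb_eq fun f => ?_
  have e0 : fourierL2 n (rmul g (emb n f)) = emb n (𝓕 (sm g f)) :=
    (congrArg (fourierL2 n) (rmul_emb (isBddMeas_temperate hg hC) hg f)).trans (fourierL2_emb _)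
  exact (congrArg (bmul (ballInd Λ)) e0).trans (ballInd_fourier_emb_eq_kerOp hg hG hκ f)

/-- By Plancherel `p²` is multiplication by `(2π|ξ|)²`, which is at least `(2πΛ)²` on the discarded
frequencies. -/
theorem norm_sub_ballInd_fourier_le (f : 𝓢(Rn n, ℂ)) {Λ : ℝ} (hΛ : 0 < Λ) :
    ‖fourierL2 n (emb n f) - bmul (ballInd Λ) (fourierL2 n (emb n f))‖ ≤
      (2 * Real.pi * Λ) ⁻¹ ^ 2 * ‖emb n (momentumSq n f)‖ := by
  have hn : ‖emb n (momentumSq n f)‖ = ‖emb n (𝓕 (momentumSq n f))‖ := by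
    rw [← fourierL2_emb]
    exact ((Lp.fourierTransformₗᵢ (Rn n) ℂ).norm_map _).symm
  rw [hn, fourierL2_emb]
  refine norm_le_of_ae ?_
  have h𝓕 : ∀ ξ, 𝓕 (momentumSq n f) ξ = (((2 * Real.pi) ^ 2 * ‖ξ‖ ^ 2 : ℝ) : ℂ) * 𝓕 f ξ := by
    intro ξ
    have hS : (fun ξ : Rn n => ‖ξ‖ ^ 2).HasTemperateGrowth := by fun_prop
    rw [momentumSq_eq_fourierMultiplier, SchwartzMap.fourierMultiplierCLM_apply,
      FourierTransform.fourier_smul, FourierTransform.fourier_fourierInv_eq, smul_apply,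
      SchwartzMap.smulLeftCLM_apply_apply hS, smul_smul, Complex.real_smul]
  filter_upwards [emb_coe (𝓕 f), emb_coe (𝓕 (momentumSq n f)),
    Lp.coeFn_sub (emb n (𝓕 f)) (bmul (ballInd Λ) (emb n (𝓕 f))),
    bmul_coe (isBddMeas_ballInd Λ) (emb n (𝓕 f))] with ξ h1 h2 h3 h4
  rw [h3, h2, Pi.sub_apply, h4, h1, h𝓕]
  by_cases hξ : ξ ∈ Metric.closedBall (0 : Rn n) Λ
  · rw [ballInd, Set.indicator_of_mem hξ, one_mul, sub_self, norm_zero]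
    positivity
  · rw [ballInd, Set.indicator_of_notMem hξ, zero_mul, sub_zero, norm_mul, Complex.norm_real,
      ← mul_assoc]
    have h5 : Λ < ‖ξ‖ := by simpa using hξ
    refine le_mul_of_one_le_left (norm_nonneg _) ?_
    rw [Real.norm_of_nonneg (by positivity), ← mul_pow, ← mul_pow]
    refine one_le_pow₀ ?_
    rw [inv_mul_eq_div, one_le_div (by positivity)]
    gcongr

end Cutoff

end

end MourreRepulsive


namespace MourreRepulsive

noncomputable section

/-! ### Compactness of decaying multipliers times the resolvent -/

section Decay

variable {n : ℕ} {α c : ℝ} {w : Rn n → ℝ}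

/-- The derivative `∂_j ⟨x⟩ ^ s`. -/
def japD (s : ℝ) (j : Fin n) (x : Rn n) : ℝ := s * (x j * japPow (s - 2) x)

/-- The second derivative `∂_j² ⟨x⟩ ^ s`. -/
def japDD (s : ℝ) (j : Fin n) (x : Rn n) : ℝ :=
  s * (japPow (s - 2) x + x j * japD (s - 2) j x)

theorem isMultiplier_japPow (s : ℝ) : IsMultiplier (japPow s : Rn n → ℝ) (japD s) (japDD s) where
  temperate := temperate_japPow s
  temperate₁ j := temperate_const_mul s ((temperate_coord j).mul (temperate_japPow (s - 2)))
  temperate₂ j := temperate_const_mul s ((temperate_japPow (s - 2)).add ((temperate_coord j).mul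
    (temperate_const_mul (s - 2) ((temperate_coord j).mul (temperate_japPow (s - 2 - 2))))))
  deriv j x := hasLineDerivAt_japPow s x j
  deriv₂ j x := by
    refine HasDerivAt.congr_deriv (HasLineDerivAt.real_const_mul s
      (HasLineDerivAt.real_mul (hasLineDerivAt_coord x j j) (hasLineDerivAt_japPow (s - 2) x j))) ?_
    simp [japDD, japD]

theorem abs_japD_le (s : ℝ) (j : Fin n) (x : Rn n) : |japD s j x| ≤ |s| * japPow (s - 1) x := by
  rw [japD, abs_mul, abs_mul, abs_of_pos (japPow_pos (s - 2) x)]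
  refine mul_le_mul_of_nonneg_left ?_ (abs_nonneg s)
  exact (abs_coord_mul_japPow_le (s - 2) x j).trans_eq (by congr 1; ring)

theorem abs_japDD_le {s : ℝ} (hs : s ≤ 2) (j : Fin n) (x : Rn n) :
    |japDD s j x| ≤ |s| * (1 + |s - 2|) := by
  rw [japDD, abs_mul]
  refine mul_le_mul_of_nonneg_left ((abs_add_le _ _).trans (add_le_add ?_ ?_)) (abs_nonneg s)
  · rw [abs_of_pos (japPow_pos _ x)]
    exact japPow_le_one (by linarith) x
  · rw [abs_mul]
    calc _ ≤ |x j| * (|s - 2| * japPow (s - 2 - 1) x) := by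
          gcongr
          exact abs_japD_le _ j x
      _ = |s - 2| * (|x j| * japPow (s - 2 - 1) x) := by ring
      _ ≤ |s - 2| * 1 := by
          gcongr
          exact (abs_coord_mul_japPow_le _ x j).trans (japPow_le_one (by linarith) x)
      _ = _ := mul_one _

theorem norm_bmul_le_one_of_japPow {s : ℝ} (hs : s ≤ 0) (u : L2 n) :
    ‖rmul (japPow s) u‖ ≤ ‖u‖ := by
  simpa using norm_bmul_apply_le (isBddMeas_japPow hs) (C := 1) (fun x => by
    rw [Complex.norm_real, Real.norm_of_nonneg (japPow_pos s x).le]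
    exact japPow_le_one hs x) u

/-- The kinetic energy after localization in space is bounded relative to `p² + w`. -/
theorem exists_norm_kin_japPow_le (h : EssSelfAdjoint (emb n) (schr w)) (hα₀ : 0 ≤ α) (hα : α ≤ 2)
    (hw : IsPotential α c w) {t : ℝ} (ht : 2 ≤ t) :
    ∃ C, ∀ f, ‖emb n (momentumSq n (sm (japPow (-t)) f))‖ ≤
      C * ‖shift (emb n) (schr w) Complex.I f‖ := by
  have hb : IsBddMeas fun x : Rn n => ((japPow (-t) x : ℝ) : ℂ) := isBddMeas_japPow (by linarith)
  have hk := norm_kinComm_le_shift h hα₀ hα hw (isMultiplier_japPow (-t)) (κ₁ := |-t|)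
    (κ₂ := |-t| * (1 + |-t - 2|)) (fun j x => (abs_japD_le _ j x).trans (by
      gcongr
      exact japPow_le_japPow (by linarith) x)) (fun j x => abs_japDD_le (by linarith) j x)
  refine ⟨1 + n * (2 * |-t| * (c + n + 2) + |-t| * (1 + |-t - 2|)) + c, fun f => ?_⟩
  have e : emb n (momentumSq n (sm (japPow (-t)) f)) = rmul (japPow (-t)) (schr w f) +
      (emb n ∘ₗ kinComm (japD (-t)) (japDD (-t))) f -
      pot w (sm (japPow (-t)) f) := by
    rw [LinearMap.comp_apply, ← (isMultiplier_japPow (-t)).schr_sm hα hw hb, schr_apply]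
    abel
  have h1 : ‖rmul (japPow (-t)) (schr w f)‖ ≤ ‖shift (emb n) (schr w) Complex.I f‖ :=
    (norm_bmul_le_one_of_japPow (by linarith) _).trans (by simpa using h.norm_apply_le_plus f)
  -- The assumption `t ≥ 2 ≥ α` lets the spatial decay absorb the potential.
  have h2 : ‖pot w (sm (japPow (-t)) f)‖ ≤ c * ‖shift (emb n) (schr w) Complex.I f‖ := by
    have h3 : ‖pot w (sm (japPow (-t)) f)‖ ≤ c * ‖emb n f‖ := by
      refine norm_le_of_ae ?_
      filter_upwards [pot_coe hα hw (sm (japPow (-t)) f), emb_coe f] with x e1 e2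
      rw [e1, e2, sm_apply (temperate_japPow _), ← mul_assoc, norm_mul, ← Complex.ofReal_mul,
        Complex.norm_real]
      exact mul_le_mul_of_nonneg_right (hw.bound_mul (by linarith) x) (norm_nonneg _)
    exact h3.trans (mul_le_mul_of_nonneg_left (by simpa using h.norm_le_plus f) hw.nonneg)
  rw [e, add_mul, add_mul, one_mul]
  exact (norm_sub_le _ _).trans (add_le_add ((norm_add_le _ _).trans (add_le_add h1 (hk f))) h2)

theorem norm_le_of_core (h : EssSelfAdjoint (emb n) (schr w)) {A : L2 n →L[ℂ] L2 n} {C : ℝ}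
    (hC : 0 ≤ C) (hA : ∀ f, ‖A (shift (emb n) (schr w) Complex.I f)‖ ≤
      C * ‖shift (emb n) (schr w) Complex.I f‖) : ‖A‖ ≤ C :=
  A.opNorm_le_bound hC fun k => DenseRange.induction_on (p := fun k => ‖A k‖ ≤ C * ‖k‖) h.plus k
    (isClosed_le A.continuous.norm (continuous_const.mul continuous_norm)) hA

theorem memLp_japPow {t : ℝ} (ht : n < 2 * t) :
    MemLp (fun x : Rn n => ((japPow (-t) x : ℝ) : ℂ)) 2 volume := by
  have hm : AEStronglyMeasurable (fun x : Rn n => ((japPow (-t) x : ℝ) : ℂ)) volume :=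
    (Complex.continuous_ofReal.comp (continuous_japPow (-t))).aestronglyMeasurable
  rw [memLp_two_iff_integrable_sq_norm hm]
  refine (integrable_rpow_neg_one_add_norm_sq (E := Rn n) (μ := volume) (r := 2 * t)
    (by simpa using ht)).congr (Filter.Eventually.of_forall fun x => ?_)
  beta_reduce
  rw [Complex.norm_real, Real.norm_of_nonneg (japPow_pos _ x).le, sq (japPow (-t) x), japPow_mul, japPow]
  congr 1
  ring

/-- For `2t > n` the weight is square integrable, so after the Fourier transform the part at low
frequencies has a square integrable kernel. High frequencies are small in norm because `p²⟨x⟩^(-t)R`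
is bounded. The operator is thus a norm limit of compact ones, up to a unitary factor. -/
theorem isCompactOperator_japPow_mul_res_of_lt (h : EssSelfAdjoint (emb n) (schr w)) (hα₀ : 0 ≤ α)
    (hα : α ≤ 2) (hw : IsPotential α c w) {t : ℝ} (ht : 2 ≤ t) (htn : n < 2 * t) :
    IsCompactOperator (rmul (japPow (-t)) * res w : L2 n →L[ℂ] L2 n) := by
  obtain ⟨C, hC⟩ := exists_norm_kin_japPow_le h hα₀ hα hw ht
  have hb : IsBddMeas fun x : Rn n => ((japPow (-t) x : ℝ) : ℂ) := isBddMeas_japPow (by linarith)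
  set T : L2 n →L[ℂ] L2 n := rmul (japPow (-t)) * res w with hT
  have hTf : ∀ f, T (shift (emb n) (schr w) Complex.I f) = emb n (sm (japPow (-t)) f) := fun f =>
    (congrArg (rmul (japPow (-t))) (res_apply h f)).trans (rmul_emb hb (temperate_japPow _) f)
  have hcomp : ∀ Λ : ℝ, IsCompactOperator
      (bmul (ballInd Λ) * (fourierL2 n * T) : L2 n →L[ℂ] L2 n) := fun Λ => by
    have hG := (memLp_japPow htn).coeFn_toLp
    have e : bmul (ballInd Λ) * (fourierL2 n * T) =
        (kerOp ((memLp_fourierKernel ((memLp_japPow htn).toLp _) Λ).toLp _)).comp (res w) := by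
      rw [← ballInd_fourier_eq_kerOp (temperate_japPow (-t)) (C := 1) (fun x => by
        rw [abs_of_pos (japPow_pos _ x)]
        exact japPow_le_one (by linarith) x) hG (memLp_fourierKernel _ Λ).coeFn_toLp]
      rfl
    rw [e]
    exact (isCompactOperator_kerOp (E := L2 n) _).comp_clm (res w : L2 n →L[ℂ] L2 n)
  have hlim : Filter.Tendsto (fun k : ℕ => bmul (ballInd (k + 1 : ℝ)) * (fourierL2 n * T))
      Filter.atTop (nhds (fourierL2 n * T)) := by
    rw [tendsto_iff_norm_sub_tendsto_zero]
    refine squeeze_zero (g := fun k : ℕ => (2 * Real.pi * (k + 1 : ℝ))⁻¹ ^ 2 * max C 0)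
      (fun _ => norm_nonneg _) (fun k => ?_) ?_
    · rw [norm_sub_rev]
      refine norm_le_of_core h (by positivity) fun f => ?_
      have h1 := norm_sub_ballInd_fourier_le (sm (japPow (-t)) f) (Λ := (k + 1 : ℝ))
        (by positivity)
      rw [← hTf] at h1
      refine h1.trans ?_
      rw [mul_assoc ((2 * Real.pi * (k + 1 : ℝ))⁻¹ ^ 2)]
      refine mul_le_mul_of_nonneg_left ((hC f).trans ?_) (by positivity)
      exact mul_le_mul_of_nonneg_right (le_max_left _ _) (norm_nonneg _)
    · have h1 : Filter.Tendsto (fun k : ℕ => (2 * Real.pi * (k + 1 : ℝ))⁻¹) Filter.atTop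
          (nhds 0) := by
        refine Filter.Tendsto.inv_tendsto_atTop (Filter.Tendsto.const_mul_atTop (by positivity) ?_)
        exact Filter.tendsto_atTop_add_const_right _ _ tendsto_natCast_atTop_atTop
      simpa using (h1.pow 2).mul_const (max C 0)
  have hU : IsCompactOperator (fourierL2 n * T : L2 n →L[ℂ] L2 n) :=
    isCompactOperator_of_tendsto hlim (Filter.Eventually.of_forall fun k => hcomp _)
  have := hU.continuous_comp (Lp.fourierTransformₗᵢ (Rn n) ℂ).symm.continuous
  have e : (Lp.fourierTransformₗᵢ (Rn n) ℂ).symm ∘ (fourierL2 n * T : L2 n →L[ℂ] L2 n) = T :=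
    funext fun u => (Lp.fourierTransformₗᵢ (Rn n) ℂ).symm_apply_apply (T u)
  rwa [e] at this

/-- From `‖⟨x⟩^(-t)R u‖² = ⟨R u, ⟨x⟩^(-2t)R u⟩`, compactness with exponent `2t` gives compactness
with exponent `t`. -/
theorem isCompactOperator_japPow_mul_res_of_two_mul {t : ℝ} (ht : 0 ≤ t)
    (hc : IsCompactOperator (rmul (japPow (-(2 * t))) * res w : L2 n →L[ℂ] L2 n)) :
    IsCompactOperator (rmul (japPow (-t)) * res w : L2 n →L[ℂ] L2 n) := by
  refine isCompactOperator_of_norm_sq_le hc (C := ‖(res w : L2 n →L[ℂ] L2 n)‖) fun x => ?_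
  have hb : IsBddMeas fun x : Rn n => ((japPow (-t) x : ℝ) : ℂ) := isBddMeas_japPow (by linarith)
  have e : rmul (japPow (-t)) (rmul (japPow (-t)) (res w x)) =
      rmul (japPow (-(2 * t))) (res w x) := by
    rw [bmul_bmul hb hb]
    congr 2
    ext y
    rw [← Complex.ofReal_mul, japPow_mul]
    congr 2
    ring
  change ‖rmul (japPow (-t)) (res w x)‖ ^ 2 ≤ _ * ‖x‖ * ‖rmul (japPow (-(2 * t))) (res w x)‖
  rw [← inner_self_eq_norm_sq (𝕜 := ℂ), inner_rmul hb, e]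
  refine (RCLike.re_le_norm _).trans ((norm_inner_le_norm _ _).trans ?_)
  exact mul_le_mul_of_nonneg_right ((res w).le_opNorm x) (norm_nonneg _)

theorem isCompactOperator_japPow_mul_res (h : EssSelfAdjoint (emb n) (schr w)) (hα₀ : 0 ≤ α)
    (hα : α ≤ 2) (hw : IsPotential α c w) {t : ℝ} (ht : 0 < t) :
    IsCompactOperator (rmul (japPow (-t)) * res w : L2 n →L[ℂ] L2 n) := by
  have key : ∀ k : ℕ, IsCompactOperator (rmul (japPow (-(2 ^ k * t))) * res w : L2 n →L[ℂ] L2 n) →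
      IsCompactOperator (rmul (japPow (-t)) * res w : L2 n →L[ℂ] L2 n) := by
    intro k
    induction k with
    | zero => simp
    | succ k ih =>
      intro hc
      refine ih (isCompactOperator_japPow_mul_res_of_two_mul (by positivity) ?_)
      rwa [← mul_assoc, ← pow_succ']
  -- Exceeding `2 + n` meets both requirements of the base case, `2 ≤ 2^k t` and `n < 2 · 2^k t`.
  obtain ⟨k, hk⟩ := pow_unbounded_of_one_lt ((2 + n) / t) (one_lt_two (α := ℝ))
  rw [div_lt_iff₀ ht] at hk
  have hn : (0 : ℝ) ≤ n := n.cast_nonneg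
  exact key k (isCompactOperator_japPow_mul_res_of_lt h hα₀ hα hw (by linarith) (by linarith))

theorem isCompactOperator_rmul_mul_res (h : EssSelfAdjoint (emb n) (schr w)) (hα₀ : 0 ≤ α)
    (hα : α ≤ 2) (hw : IsPotential α c w) {F : Rn n → ℝ}
    (hF : AEStronglyMeasurable F volume) {C t : ℝ} (ht : 0 < t)
    (hC : ∀ x, |F x| ≤ C * japPow (-t) x) :
    IsCompactOperator (rmul F * res w : L2 n →L[ℂ] L2 n) := by
  have hb : IsBddMeas fun x : Rn n => ((japPow (-t) x : ℝ) : ℂ) := isBddMeas_japPow (by linarith)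
  have hq : IsBddMeas fun x : Rn n => ((F x * japPow t x : ℝ) : ℂ) := by
    refine ⟨Complex.continuous_ofReal.comp_aestronglyMeasurable
      (hF.mul (continuous_japPow t).aestronglyMeasurable), C, fun x => ?_⟩
    rw [Complex.norm_real, Real.norm_eq_abs, abs_mul, abs_of_pos (japPow_pos t x)]
    calc _ ≤ C * japPow (-t) x * japPow t x :=
          mul_le_mul_of_nonneg_right (hC x) (japPow_pos t x).le
      _ = C := by rw [mul_assoc, japPow_mul, neg_add_cancel, japPow_zero, mul_one]
  have e : (rmul F * res w : L2 n →L[ℂ] L2 n) =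
      (rmul fun x => F x * japPow t x) * (rmul (japPow (-t)) * res w) := by
    ext1 u
    change rmul F (res w u) = _
    refine Eq.trans ?_ (bmul_bmul hq hb _).symm
    refine congrArg (fun k : Rn n → ℂ => bmul k (res w u)) (funext fun x => ?_)
    rw [← Complex.ofReal_mul, mul_assoc, japPow_mul, add_neg_cancel, japPow_zero, mul_one]
  rw [e]
  exact (isCompactOperator_japPow_mul_res h hα₀ hα hw ht).clm_comp _

end Decay

end

end MourreRepulsive


namespace MourreRepulsive

noncomputable section

/-! ### The Mourre estimate between resolvents -/

section CompactIdeal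

variable {E : Type*} [NormedAddCommGroup E] [InnerProductSpace ℂ E]

/-- Compactness of a bounded operator. -/
def Cpt (T : E →L[ℂ] E) : Prop := IsCompactOperator T

variable {S T : E →L[ℂ] E}

theorem Cpt.add (hS : Cpt S) (hT : Cpt T) : Cpt (S + T) := IsCompactOperator.add hS hT

theorem Cpt.sub (hS : Cpt S) (hT : Cpt T) : Cpt (S - T) := IsCompactOperator.sub hS hT

theorem Cpt.smul (hT : Cpt T) (z : ℂ) : Cpt (z • T) := IsCompactOperator.smul hT z

theorem Cpt.sum {ι : Type*} {s : Finset ι} {T : ι → E →L[ℂ] E} (hT : ∀ i ∈ s, Cpt (T i)) :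
    Cpt (∑ i ∈ s, T i) :=
  (compactOperator (RingHom.id ℂ) E E).sum_mem hT

theorem Cpt.mul_left (hT : Cpt T) (S : E →L[ℂ] E) : Cpt (S * T) := IsCompactOperator.clm_comp hT S

theorem Cpt.mul_right (hT : Cpt T) (S : E →L[ℂ] E) : Cpt (T * S) := IsCompactOperator.comp_clm hT S

theorem Cpt.adjoint [CompleteSpace E] (hT : Cpt T) : Cpt (ContinuousLinearMap.adjoint T) :=
  isCompactOperator_adjoint hT

end CompactIdeal

/-! ### The kinetic energy and the Jacobian modulo compact operators -/

section Estimate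

open ContinuousLinearMap (adjoint)

variable {n : ℕ} {α c : ℝ} {w : Rn n → ℝ}

/-- Continuous functions with `|F| ≤ C ⟨x⟩ ^ (-t)` for some `t > 0`. -/
def Decays (F : Rn n → ℝ) : Prop :=
  AEStronglyMeasurable F volume ∧ ∃ C t, 0 < t ∧ ∀ x, |F x| ≤ C * japPow (-t) x

theorem Decays.isBddMeas {F : Rn n → ℝ} (hF : Decays F) : IsBddMeas fun x => ((F x : ℝ) : ℂ) := by
  obtain ⟨hm, C, t, ht, hC⟩ := hF
  have hC0 : 0 ≤ C := nonneg_of_mul_nonneg_left ((abs_nonneg _).trans (hC 0)) (japPow_pos _ 0)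
  refine ⟨Complex.continuous_ofReal.comp_aestronglyMeasurable hm, C, fun x => ?_⟩
  rw [Complex.norm_real]
  refine (hC x).trans ?_
  exact mul_le_of_le_one_right hC0 (japPow_le_one (by linarith) x)

theorem Decays.cpt {F : Rn n → ℝ} (hF : Decays F) (h : EssSelfAdjoint (emb n) (schr w))
    (hα₀ : 0 ≤ α) (hα : α ≤ 2) (hw : IsPotential α c w) : Cpt (rmul F * res w) := by
  obtain ⟨hm, C, t, ht, hC⟩ := hF
  exact isCompactOperator_rmul_mul_res h hα₀ hα hw hm ht hC

theorem Decays.cpt_adjoint {F : Rn n → ℝ} (hF : Decays F) (h : EssSelfAdjoint (emb n) (schr w))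
    (hα₀ : 0 ≤ α) (hα : α ≤ 2) (hw : IsPotential α c w) (S : L2 n →L[ℂ] L2 n) :
    Cpt (adjoint (res w) * (rmul F * S)) := by
  have h1 : Cpt (star (rmul F * res w) * S) := (hF.cpt h hα₀ hα hw).adjoint.mul_right S
  rw [star_mul, (isSelfAdjoint_rmul hF.isBddMeas).star_eq, mul_assoc] at h1
  exact h1

theorem decays_of_continuous {F : Rn n → ℝ} (hF : Continuous F) {C t : ℝ} (ht : 0 < t)
    (hC : ∀ x, |F x| ≤ C * japPow (-t) x) : Decays F :=
  ⟨hF.aestronglyMeasurable, C, t, ht, hC⟩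

theorem decays_kinErr (hα₀ : 0 ≤ α) (j : Fin n) : Decays (kinErr α j : Rn n → ℝ) :=
  decays_of_continuous (continuous_of_temperate (temperate_kinErr α j)) (t := α / 2 + 1)
    (by positivity) fun x => (abs_kinErr_le hα₀ j x).trans_eq (by congr 2; ring)

theorem decays_divWeight (hα₀ : 0 ≤ α) (hα : α ≤ 2) (i : Fin n) :
    Decays (divWeight α i : Rn n → ℝ) :=
  decays_of_continuous (continuous_of_temperate (temperate_divWeight α i)) (t := 1) one_pos
    fun x => abs_divWeight_le hα₀ hα i x

theorem decays_japPow {s : ℝ} (hs : s < 0) : Decays (japPow s : Rn n → ℝ) :=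
  decays_of_continuous (continuous_japPow s) (C := 1) (t := -s) (by linarith) fun x => by
    rw [neg_neg, one_mul, abs_of_pos (japPow_pos s x)]

-- The operator form, between resolvents, of `p·⟨x⟩^(-α)p = ⟨x⟩^(-α)(H - w)` plus the derivative of
-- the weight. The factor `1 - iR` is `H R`.
set_option maxHeartbeats 1000000 in
theorem sum_momOp (h : EssSelfAdjoint (emb n) (schr w)) (hα₀ : 0 ≤ α) (hα : α ≤ 2)
    (hw : IsPotential α c w) :
    ∑ i, adjoint (momOp w α i) * momOp w α i =
      adjoint (res w) * (rmul (japPow (-α)) * (1 - Complex.I • res w)) -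
        adjoint (res w) * (rmul (fun x => w x * japPow (-α) x) * res w) -
        Complex.I • ∑ i, adjoint (res w) * (rmul (kinErr α i) * momOp w α i) := by
  have hJ : IsBddMeas fun x : Rn n => ((japPow (-α) x : ℝ) : ℂ) := isBddMeas_japPow (by linarith)
  have hwJ := hw.isBddMeas_mul (s := -α) (by linarith)
  refine ext_of_core h fun g => eq_of_denseRange_inner h.plus fun f => ?_
  set k := shift (emb n) (schr w) Complex.I f with hk
  have h1 : ∀ A B : L2 n →L[ℂ] L2 n, ∀ l, inner ℂ k ((adjoint A * B) l) =
      inner ℂ (A k) (B l) := fun A B l => ContinuousLinearMap.adjoint_inner_right A k (B l)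
  simp only [sub_apply, sum_apply, smul_apply, inner_sub_right, inner_sum, inner_smul_right, h1]
  have h2 : ∀ F : Rn n → ℝ, ∀ S : L2 n →L[ℂ] L2 n, ∀ l, (rmul F * S) l = rmul F (S l) :=
    fun _ _ _ => rfl
  simp only [hk, h2, momOp, relOp_apply h (relBdd_wmom h hα₀ hα hw _), res_apply h, sub_apply,
    one_apply_eq_self, smul_apply]
  rw [shift_apply (emb n) (schr w) Complex.I g, add_sub_cancel_right]
  have h3 := sum_inner_weighted_momentum α f g
  have h4 : inner ℂ (emb n (sm (japPow (-α)) f)) (emb n (momentumSq n g)) =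
      inner ℂ (emb n f) (rmul (japPow (-α)) (schr w g)) -
      inner ℂ (emb n f) (rmul (fun x => w x * japPow (-α) x) (emb n g)) := by
    have h5 : rmul (japPow (-α)) (pot w g) = rmul (fun x => w x * japPow (-α) x) (emb n g) := by
      refine Lp.ext ?_
      filter_upwards [bmul_coe hJ (pot w g), pot_coe hα hw g, bmul_coe hwJ (emb n g), emb_coe g]
        with x e1 e2 e3 e4
      rw [e1, e2, e3, e4]
      push_cast
      ring
    rw [← rmul_emb hJ (temperate_japPow _), inner_rmul hJ, ← inner_sub_right, ← h5, ← map_sub,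
      schr_apply, add_sub_cancel_right]
  have h6 : ∀ i : Fin n, inner ℂ (emb n f) (rmul (kinErr α i) (wmom α i g)) =
      inner ℂ (emb n (sm (kinErr α i) f)) (emb n (sm (japPow (-α / 2)) (momentum i g))) := by
    intro i
    rw [← inner_rmul (decays_kinErr hα₀ i).isBddMeas, rmul_emb (decays_kinErr hα₀ i).isBddMeas
      (temperate_kinErr α i)]
    rfl
  simp only [h6]
  rw [← h4]
  exact h3

theorem rmul_add_const {F : Rn n → ℝ} (hF : IsBddMeas fun x => ((F x : ℝ) : ℂ)) (a : ℝ) :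
    (rmul fun x => F x + a) = rmul F + (a : ℂ) • (1 : L2 n →L[ℂ] L2 n) := by
  have h1 : (fun x => ((F x + a : ℝ) : ℂ)) = fun x => ((F x : ℝ) : ℂ) + (a : ℂ) :=
    funext fun x => Complex.ofReal_add _ _
  have h2 := bmul_add hF (isBddMeas_const (n := n) (a : ℂ))
  rw [bmul_const] at h2
  exact (congrArg bmul h1).trans h2

theorem sub_sub_sub_smul_eq {R M N T Z S P : L2 n →L[ℂ] L2 n} {z : ℂ} (hN : N = M + z • 1)
    (hP : P = S - R * (M * T) - Z) : P - z • (R * T) = S - R * (N * T) - Z := by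
  rw [hN, hP, add_mul, mul_add, smul_mul_assoc, one_mul, mul_smul_comm]
  abel

/-- On bounded energies the kinetic energy compensates the repulsion, as `w⟨x⟩^(-α)` tends to `-σ`.
Every other term has a decaying multiplier next to a resolvent; for the term `⟨x⟩^(-α)H R` this is
where `α > 0` enters. -/
theorem cpt_sum_momOp_sub {σ : ℝ} (h : EssSelfAdjoint (emb n) (schr w)) (hα₀ : 0 < α) (hα : α ≤ 2)
    (hw : IsPotential α c w) (hσ : Decays fun x => w x * japPow (-α) x + σ) :
    Cpt (∑ i, adjoint (momOp w α i) * momOp w α i - (σ : ℂ) • (adjoint (res w) * res w)) := by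
  have h1 := (decays_japPow (n := n) (neg_neg_of_pos hα₀)).cpt_adjoint h hα₀.le hα hw
    (1 - Complex.I • res w)
  have h2 := hσ.cpt_adjoint h hα₀.le hα hw (res w)
  have h3 : Cpt (Complex.I • ∑ i, adjoint (res w) * (rmul (kinErr α i) * momOp w α i)) :=
    (Cpt.sum fun i _ => (decays_kinErr hα₀.le i).cpt_adjoint h hα₀.le hα hw (momOp w α i)).smul _
  have e := rmul_add_const (hw.isBddMeas_mul (s := -α) (by linarith)) σ
  have e2 := sub_sub_sub_smul_eq e (sum_momOp h hα₀.le hα hw)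
  have h4 := (h1.sub h2).sub h3
  rwa [← e2] at h4

/-- The positive part of the commutator. -/
def convexPart (w : Rn n → ℝ) (α : ℝ) : L2 n →L[ℂ] L2 n :=
  ∑ i, ∑ j, adjoint (momOp w α i) * (rmul (gradWeight α i j) * momOp w α j) -
    ((1 - α : ℝ) : ℂ) • ∑ i, adjoint (momOp w α i) * momOp w α i

/-- The matrix in question is `α(1 - x⊗x/⟨x⟩²)`, nonnegative by Cauchy–Schwarz and `|x| ≤ ⟨x⟩`. -/
theorem sum_gradWeight_nonneg (hα₀ : 0 ≤ α) (x : Rn n) (a : Fin n → ℂ) :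
    ∃ r : ℝ, 0 ≤ r ∧ ∑ i, ∑ j, inner ℂ (a i) (((gradWeight α i j x : ℝ) : ℂ) * a j) -
      ((1 - α : ℝ) : ℂ) * ∑ i, inner ℂ (a i) (a i) = r := by
  refine ⟨α * (∑ i, ‖a i‖ ^ 2 - japPow (-2) x * ‖∑ i, (x i : ℂ) * a i‖ ^ 2),
    mul_nonneg hα₀ (sub_nonneg.2 ?_), ?_⟩
  · have h1 : ‖∑ i, (x i : ℂ) * a i‖ ^ 2 ≤ ‖x‖ ^ 2 * ∑ i, ‖a i‖ ^ 2 := by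
      have h2 : ‖∑ i, (x i : ℂ) * a i‖ ≤ ∑ i, |x i| * ‖a i‖ :=
        norm_sum_le_of_le _ fun i _ => by rw [norm_mul, Complex.norm_real, Real.norm_eq_abs]
      have h3 := Finset.sum_mul_sq_le_sq_mul_sq Finset.univ (fun i => |x i|) (fun i => ‖a i‖)
      have h4 : ∑ i, |x i| ^ 2 = ‖x‖ ^ 2 := by
        rw [← sum_coord_sq]
        exact Finset.sum_congr rfl fun i _ => by rw [sq_abs, sq]
      rw [h4] at h3
      exact (pow_le_pow_left₀ (norm_nonneg _) h2 2).trans h3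
    have h5 : japPow (-2) x * ‖x‖ ^ 2 ≤ 1 := by
      have h6 : japPow (-2) x * japPow 2 x = 1 := by rw [japPow_mul]; simp [japPow_zero]
      rw [japPow_two] at h6
      nlinarith [japPow_pos (-2) x]
    have h7 : 0 ≤ ∑ i, ‖a i‖ ^ 2 := by positivity
    calc _ ≤ japPow (-2) x * (‖x‖ ^ 2 * ∑ i, ‖a i‖ ^ 2) :=
          mul_le_mul_of_nonneg_left h1 (japPow_pos _ x).le
      _ = (japPow (-2) x * ‖x‖ ^ 2) * ∑ i, ‖a i‖ ^ 2 := by ring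
      _ ≤ _ := mul_le_of_le_one_left h7 h5
  · have h1 : ((‖∑ i, (x i : ℂ) * a i‖ ^ 2 : ℝ) : ℂ) =
        ∑ i, ∑ j, (x i : ℂ) * (x j : ℂ) * (starRingEnd ℂ (a i) * a j) := by
      rw [Complex.ofReal_pow, ← Complex.conj_mul', map_sum, Finset.sum_mul_sum]
      refine Finset.sum_congr rfl fun i _ => Finset.sum_congr rfl fun j _ => ?_
      rw [map_mul, Complex.conj_ofReal]
      ring
    have h2 : ∀ i, inner ℂ (a i) (a i) = ((‖a i‖ ^ 2 : ℝ) : ℂ) := fun i => by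
      rw [inner_self_eq_norm_sq_to_K]
      norm_cast
    have h3 : ∀ i, ∑ j, inner ℂ (a i) (((gradWeight α i j x : ℝ) : ℂ) * a j) =
        ((‖a i‖ ^ 2 : ℝ) : ℂ) - α * japPow (-2) x *
          ∑ j, (x i : ℂ) * (x j : ℂ) * (starRingEnd ℂ (a i) * a j) := fun i => by
      have h4 : ∀ j, inner ℂ (a i) (((gradWeight α i j x : ℝ) : ℂ) * a j) =
          (if j = i then inner ℂ (a i) (a j) else 0) - α * japPow (-2) x *
            ((x i : ℂ) * (x j : ℂ) * (starRingEnd ℂ (a i) * a j)) := fun j => by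
        rw [gradWeight, RCLike.inner_apply, RCLike.inner_apply]
        split_ifs <;> push_cast <;> ring
      simp only [h4]
      rw [Finset.sum_sub_distrib, Finset.sum_ite_eq' Finset.univ i, if_pos (Finset.mem_univ i), h2,
        Finset.mul_sum]
    simp only [h3, h2]
    rw [Finset.sum_sub_distrib, ← Finset.mul_sum, ← h1]
    push_cast
    ring

end Estimate

end

end MourreRepulsive


namespace MourreRepulsive

noncomputable section

/-! ### Algebraic decompositions of the commutator -/

section OperatorAlgebra

variable {E : Type*} [NormedAddCommGroup E] [InnerProductSpace ℂ E]

/-- The constant is the sum of `4(1 - a)s` from the kinetic term and `2as` from the potential, that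
is `2(2 - a)s`. -/
theorem commutator_split {G D D' P R R' Y Z X Q : E →L[ℂ] E} {a s : ℝ}
    (hX : X = (4 : ℂ) • G - Complex.I • D + Complex.I • D' - (2 : ℂ) • (R' * (Y * R)))
    (hZ : Z = Y + ((s * a : ℝ) : ℂ) • 1) (hQ : Q = G - ((1 - a : ℝ) : ℂ) • P) :
    X - (((4 : ℝ) : ℂ) • Q + ((2 * (2 - a) * s : ℝ) : ℂ) • (R' * R)) =
      (4 * (1 - a : ℝ) : ℂ) • (P - (s : ℂ) • (R' * R)) - Complex.I • D + Complex.I • D' -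
        (2 : ℂ) • (R' * (Z * R)) := by
  rw [hX, hZ, hQ, add_mul, mul_add, smul_mul_assoc, one_mul, mul_smul_comm]
  generalize R' * R = T
  generalize R' * (Y * R) = W
  push_cast
  module

theorem positive_split {S S' R Q X T : E →L[ℂ] E} {κ μ : ℝ} (hT : T = S' * (R * S)) :
    S' * (X * S) - ((μ : ℂ) • T + S' * ((X - (((4 : ℝ) : ℂ) • Q + (κ : ℂ) • R)) * S)) =
      ((4 : ℝ) : ℂ) • (S' * (Q * S)) + ((κ - μ : ℝ) : ℂ) • T := by
  rw [sub_mul, add_mul, mul_sub, mul_add, smul_mul_assoc, smul_mul_assoc, mul_smul_comm,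
    mul_smul_comm, ← hT]
  push_cast
  module

theorem sum_split {ι : Type*} {s : Finset ι} (a b c : ι → E →L[ℂ] E) (d : E →L[ℂ] E) (y z : ℂ) :
    ∑ i ∈ s, (y • a i - z • b i + z • c i) - d =
      y • ∑ i ∈ s, a i - z • ∑ i ∈ s, b i + z • ∑ i ∈ s, c i - d := by
  rw [Finset.sum_add_distrib, Finset.sum_sub_distrib, Finset.smul_sum, Finset.smul_sum,
    Finset.smul_sum]

end OperatorAlgebra

/-! ### Positivity and the compact remainder -/

section MourreOperator

open ContinuousLinearMap (adjoint)

variable {n : ℕ} {α c σ : ℝ} {w Y : Rn n → ℝ}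

theorem inner_rmul_eq_integral {g : Rn n → ℝ} (hg : IsBddMeas fun x => ((g x : ℝ) : ℂ))
    (u v : L2 n) : Integrable (fun x => inner ℂ (u x) (((g x : ℝ) : ℂ) * v x)) volume ∧
      inner ℂ u (rmul g v) = ∫ x, inner ℂ (u x) (((g x : ℝ) : ℂ) * v x) := by
  have h1 : (fun x => inner ℂ (u x) ((rmul g v : Rn n → ℂ) x)) =ᵐ[volume]
      fun x => inner ℂ (u x) (((g x : ℝ) : ℂ) * v x) := by
    filter_upwards [bmul_coe hg v] with x hx
    rw [hx]
  exact ⟨(L2.integrable_inner u (rmul g v)).congr h1, (L2.inner_def _ _).trans (integral_congr_ae h1)⟩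

theorem sum_inner_gradWeight_nonneg (hα₀ : 0 ≤ α) (u : Fin n → L2 n) :
    ∃ r : ℝ, 0 ≤ r ∧ ∑ i, ∑ j, inner ℂ (u i) (rmul (gradWeight α i j) (u j)) -
      ((1 - α : ℝ) : ℂ) * ∑ i, inner ℂ (u i) (u i) = r := by
  choose r hr0 hr using fun x => sum_gradWeight_nonneg hα₀ x fun i => u i x
  refine ⟨∫ x, r x, integral_nonneg hr0, ?_⟩
  have hg := fun i j => inner_rmul_eq_integral (isBddMeas_gradWeight (n := n) hα₀ i j) (u i) (u j)
  have hint : Integrable (fun x => ∑ i, ∑ j, inner ℂ (u i x)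
      (((gradWeight α i j x : ℝ) : ℂ) * u j x)) volume :=
    integrable_finsetSum _ fun i _ => integrable_finsetSum _ fun j _ => (hg i j).1
  have hint' : Integrable (fun x => ∑ i, inner ℂ (u i x) (u i x)) volume :=
    integrable_finsetSum _ fun i _ => L2.integrable_inner (u i) (u i)
  rw [← integral_complex_ofReal, ← integral_congr_ae (Filter.Eventually.of_forall hr)]
  rw [integral_sub hint (hint'.const_mul _), integral_const_mul, integral_finsetSum _
    (fun i _ => integrable_finsetSum _ fun j _ => (hg i j).1), integral_finsetSum _
    (fun i _ => L2.integrable_inner (u i) (u i))]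
  refine congrArg₂ _ (Finset.sum_congr rfl fun i _ => ?_)
    (congrArg _ (Finset.sum_congr rfl fun i _ => L2.inner_def _ _))
  rw [integral_finsetSum _ fun j _ => (hg i j).1]
  exact Finset.sum_congr rfl fun j _ => (hg i j).2

theorem isPositive_convexPart (hα₀ : 0 ≤ α) : (convexPart w α).IsPositive := by
  have key : ∀ k : L2 n, ∃ r : ℝ, 0 ≤ r ∧ inner ℂ k (convexPart w α k) = r := fun k => by
    obtain ⟨r, hr, e⟩ := sum_inner_gradWeight_nonneg hα₀ fun i => momOp w α i k
    refine ⟨r, hr, e ▸ ?_⟩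
    have h1 : ∀ A B : L2 n →L[ℂ] L2 n, inner ℂ k ((adjoint A * B) k) =
        inner ℂ (A k) (B k) := fun A B => ContinuousLinearMap.adjoint_inner_right A k (B k)
    rw [convexPart]
    simp only [sub_apply, sum_apply, smul_apply, inner_sub_right, inner_sum, inner_smul_right, h1]
    rfl
  rw [ContinuousLinearMap.isPositive_iff_complex]
  intro k
  obtain ⟨r, hr, e⟩ := key k
  have e2 : inner ℂ (convexPart w α k) k = (r : ℂ) := by
    rw [← inner_conj_symm, e, Complex.conj_ofReal]
  rw [e2]
  exact ⟨by simp, by simpa using hr⟩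

theorem commOp_eq : commOp w α Y =
    (4 : ℂ) • ∑ i, ∑ j, adjoint (momOp w α i) * (rmul (gradWeight α i j) * momOp w α j) -
      Complex.I • ∑ i, adjoint (momOp w α i) * (rmul (divWeight α i) * res w) +
      Complex.I • ∑ i, adjoint (res w) * (rmul (divWeight α i) * momOp w α i) -
      (2 : ℂ) • (adjoint (res w) * (rmul Y * res w)) := by
  exact sum_split _ _ _ _ _ _

/-- What remains after the positive part and the constant is the error of the kinetic replacement,
the terms with `∇ div X`, and the deviation of the field derivative of the potential from `-σα`.
Each is compact by decay. -/
theorem cpt_commOp_sub (h : EssSelfAdjoint (emb n) (schr w)) (hα₀ : 0 < α) (hα : α ≤ 2)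
    (hw : IsPotential α c w) (hσ : Decays fun x => w x * japPow (-α) x + σ)
    (hYb : IsBddMeas fun x => ((Y x : ℝ) : ℂ)) (hY : Decays fun x => Y x + σ * α) :
    Cpt (commOp w α Y - (((4 : ℝ) : ℂ) • convexPart w α +
      ((2 * (2 - α) * σ : ℝ) : ℂ) • (adjoint (res w) * res w))) := by
  have h1 := (cpt_sum_momOp_sub h hα₀ hα hw hσ).smul (4 * (1 - α : ℝ) : ℂ)
  have h2 : Cpt (Complex.I • ∑ i, adjoint (momOp w α i) * (rmul (divWeight α i) * res w)) :=
    (Cpt.sum fun i _ => ((decays_divWeight hα₀.le hα i).cpt h hα₀.le hα hw).mul_left _).smul _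
  have h3 : Cpt (Complex.I • ∑ i, adjoint (res w) * (rmul (divWeight α i) * momOp w α i)) :=
    (Cpt.sum fun i _ => (decays_divWeight hα₀.le hα i).cpt_adjoint h hα₀.le hα hw _).smul _
  have h4 : Cpt ((2 : ℂ) • (adjoint (res w) * (rmul (fun x => Y x + σ * α) * res w))) :=
    (hY.cpt_adjoint h hα₀.le hα hw (res w)).smul _
  have h5 := ((h1.sub h2).add h3).sub h4
  have e := commutator_split (commOp_eq (w := w) (α := α) (Y := Y)) (rmul_add_const hYb (σ * α))
    (rfl : convexPart w α = _)
  rwa [← e] at h5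

/-- The Mourre estimate between bounded operators `S` with `(H + i)⁻¹ S` self-adjoint. -/
theorem exists_cpt_le_adjoint_commOp_mul (h : EssSelfAdjoint (emb n) (schr w)) (hα₀ : 0 < α)
    (hα : α ≤ 2) (hw : IsPotential α c w) (hσ : Decays fun x => w x * japPow (-α) x + σ)
    (hYb : IsBddMeas fun x => ((Y x : ℝ) : ℂ)) (hY : Decays fun x => Y x + σ * α)
    {S T : L2 n →L[ℂ] L2 n} (hT : T = res w * S) (hTs : IsSelfAdjoint T) {μ : ℝ}
    (hμ : μ ≤ 2 * (2 - α) * σ) :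
    ∃ K : L2 n →L[ℂ] L2 n, IsCompactOperator K ∧
      ((μ : ℝ) : ℂ) • T ^ 2 + K ≤ adjoint S * (commOp w α Y * S) := by
  refine ⟨adjoint S * ((commOp w α Y - (((4 : ℝ) : ℂ) • convexPart w α +
      ((2 * (2 - α) * σ : ℝ) : ℂ) • (adjoint (res w) * res w))) * S),
    ((cpt_commOp_sub h hα₀ hα hw hσ hYb hY).mul_right S).mul_left _, ?_⟩
  rw [ContinuousLinearMap.le_def]
  -- As `T` is self-adjoint, `T² = T*T`, which turns the multiple of `R*R` into a multiple of `T²`.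
  -- The surplus `2(2 - α)σ - μ` is nonnegative and is kept as a positive term.
  have hTT : T ^ 2 = adjoint S * (adjoint (res w) * res w * S) := by
    have h1 : star T = star S * star (res w) := by rw [hT, star_mul]
    rw [hTs.star_eq] at h1
    calc T ^ 2 = T * T := sq T
      _ = (star S * star (res w)) * (res w * S) := by rw [← h1, ← hT]
      _ = _ := by simp only [mul_assoc]; rfl
  have hp1 : (adjoint S * (convexPart w α * S)).IsPositive :=
    (isPositive_convexPart hα₀.le).adjoint_conj S
  have hp2 : (T ^ 2).IsPositive := by
    have := ContinuousLinearMap.isPositive_adjoint_comp_self T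
    rw [ContinuousLinearMap.isSelfAdjoint_iff'.1 hTs] at this
    rw [sq]
    exact this
  rw [positive_split hTT]
  exact (hp1.smul_of_nonneg (Complex.zero_le_real.2 (zero_le_four (α := ℝ)))).add
    (hp2.smul_of_nonneg (Complex.zero_le_real.2 (by linarith)))

end MourreOperator

end

end MourreRepulsive


namespace MourreRepulsive

noncomputable section

/-! ### The derivative of the repulsive potential along the field -/

section Repulsive

variable {n : ℕ} {α σ θ : ℝ} {V : Rn n → ℝ}

/-- The derivative `∂_j (|x| ^ α x_j)`. -/
def radD (α : ℝ) (j : Fin n) (x : Rn n) : ℝ := α * (‖x‖ ^ (α - 2) * (x j * x j)) + ‖x‖ ^ α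

theorem norm_rpow_sub_two_mul (hα₀ : 0 < α) (x : Rn n) : ‖x‖ ^ (α - 2) * ‖x‖ ^ 2 = ‖x‖ ^ α := by
  rcases (norm_nonneg x).eq_or_lt with h0 | h0
  · rw [← h0, Real.zero_rpow hα₀.ne']
    simp
  · rw [← Real.rpow_natCast, ← Real.rpow_add h0]
    congr 1
    push_cast
    ring

/-- At the origin `|x|^α` need not be differentiable, but along the axis the product is `|t|^α t`,
with derivative zero because `α > 0`. Away from the origin the chain rule applies to `(|x|²)^(α/2)`.
-/
theorem hasLineDerivAt_norm_rpow_mul (hα₀ : 0 < α) (j : Fin n) (x : Rn n) :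
    HasLineDerivAt ℝ (fun x : Rn n => ‖x‖ ^ α * x j) (radD α j x) x (ej j) := by
  by_cases hx : x = 0
  · subst hx
    have h1 : HasDerivAt (fun t : ℝ => |t| ^ α * t) 0 0 := by
      rw [hasDerivAt_iff_tendsto_slope]
      have h2 : Filter.Tendsto (fun t : ℝ => |t| ^ α) (nhdsWithin 0 {0}ᶜ) (nhds 0) := by
        have h3 : Continuous fun t : ℝ => |t| ^ α :=
          continuous_abs.rpow_const fun _ => Or.inr hα₀.le
        have h4 := h3.tendsto 0
        simp only [abs_zero, Real.zero_rpow hα₀.ne'] at h4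
        exact h4.mono_left nhdsWithin_le_nhds
      refine h2.congr' ?_
      filter_upwards [self_mem_nhdsWithin] with t ht
      have ht' : t ≠ 0 := ht
      rw [slope_def_field]
      field_simp
      simp
    have h2 : HasDerivAt (fun t : ℝ => ‖(0 : Rn n) + t • ej j‖ ^ α * ((0 : Rn n) + t • ej j) j)
        0 0 := by
      have e : (fun t : ℝ => ‖(0 : Rn n) + t • ej j‖ ^ α * ((0 : Rn n) + t • ej j) j) =
          fun t : ℝ => |t| ^ α * t := by
        funext t
        simp [norm_smul]
      rw [e]
      exact h1
    refine HasDerivAt.congr_deriv h2 ?_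
    simp [radD, Real.zero_rpow hα₀.ne']
  · have hpos : 0 < ‖x‖ := norm_pos_iff.2 hx
    have e : (fun x : Rn n => ‖x‖ ^ α) = fun x => (‖x‖ ^ 2) ^ (α / 2) := by
      funext y
      rw [← Real.rpow_natCast, ← Real.rpow_mul (norm_nonneg y)]
      congr 1
      push_cast
      ring
    have h1 : HasLineDerivAt ℝ (fun x : Rn n => ‖x‖ ^ α) (α * (‖x‖ ^ (α - 2) * x j)) x (ej j) := by
      rw [e]
      refine HasDerivAt.congr_deriv (HasDerivAt.rpow_const (p := α / 2) (hasLineDerivAt_normSq x j)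
        (Or.inl (by simpa using hx))) ?_
      simp only [zero_smul, add_zero]
      rw [← Real.rpow_natCast, ← Real.rpow_mul (norm_nonneg x),
        show ((2 : ℕ) : ℝ) * (α / 2 - 1) = α - 2 by push_cast; ring]
      ring
    refine HasDerivAt.congr_deriv
      (HasLineDerivAt.real_mul h1 (hasLineDerivAt_coord x j j)) ?_
    simp only [radD, if_true]
    ring

theorem continuous_norm_rpow (hα₀ : 0 ≤ α) : Continuous fun x : Rn n => ‖x‖ ^ α :=
  continuous_norm.rpow_const fun _ => Or.inr hα₀

theorem norm_rpow_mul_japPow (α : ℝ) (x : Rn n) :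
    ‖x‖ ^ α * japPow (-α) x = (‖x‖ ^ 2 / (1 + ‖x‖ ^ 2)) ^ (α / 2) := by
  rw [Real.div_rpow (by positivity) (by positivity), japPow, neg_div, Real.rpow_neg (by positivity),
    div_eq_mul_inv]
  congr 1
  rw [← Real.rpow_natCast, ← Real.rpow_mul (norm_nonneg x)]
  congr 1
  push_cast
  ring

theorem norm_rpow_mul_japPow_le_one (hα₀ : 0 ≤ α) (x : Rn n) : ‖x‖ ^ α * japPow (-α) x ≤ 1 := by
  rw [norm_rpow_mul_japPow]
  refine Real.rpow_le_one (by positivity) ?_ (by positivity)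
  rw [div_le_one (by positivity)]
  linarith

/-- With `t = |x|²/(1 + |x|²)` in `[0, 1]` the difference is `1 - t^(α/2) ≤ 1 - t`, and `1 - t =
⟨x⟩^(-2)`. -/
theorem abs_one_sub_norm_rpow_mul_japPow_le (hα₀ : 0 ≤ α) (hα : α ≤ 2) (x : Rn n) :
    |1 - ‖x‖ ^ α * japPow (-α) x| ≤ japPow (-2) x := by
  rw [abs_of_nonneg (sub_nonneg.2 (norm_rpow_mul_japPow_le_one hα₀ x)), norm_rpow_mul_japPow]
  have h1 : ‖x‖ ^ 2 / (1 + ‖x‖ ^ 2) ≤ (‖x‖ ^ 2 / (1 + ‖x‖ ^ 2)) ^ (α / 2) := by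
    refine Real.self_le_rpow_of_le_one (by positivity) ?_ (by linarith)
    rw [div_le_one (by positivity)]
    linarith
  have h2 : japPow (-2) x = 1 - ‖x‖ ^ 2 / (1 + ‖x‖ ^ 2) := by
    have h3 : japPow (-2) x * japPow 2 x = 1 := by rw [japPow_mul]; simp [japPow_zero]
    rw [japPow_two] at h3
    have h4 : 0 < 1 + ‖x‖ ^ 2 := by positivity
    field_simp
    linarith
  rw [h2]
  linarith

theorem abs_coord_mul_coord_mul_japPow_le (s : ℝ) (x : Rn n) (j : Fin n) :
    |x j * (x j * japPow (s - 2) x)| ≤ japPow s x := by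
  rw [abs_mul, abs_mul, abs_of_pos (japPow_pos _ x)]
  calc _ ≤ |x j| * japPow (s - 1) x := by
        refine mul_le_mul_of_nonneg_left ?_ (abs_nonneg _)
        exact (abs_coord_mul_japPow_le (s - 2) x j).trans_eq (by congr 1; ring)
    _ ≤ japPow s x := (abs_coord_mul_japPow_le (s - 1) x j).trans_eq (by congr 1; ring)

theorem abs_fieldGrad_self_le (hα₀ : 0 ≤ α) (j : Fin n) (x : Rn n) :
    |fieldGrad α j j x| ≤ 1 + α := by
  have h0 := japPow_le_one (neg_nonpos.2 hα₀) x
  rw [fieldGrad, if_pos rfl]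
  refine (abs_add_le _ _).trans (add_le_add ?_ ?_)
  · rwa [abs_of_pos (japPow_pos _ x)]
  · rw [abs_mul, abs_neg, abs_of_nonneg hα₀]
    exact mul_le_of_le_one_right hα₀ ((abs_coord_mul_coord_mul_japPow_le (-α) x j).trans h0)

theorem abs_radD_mul_japPow_le (hα₀ : 0 < α) (j : Fin n) (x : Rn n) :
    |radD α j x * japPow (-α) x| ≤ α + 1 := by
  have h1 : |radD α j x| ≤ (α + 1) * ‖x‖ ^ α := by
    have h2 : |x j * x j| ≤ ‖x‖ ^ 2 := by
      rw [abs_mul, sq]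
      exact mul_le_mul (abs_coord_le_norm x j) (abs_coord_le_norm x j) (abs_nonneg _) (norm_nonneg x)
    have h3 : |‖x‖ ^ (α - 2) * (x j * x j)| ≤ ‖x‖ ^ α := by
      rw [abs_mul, abs_of_nonneg (by positivity : 0 ≤ ‖x‖ ^ (α - 2)),
        ← norm_rpow_sub_two_mul hα₀ x]
      gcongr
    rw [radD, add_mul, one_mul]
    refine (abs_add_le _ _).trans (add_le_add ?_ (abs_of_nonneg (by positivity)).le)
    rw [abs_mul, abs_of_pos hα₀]
    gcongr
  rw [abs_mul, abs_of_pos (japPow_pos _ x)]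
  calc _ ≤ (α + 1) * ‖x‖ ^ α * japPow (-α) x :=
        mul_le_mul_of_nonneg_right h1 (japPow_pos _ x).le
    _ = (α + 1) * (‖x‖ ^ α * japPow (-α) x) := mul_assoc _ _ _
    _ ≤ (α + 1) * 1 := by
        gcongr
        exact norm_rpow_mul_japPow_le_one hα₀.le x
    _ = _ := mul_one _

/-- The partial derivative `∂_j V`. -/
def partialD (V : Rn n → ℝ) (j : Fin n) (x : Rn n) : ℝ := fderiv ℝ V x (ej j)

/-- The derivatives `∂_j (⟨x⟩ ^ (-α) x_j (V - σ |x| ^ α))`. -/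
def potFieldD (σ α : ℝ) (V : Rn n → ℝ) (j : Fin n) (x : Rn n) : ℝ :=
  -σ * (radD α j x * japPow (-α) x + ‖x‖ ^ α * x j * (-α * (x j * japPow (-α - 2) x))) +
    (partialD V j x * field α j x + V x * fieldGrad α j j x)

/-- The derivative of `V - σ |x| ^ α` along the field `⟨x⟩ ^ (-α) x`. -/
def potField (σ α : ℝ) (V : Rn n → ℝ) (x : Rn n) : ℝ :=
  ∑ j, partialD V j x * field α j x - σ * α * (‖x‖ ^ α * japPow (-α) x)

theorem hasLineDerivAt_potFieldD (hα₀ : 0 < α) (hV : ContDiff ℝ ∞ V) (j : Fin n) (x : Rn n) :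
    HasLineDerivAt ℝ (fun x => totalPot σ α V x * field α j x) (potFieldD σ α V j x) x (ej j) := by
  have e : (fun x => totalPot σ α V x * field α j x) =
      fun x => -σ * (‖x‖ ^ α * x j * japPow (-α) x) + V x * field α j x := by
    funext y
    simp only [totalPot, repulsive, field]
    ring
  rw [e]
  have hVd : HasLineDerivAt ℝ V (partialD V j x) x (ej j) :=
    ((hV.differentiable (by simp)) x).hasFDerivAt.hasLineDerivAt (ej j)
  exact HasLineDerivAt.real_add (HasLineDerivAt.real_const_mul (-σ) (HasLineDerivAt.real_mul
    (hasLineDerivAt_norm_rpow_mul hα₀ j x) (hasLineDerivAt_japPow (-α) x j)))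
    (HasLineDerivAt.real_mul hVd (hasLineDerivAt_field α j j x))

theorem sum_potFieldD (hα₀ : 0 < α) (x : Rn n) :
    ∑ j, potFieldD σ α V j x = potField σ α V x + totalPot σ α V x * fieldDiv α x := by
  have h1 : ∑ j, radD α j x = (α + n) * ‖x‖ ^ α := by
    simp only [radD, Finset.sum_add_distrib, ← Finset.mul_sum, sum_coord_sq,
      norm_rpow_sub_two_mul hα₀, Finset.sum_const, Finset.card_univ, Fintype.card_fin, nsmul_eq_mul]
    ring
  have h2 : ∑ j, ‖x‖ ^ α * x j * (-α * (x j * japPow (-α - 2) x)) =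
      -α * ‖x‖ ^ α * (‖x‖ ^ 2 * japPow (-α - 2) x) := by
    rw [← sum_coord_sq, Finset.sum_mul, Finset.mul_sum]
    exact Finset.sum_congr rfl fun j _ => by ring
  have h3 : (1 + ‖x‖ ^ 2) * japPow (-α - 2) x = japPow (-α) x := by
    rw [← japPow_two, japPow_mul]
    congr 1
    ring
  simp only [potFieldD]
  rw [Finset.sum_add_distrib, ← Finset.mul_sum, Finset.sum_add_distrib, ← Finset.sum_mul, h1, h2,
    Finset.sum_add_distrib, ← Finset.mul_sum, sum_fieldGrad, potField, totalPot, repulsive, fieldDiv]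
  linear_combination σ * α * ‖x‖ ^ α * h3

theorem continuous_partialD (hV : ContDiff ℝ ∞ V) (j : Fin n) : Continuous (partialD V j) :=
  (hV.continuous_fderiv (by simp)).clm_apply continuous_const

theorem continuous_field (α : ℝ) (j : Fin n) : Continuous (field α j : Rn n → ℝ) :=
  continuous_of_temperate (temperate_field α j)

theorem isFieldDeriv_potField (hα₀ : 0 < α) (hV : ContDiff ℝ ∞ V) {B B' : ℝ}
    (hB : ∀ x, |V x| ≤ B) (hB' : ∀ j x, |partialD V j x * field α j x| ≤ B') :
    IsFieldDeriv α (totalPot σ α V) (potField σ α V) (potFieldD σ α V)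
      (|σ| * (α + 1 + α) + (B' + B * (1 + α))) where
  meas j := by
    have h1 : Measurable fun x : Rn n => ‖x‖ ^ (α - 2) * (x j * x j) := by fun_prop
    have h2 := (continuous_norm_rpow (n := n) hα₀.le).measurable
    have h3 : Measurable (radD α j : Rn n → ℝ) := (h1.const_mul α).add h2
    have h4 : Measurable fun x : Rn n => x j := by fun_prop
    exact ((((h3.mul (continuous_japPow _).measurable).add ((h2.mul h4).mul ((h4.mul
      (continuous_japPow _).measurable).const_mul _))).const_mul _).add
      (((continuous_partialD hV j).mul (continuous_field α j)).add (hV.continuous.mul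
        (continuous_of_temperate (temperate_fieldGrad α j j)))).measurable).aestronglyMeasurable
  bound j x := by
    have hB0 : 0 ≤ B := (abs_nonneg _).trans (hB x)
    have h1 : |‖x‖ ^ α * x j * (-α * (x j * japPow (-α - 2) x))| ≤ α := by
      have e : ‖x‖ ^ α * x j * (-α * (x j * japPow (-α - 2) x)) =
          -α * (‖x‖ ^ α * (x j * (x j * japPow (-α - 2) x))) := by ring
      rw [e, abs_mul, abs_neg, abs_of_pos hα₀, abs_mul, abs_of_nonneg (by positivity : 0 ≤ ‖x‖ ^ α)]
      refine mul_le_of_le_one_right hα₀.le (le_trans ?_ (norm_rpow_mul_japPow_le_one hα₀.le x))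
      gcongr
      exact abs_coord_mul_coord_mul_japPow_le (-α) x j
    have h2 : |potFieldD σ α V j x| ≤ |σ| * (α + 1 + α) + (B' + B * (1 + α)) := by
      refine (abs_add_le _ _).trans (add_le_add ?_ ((abs_add_le _ _).trans (add_le_add (hB' j x) ?_)))
      · rw [abs_mul, abs_neg]
        refine mul_le_mul_of_nonneg_left ((abs_add_le _ _).trans (add_le_add ?_ h1)) (abs_nonneg σ)
        exact abs_radD_mul_japPow_le hα₀ j x
      · rw [abs_mul]
        exact mul_le_mul (hB x) (abs_fieldGrad_self_le hα₀.le j x) (abs_nonneg _) hB0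
    exact h2.trans (le_mul_of_one_le_right ((abs_nonneg _).trans h2) (one_le_japPow zero_le_two x))
  deriv j x := hasLineDerivAt_potFieldD hα₀ hV j x
  sum_eq x := sum_potFieldD hα₀ x

theorem continuous_potField (hα₀ : 0 < α) (hV : ContDiff ℝ ∞ V) : Continuous (potField σ α V) :=
  (continuous_finsetSum _ fun j _ => (continuous_partialD hV j).mul (continuous_field α j)).sub
    (continuous_const.mul ((continuous_norm_rpow hα₀.le).mul (continuous_japPow _)))

theorem abs_partialD_mul_field_le {C : ℝ} (hα₀ : 0 ≤ α) {j : Fin n} {x : Rn n}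
    (hC : |partialD V j x| ≤ C * japPow (-(θ + 1)) x) :
    |partialD V j x * field α j x| ≤ C * japPow (-θ) x := by
  have hC0 : 0 ≤ C := nonneg_of_mul_nonneg_left ((abs_nonneg _).trans hC) (japPow_pos _ x)
  rw [abs_mul]
  calc _ ≤ C * japPow (-(θ + 1)) x * japPow (1 - α) x :=
        mul_le_mul hC (abs_field_le α j x) (abs_nonneg _) (mul_nonneg hC0 (japPow_pos _ x).le)
    _ = C * japPow (-θ - α) x := by
        rw [mul_assoc, japPow_mul]
        congr 2
        ring
    _ ≤ _ := mul_le_mul_of_nonneg_left (japPow_le_japPow (by linarith) x) hC0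

/-- The decay of `∇V` more than compensates the growth of the field, and the repulsive part differs
from its limit by `O(⟨x⟩^(-2))`; the bound `θ ≤ 2` merges the two rates. -/
theorem decays_potField_add (hσ : 0 ≤ σ) (hα₀ : 0 < α) (hα : α ≤ 2) (hθ₀ : 0 < θ) (hθ : θ ≤ 2)
    (hV : ContDiff ℝ ∞ V) {C : ℝ} (hC : ∀ j x, |partialD V j x| ≤ C * japPow (-(θ + 1)) x) :
    Decays fun x => potField σ α V x + σ * α := by
  refine decays_of_continuous ((continuous_potField hα₀ hV).add continuous_const)
    (C := n * C + σ * α) hθ₀ fun x => ?_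
  have e : potField σ α V x + σ * α = ∑ j, partialD V j x * field α j x +
      σ * α * (1 - ‖x‖ ^ α * japPow (-α) x) := by
    rw [potField]
    ring
  rw [e, add_mul]
  refine (abs_add_le _ _).trans (add_le_add ?_ ?_)
  · refine (Finset.abs_sum_le_sum_abs _ _).trans
      ((Finset.sum_le_sum fun j _ => abs_partialD_mul_field_le hα₀.le (hC j x)).trans_eq ?_)
    simp [mul_assoc]
  · rw [abs_mul, abs_of_nonneg (by positivity)]
    gcongr
    exact (abs_one_sub_norm_rpow_mul_japPow_le hα₀.le hα x).trans
      (japPow_le_japPow (by linarith) x)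

theorem decays_totalPot_add (hσ : 0 ≤ σ) (hα₀ : 0 < α) (hα : α ≤ 2) (hθ₀ : 0 < θ) (hθ : θ ≤ 2)
    (hV : Continuous V) {C : ℝ} (hC : ∀ x, |V x| ≤ C * japPow (-θ) x) :
    Decays fun x => totalPot σ α V x * japPow (-α) x + σ := by
  have hcont : Continuous fun x => totalPot σ α V x * japPow (-α) x + σ :=
    (((((continuous_norm_rpow hα₀.le).const_mul σ).neg).add hV).mul (continuous_japPow _)).add
      continuous_const
  refine decays_of_continuous hcont (C := σ + C) hθ₀ fun x => ?_
  have e : totalPot σ α V x * japPow (-α) x + σ =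
      σ * (1 - ‖x‖ ^ α * japPow (-α) x) + V x * japPow (-α) x := by
    rw [totalPot, repulsive]
    ring
  rw [e, add_mul]
  refine (abs_add_le _ _).trans (add_le_add ?_ ?_)
  · rw [abs_mul, abs_of_nonneg hσ]
    gcongr
    exact (abs_one_sub_norm_rpow_mul_japPow_le hα₀.le hα x).trans
      (japPow_le_japPow (by linarith) x)
  · rw [abs_mul, abs_of_pos (japPow_pos _ x)]
    exact (mul_le_of_le_one_right (abs_nonneg _) (japPow_le_one (by linarith) x)).trans (hC x)

end Repulsive

end

end MourreRepulsive


namespace MourreRepulsive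

noncomputable section

/-! ### Specialization to the Hamiltonian -/

section Final

variable {n : ℕ} {α c σ θ : ℝ} {w Y V : Rn n → ℝ}

theorem funcCalc_eq_fcalc (h : EssSelfAdjoint (emb n) (schr w)) {H : L2 n →ₗ.[ℂ] L2 n}
    (hH : H.graph = (LinearMap.range ((emb n).prod (schr w))).topologicalClosure) (φ : ℝ → ℝ) :
    funcCalc H φ = fcalc w φ := by
  rw [funcCalc, h.resolventOp_eq hH]
  rfl

theorem commForm_of_eq_res_mul (h : EssSelfAdjoint (emb n) (schr w)) (hα₀ : 0 ≤ α) (hα : α < 2)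
    (hw : IsPotential α c w) {D : Fin n → Rn n → ℝ} {C : ℝ} (hY : IsFieldDeriv α w Y D C)
    (hYb : IsBddMeas fun x => ((Y x : ℝ) : ℂ)) {H : L2 n →ₗ.[ℂ] L2 n}
    (hH : H.graph = (LinearMap.range ((emb n).prod (schr w))).topologicalClosure)
    {S T : L2 n →L[ℂ] L2 n} (hT : T = res w * S) (u v : L2 n)
    (hu : T u ∈ H.domain ⊓ (conjugateOp n α).domain)
    (hv : T v ∈ H.domain ⊓ (conjugateOp n α).domain) :
    inner ℂ u ((ContinuousLinearMap.adjoint S * (commOp w α Y * S)) v) =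
      commForm H (conjugateOp n α) ⟨T u, hu⟩ ⟨T v, hv⟩ := by
  subst hT
  exact (ContinuousLinearMap.adjoint_inner_right S u _).trans
    (commForm_eq h hα₀ hα hw hY hYb hH (k := S u) (l := S v) hu hv).symm

/-- Only derivatives of order zero and one enter: `V` itself in the potential, and `∇V` in the
commutator. -/
theorem exists_abs_le_of_iteratedFDeriv (hV : ContDiff ℝ ∞ V)
    (hVdecay : ∀ k : ℕ, ∃ C R : ℝ, ∀ x : Rn n, R ≤ ‖x‖ →
      ‖iteratedFDeriv ℝ k V x‖ ≤ C * japPow (-θ - k) x) :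
    (∃ C, ∀ x, |V x| ≤ C * japPow (-θ) x) ∧
      ∃ C, ∀ j x, |partialD V j x| ≤ C * japPow (-(θ + 1)) x := by
  constructor
  · refine exists_abs_le_of_decay hV.continuous ?_
    obtain ⟨C, R, h⟩ := hVdecay 0
    exact ⟨C, R, fun x hx => by simpa [norm_iteratedFDeriv_zero] using h x hx⟩
  · obtain ⟨C, R, h⟩ := hVdecay 1
    obtain ⟨C', h'⟩ := exists_abs_le_of_decay (θ := θ + 1) (V := fun x => ‖fderiv ℝ V x‖)
      (hV.continuous_fderiv (by simp)).norm ⟨C, R, fun x hx => by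
        have := h x hx
        rw [norm_iteratedFDeriv_one, Nat.cast_one, show -θ - 1 = -(θ + 1) by ring] at this
        rwa [abs_norm]⟩
    refine ⟨C', fun j x => ((fderiv ℝ V x).le_opNorm (ej j)).trans ?_⟩
    have := h' x
    rw [abs_norm] at this
    simpa using this

end Final

end

end MourreRepulsive

theorem proposition3 (n : ℕ) (hn : 1 ≤ n) (σ α θ : ℝ) (hσ : 0 < σ) (hα₀ : 0 < α) (hα₂ : α < 2)
    (hθ₀ : 0 < θ) (hθ₁ : θ ≤ 1 - α / 2)
    (V : EuclideanSpace ℝ (Fin n) → ℝ) (hV : ContDiff ℝ ∞ V)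
    (hVdecay : ∀ k : ℕ, ∃ C R : ℝ, ∀ x : EuclideanSpace ℝ (Fin n), R ≤ ‖x‖ →
      ‖iteratedFDeriv ℝ k V x‖ ≤ C * japPow (-θ - k) x) :
    IsSelfAdjoint (hamiltonian σ α V) ∧
    ∀ φ : ℝ → ℝ, ContDiff ℝ ∞ φ → HasCompactSupport φ →
      (∀ ψ ∈ (mulOp (n := n) (japPow (1 - α / 2))).domain,
        funcCalc (hamiltonian σ α V) φ ψ ∈
          (hamiltonian σ α V).domain ⊓ (conjugateOp n α).domain) ∧
      ∃ B : L2 n →L[ℂ] L2 n,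
        (∀ (u v : L2 n)
          (hu : funcCalc (hamiltonian σ α V) φ u ∈
            (hamiltonian σ α V).domain ⊓ (conjugateOp n α).domain)
          (hv : funcCalc (hamiltonian σ α V) φ v ∈
            (hamiltonian σ α V).domain ⊓ (conjugateOp n α).domain),
          inner ℂ u (B v) =
            commForm (hamiltonian σ α V) (conjugateOp n α)
              ⟨funcCalc (hamiltonian σ α V) φ u, hu⟩ ⟨funcCalc (hamiltonian σ α V) φ v, hv⟩) ∧
        ∃ K : L2 n →L[ℂ] L2 n, IsCompactOperator K ∧
          ((min (α * σ) ((2 - α) * σ) : ℝ) : ℂ) • (funcCalc (hamiltonian σ α V) φ) ^ 2 + K ≤ B := by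
  obtain ⟨⟨CV, hCV⟩, CD, hCD⟩ := exists_abs_le_of_iteratedFDeriv hV hVdecay
  have hCV0 : 0 ≤ CV := nonneg_of_mul_nonneg_left ((abs_nonneg _).trans (hCV 0)) (japPow_pos _ 0)
  have hB : ∀ x, |V x| ≤ CV := fun x =>
    (hCV x).trans (mul_le_of_le_one_right hCV0 (japPow_le_one (by linarith) x))
  have hB' : ∀ j x, |partialD V j x * field α j x| ≤ CD := fun j x => by
    have hCD0 : 0 ≤ CD :=
      nonneg_of_mul_nonneg_left ((abs_nonneg _).trans (hCD j 0)) (japPow_pos _ 0)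
    exact (abs_partialD_mul_field_le hα₀.le (hCD j x)).trans
      (mul_le_of_le_one_right hCD0 (japPow_le_one (by linarith) x))
  have hw := isPotential_totalPot (n := n) hσ.le hα₀.le hV.continuous hB
  have h := essSelfAdjoint_schr hα₀.le hα₂ hw
  have hH := hamiltonian_graph hσ.le hα₀.le hα₂.le hV.continuous hB
  have hY := isFieldDeriv_potField (σ := σ) hα₀ hV hB hB'
  have hYd := decays_potField_add hσ.le hα₀ hα₂.le hθ₀ (by linarith) hV hCD
  have hwd := decays_totalPot_add hσ.le hα₀ hα₂.le hθ₀ (by linarith) hV.continuous hCV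
  have hYb : IsBddMeas fun x => ((potField σ α V x : ℝ) : ℂ) := by
    simpa using hYd.isBddMeas.add (isBddMeas_const (-(σ * α : ℂ)))
  refine ⟨h.isSelfAdjoint hH, fun φ hφ hc => ?_⟩
  have hT := fcalc_eq h hφ hc
  rw [funcCalc_eq_fcalc h hH φ]
  -- The bounded operator is `S* C S`, with `S = (H + i)φ(H)` and `C` the commutator operator
  -- between resolvents. The minimum enters only through `(2 - α)σ`, which is at most `2(2 - α)σ`.
  refine ⟨fun ψ hψ => ⟨?_, ?_⟩, _, fun u v hu hv =>
    commForm_of_eq_res_mul h hα₀.le hα₂ hw hY hYb hH hT u v hu hv,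
    exists_cpt_le_adjoint_commOp_mul h hα₀ hα₂.le hw hwd hYb hYd hT EssSelfAdjoint.isSelfAdjoint_cfc
      ((min_le_right _ _).trans ?_)⟩
  · rw [hT]
    exact h.resolvent_mem_domain hH _
  · obtain ⟨gψ, hg⟩ := LinearPMap.mem_domain_iff.1 hψ
    rw [mulOp_graph] at hg
    obtain ⟨k, hk⟩ := exists_fcalc_eq_weight_mul_res h hα₀.le hα₂.le hw hφ hc hg
    rw [hk]
    exact weight_mul_res_mem_domain h hα₀.le hα₂.le hw k
  · nlinarith
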